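/- Let $\mathbb D$ be the open unit disc, $\mathbb T$ the unit circle, and $m$ normalized Lebesgue measure on $\mathbb T$. Let $H^2$ be the Hardy space of analytic functions on $\mathbb D$ with $\|f\|_{H^2}^2=\sup_{0<\rho<1}\int_{\mathbb T}|f(\rho\xi)|^2\,dm(\xi)<\infty$, and $H^\infty$ the space of bounded analytic functions on $\mathbb D$; on $\mathbb T$, functions are evaluated by radial limits. A function $f\in H^\infty$ is outer if there is a constant $c$ with $|c|=1$ such that $$f(z)=c\,\exp\Big(\int_{\mathbb T}\frac{\xi+z}{\xi-z}\log|f(\xi)|\,dm(\xi)\Big),\qquad z\in\mathbb D,$$ where $\log|f|\in L^1(\mathbb T)$. Let $a_1$ be a nonzero polynomial of degree $N\ge 0$ all of whose zeros lie on $\mathbb T$. Let $T_{\overline{a_1}}f=P_+(\overline{a_1}f)$ be the co-analytic Toeplitz operator on $H^2$, where $P_+g(z)=\int_{\mathbb T}\frac{g(\xi)}{1-\overline{\xi}z}\,dm(\xi)$, and let $\mathscr M(\overline{a_1})=T_{\overline{a_1}}H^2$, equipped with the range norm $\|F\|=\inf\{\|f\|_{H^2}: f\in H^2,\ T_{\overline{a_1}}f=F\}$.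 A multiplier of a space $\mathcal H$ of functions on $\mathbb D$ is an analytic function $\varphi$ on $\mathbb D$ with $\varphi\mathcal H\subset\mathcal H$. A function $\psi$ is cyclic for the shift $f\mapsto zf$ on $\mathcal H$ if all the functions $z^n\psi$ ($n\ge 0$) belong to $\mathcal H$ and their linear span is dense in $\mathcal H$. Let $\psi=a_1\widetilde\psi+r$, where $\widetilde\psi\in H^2$, $a_1\widetilde\psi\in H^\infty$, and $r$ is a polynomial of degree less than $N$ (so $r=0$ if $N=0$). Then $\psi$ is a multiplier of $\mathscr M(\overline{a_1})$, and the following are equivalent: 1. $\psi\mathscr M(\overline{a_1})$ is dense in $\mathscr M(\overline{a_1})$; 2. $\psi$ is cyclic for the shift on $\mathscr M(\overline{a_1})$; 3. $\psi$ is outer and $\gcd(a_1,r)=1$. The same holds for de Branges--Rovnyak spaces. Let $b$ be a rational function that is analytic on $\mathbb D$ with $|b|\le 1$ there and that has an outer Pythagorean mate $a$, that is, $|a|^2+|b|^2=1$ almost everywhere on $\mathbb T$ (so $b$ is not inner). Suppose that $a_1$ is the polynomial of the zeros of $a$ on $\mathbb T$, counted with multiplicity, up to a nonzero constant factor: $a=a_1\,p/q$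 on $\mathbb D$ with polynomials $p,q$ that have no zeros in $\overline{\mathbb D}$. Let $\mathscr H(b)$ be the reproducing kernel Hilbert space on $\mathbb D$ with kernel $k_w(z)=\dfrac{1-b(z)\overline{b(w)}}{1-\overline w z}$. Then $\psi$ is a multiplier of $\mathscr H(b)$, and $\psi\mathscr H(b)$ is dense in $\mathscr H(b)$ if and only if $\psi$ is cyclic for the shift on $\mathscr H(b)$, if and only if $\psi$ is outer and $\gcd(a_1,r)=1$. -/

import Mathlib

open Filter Topology MeasureTheory Metric ComplexConjugate

noncomputable section

/-! Functions on the open unit disc are represented by functions `ℂ → ℂ`, of which only the values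
on `ball 0 1` matter. The normalized Lebesgue integral over the unit circle is
`Real.circleAverage _ 0 1`. -/

/-- The space `H^∞` of bounded analytic functions on the unit disc. -/
def MemHInfty (f : ℂ → ℂ) : Prop :=
  DifferentiableOn ℂ f (ball 0 1) ∧ ∃ C : ℝ, ∀ z ∈ ball (0 : ℂ) 1, ‖f z‖ ≤ C

/-- The Hardy space `H^2`: analytic functions on the unit disc whose square means over the circles
of radius `ρ < 1` are bounded. -/
def MemH2 (f : ℂ → ℂ) : Prop :=
  DifferentiableOn ℂ f (ball 0 1) ∧
    ∃ C : ℝ, ∀ ρ ∈ Set.Ioo (0 : ℝ) 1, Real.circleAverage (fun z => ‖f z‖ ^ 2) 0 ρ ≤ C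

/-- The norm of `H^2` (meaningful for `f` in `H^2`). -/
def h2Norm (f : ℂ → ℂ) : ℝ :=
  √(⨆ ρ : Set.Ioo (0 : ℝ) 1, Real.circleAverage (fun z => ‖f z‖ ^ 2) 0 ρ)

/-- The radial boundary function of `f` at a point `ξ` of the unit circle. For `f` in `H^2` the limit
exists for almost every `ξ`. -/
def radialLimit (f : ℂ → ℂ) (ξ : ℂ) : ℂ :=
  limUnder (𝓝[<] (1 : ℝ)) (fun ρ : ℝ => f (ρ * ξ))

/-- Outer functions in `H^∞`, the normalization being up to a unimodular constant `c`. -/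
def IsOuter (f : ℂ → ℂ) : Prop :=
  MemHInfty f ∧
    CircleIntegrable (fun ξ => Real.log ‖radialLimit f ξ‖) 0 1 ∧
    ∃ c : ℂ, ‖c‖ = 1 ∧ ∀ z ∈ ball (0 : ℂ) 1,
      f z = c * Complex.exp (Real.circleAverage
        (fun ξ => (ξ + z) / (ξ - z) * (Real.log ‖radialLimit f ξ‖ : ℂ)) 0 1)

/-- The Riesz projection `P₊` of a function `g` on the unit circle onto `H^2`, written as the Cauchy
integral of `g`. -/
def rieszProjection (g : ℂ → ℂ) (z : ℂ) : ℂ :=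
  Real.circleAverage (fun ξ => g ξ / (1 - conj ξ * z)) 0 1

/-- The co-analytic Toeplitz operator `f ↦ P₊ (conj φ * f)`, for a symbol `φ` on the unit circle. -/
def coToeplitz (φ f : ℂ → ℂ) : ℂ → ℂ :=
  rieszProjection (fun ξ => conj (φ ξ) * radialLimit f ξ)

/-- The range of the co-analytic Toeplitz operator with symbol `φ` on `H^2`. -/
def MBar (φ : ℂ → ℂ) : Set (ℂ → ℂ) :=
  {F | ∃ f, MemH2 f ∧ Set.EqOn F (coToeplitz φ f) (ball 0 1)}

/-- The range norm on `MBar φ`. -/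
def rangeNorm (φ F : ℂ → ℂ) : ℝ :=
  sInf {t | ∃ f, MemH2 f ∧ Set.EqOn F (coToeplitz φ f) (ball 0 1) ∧ t = h2Norm f}

/-- `S` is a subset of `MBar φ` which is dense for the range norm. -/
def IsDenseInMBar (φ : ℂ → ℂ) (S : Set (ℂ → ℂ)) : Prop :=
  S ⊆ MBar φ ∧ ∀ F ∈ MBar φ, ∀ ε > 0, ∃ G ∈ S, rangeNorm φ (F - G) < ε

/-- `ψ` is a multiplier of the set `M` of functions on the disc. -/
def IsMultiplier (M : Set (ℂ → ℂ)) (ψ : ℂ → ℂ) : Prop :=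
  DifferentiableOn ℂ ψ (ball 0 1) ∧ ∀ F ∈ M, ψ * F ∈ M

/-- `ψ` is a cyclic vector for the shift `F ↦ z F` on `MBar φ`. -/
def IsCyclicInMBar (φ ψ : ℂ → ℂ) : Prop :=
  IsDenseInMBar φ (Submodule.span ℂ (Set.range fun (n : ℕ) (z : ℂ) => z ^ n * ψ z) : Set (ℂ → ℂ))

/-- `b` coincides on the unit disc with a rational function without poles there. -/
def IsRationalOnDisc (b : ℂ → ℂ) : Prop :=
  ∃ p q : Polynomial ℂ, ∀ z ∈ ball (0 : ℂ) 1, q.eval z ≠ 0 ∧ b z = p.eval z / q.eval z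

/-- `a` is a Pythagorean mate of `b`: it is outer and `|a|^2 + |b|^2 = 1` almost everywhere on the
unit circle. -/
def IsPythagoreanMate (a b : ℂ → ℂ) : Prop :=
  IsOuter a ∧ ∀ᵐ θ : ℝ,
    ‖radialLimit a (circleMap 0 1 θ)‖ ^ 2 + ‖radialLimit b (circleMap 0 1 θ)‖ ^ 2 = 1

/-- Inside the closed unit disc, the rational function `a` has the same zeros as the polynomial `a₁`,
with the same multiplicities, and no poles. -/
def HasZeroPolynomial (a : ℂ → ℂ) (a₁ : Polynomial ℂ) : Prop :=
  ∃ p q : Polynomial ℂ, (∀ z ∈ closedBall (0 : ℂ) 1, p.eval z ≠ 0 ∧ q.eval z ≠ 0) ∧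
    ∀ z ∈ ball (0 : ℂ) 1, a z = a₁.eval z * (p.eval z / q.eval z)

section RKHS

variable (H : Type*) [NormedAddCommGroup H] [InnerProductSpace ℂ H]
  [RKHS ℂ H (ball (0 : ℂ) 1) ℂ]

/-- `H` is the de Branges--Rovnyak space of `b`: the Hilbert space of functions on the unit disc with
reproducing kernel `k_w(z) = (1 - b(z) conj (b(w))) / (1 - conj w * z)`. -/
def IsDeBrangesRovnyak [CompleteSpace H] (b : ℂ → ℂ) : Prop :=
  ∀ z w : ball (0 : ℂ) 1,
    RKHS.kernel H z w 1 = (1 - b z * conj (b w)) / (1 - conj (w : ℂ) * z)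

/-- `ψ` is a multiplier of the function space `H`. -/
def IsMultiplierOf (ψ : ℂ → ℂ) : Prop :=
  DifferentiableOn ℂ ψ (ball 0 1) ∧
    ∀ f : H, ∃ g : H, ∀ z : ball (0 : ℂ) 1, g z = ψ z * f z

/-- The set `ψ H`, as a subset of `H`. -/
def mulSet (ψ : ℂ → ℂ) : Set H :=
  {g | ∃ f : H, ∀ z : ball (0 : ℂ) 1, g z = ψ z * f z}

/-- `ψ` is a cyclic vector for the shift `f ↦ z f` on `H`. -/
def IsCyclicIn (ψ : ℂ → ℂ) : Prop :=
  ∃ u : ℕ → H, (∀ n, ∀ z : ball (0 : ℂ) 1, u n z = (z : ℂ) ^ n * ψ z) ∧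
    Dense (Submodule.span ℂ (Set.range u) : Set H)

end RKHS

end

/-! Identify `H^2` with square summable Taylor sequences (`HardySeq`). Let `A = conjMul a` be the
adjoint of multiplication by `a = a₁`, of degree `N`. The zeros of `a` lie on the circle, so `conj a
= κ a / ξ ^ N` there for a constant `κ`. Projecting onto `H^2` gives `z ^ N * A x = κ * (a * x - p
x)`, where `p x` is a polynomial of degree less than `N` (`exists_isRemainder`). Moreover `A` is
injective, so the range norm of `A x` is `‖x‖`, and every question about the range becomes one about
`x`. An identity of this shape determines both `A x` and `p x` (`eq_of_pow_mul_eq`), since a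
polynomial of degree less than `N` divisible by `z ^ N` is zero.

Multiplying the identity by `ψ = a t + r` and reducing `r * p x` modulo `a` shows that `ψ` is a
multiplier, and that on remainders it acts as multiplication by `r` in `ℂ[X] / (a)` (`exists_mul`).
This makes both conditions necessary. At a common zero of `a` and `r` every product has remainder
zero, a closed condition that the constant `1` violates. And since `A` is bounded and `1` is in the
range, density forces multiples of `ψ` to approximate `1` in `H^2`, which makes `ψ` outer
(`isOuter_of_approx`).

Conversely, let `ψ` be outer and coprime to `a` modulo `a`. The vectors with `p y = 0` are exactly
those in `z ^ N H^2`. The products `a q ψ` correspond to `κ⁻¹ z ^ N ψ q`, and these are dense in `z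
^ N H^2` because polynomial multiples of an outer function are dense in `H^2`. Any remaining vector
is first given remainder zero by subtracting some `Q ψ`, which is possible because `X ^ N * r` is
invertible modulo `a` (`dense_span_orbit`). The orbit span lies inside the set of multiples, so the
two density statements have the same answer (`dense_mulDomain_iff`, `dense_span_orbit_iff`).

For de Branges–Rovnyak spaces, the norm of a combination of kernels is the form `‖x‖² - ‖T_b^* x‖²`
at the same combination of Szegő kernels. This form is comparable to `‖a₁ x‖²`
(`exists_defect_bounds`), so the space is the range of `A` with an equivalent norm (`exists_equiv`),
and the criterion carries over.

The analytic input is Fatou's theorem on radial limits, Parseval's identity, and the description of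
outer functions through Poisson integrals of `log |ψ|`. -/

noncomputable section

/-! ### Radial limits of Poisson integrals -/

/-- The Poisson kernel of the unit disc at a point of modulus `ρ`, as a function of the angle. -/
def poissonAngle (ρ t : ℝ) : ℝ := (1 - ρ ^ 2) / (1 - 2 * ρ * Real.cos t + ρ ^ 2)

/-- The derivative of `poissonAngle ρ`. -/
def poissonAngleDeriv (ρ t : ℝ) : ℝ :=
  -((1 - ρ ^ 2) * (2 * ρ * Real.sin t)) / (1 - 2 * ρ * Real.cos t + ρ ^ 2) ^ 2

lemma poissonAngle_denom_pos {ρ : ℝ} (h0 : 0 < ρ) (h1 : ρ < 1) (t : ℝ) :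
    0 < 1 - 2 * ρ * Real.cos t + ρ ^ 2 := by
  nlinarith [Real.cos_le_one t, sq_pos_of_pos (sub_pos.2 h1)]

lemma hasDerivAt_poissonAngle {ρ : ℝ} (h0 : 0 < ρ) (h1 : ρ < 1) (t : ℝ) :
    HasDerivAt (poissonAngle ρ) (poissonAngleDeriv ρ t) t := by
  have hd : HasDerivAt (fun t => 1 - 2 * ρ * Real.cos t + ρ ^ 2) (2 * ρ * Real.sin t) t := by
    exact ((((Real.hasDerivAt_cos t).const_mul (2 * ρ)).const_sub 1).add_const
      (ρ ^ 2)).congr_deriv (by ring)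
  have := (hasDerivAt_const t (1 - ρ ^ 2)).div hd (poissonAngle_denom_pos h0 h1 t).ne'
  convert! this using 1
  simp [poissonAngleDeriv]

lemma continuous_poissonAngleDeriv {ρ : ℝ} (h0 : 0 < ρ) (h1 : ρ < 1) :
    Continuous (poissonAngleDeriv ρ) := by
  unfold poissonAngleDeriv
  refine Continuous.div (by fun_prop) (by fun_prop) fun t => ?_
  exact (pow_pos (poissonAngle_denom_pos h0 h1 t) 2).ne'

lemma continuous_poissonAngle {ρ : ℝ} (h0 : 0 < ρ) (h1 : ρ < 1) :
    Continuous (poissonAngle ρ) :=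
  continuous_iff_continuousAt.2 fun t => (hasDerivAt_poissonAngle h0 h1 t).continuousAt

lemma poissonAngle_pi {ρ : ℝ} (h0 : 0 < ρ) : poissonAngle ρ Real.pi = (1 - ρ) / (1 + ρ) := by
  have : (1 + ρ) ≠ 0 := by positivity
  rw [poissonAngle, Real.cos_pi, div_eq_div_iff (by nlinarith) this]
  ring

lemma poissonAngle_neg (ρ t : ℝ) : poissonAngle ρ (-t) = poissonAngle ρ t := by
  simp [poissonAngle]

lemma circleAverage_poissonKernel_eq_integral {ρ : ℝ} (θ : ℝ) (g : ℂ → ℝ) :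
    Real.circleAverage (fun ξ => poissonKernel 0 (ρ * circleMap 0 1 θ) ξ * g ξ) 0 1 =
      (2 * Real.pi)⁻¹ * ∫ t in -Real.pi..Real.pi,
        poissonAngle ρ t * g (circleMap 0 1 (θ + t)) := by
  rw [Real.circleAverage_eq_integral_add (θ - Real.pi)]
  have := intervalIntegral.integral_comp_sub_right
    (a := 0) (b := 2 * Real.pi)
    (fun t => poissonAngle ρ t * g (circleMap 0 1 (θ + t))) Real.pi
  rw [show (0 : ℝ) - Real.pi = -Real.pi by ring, show 2 * Real.pi - Real.pi = Real.pi by ring]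
    at this
  rw [← this, smul_eq_mul]
  congr 1
  refine intervalIntegral.integral_congr fun s _ => ?_
  rw [show θ + (s - Real.pi) = s + (θ - Real.pi) by ring]
  congr 1
  set u := s - Real.pi with hu
  rw [show s + (θ - Real.pi) = u + θ by rw [hu]; ring]
  rw [poissonKernel_def, poissonAngle]
  have h1 : circleMap 0 1 (u + θ) - ρ * circleMap 0 1 θ =
      circleMap 0 1 θ * (circleMap 0 1 u - ρ) := by
    simp [circleMap, add_mul, Complex.exp_add]
    ring
  have h2 : ‖circleMap 0 1 u - ρ‖ ^ 2 = 1 - 2 * ρ * Real.cos u + ρ ^ 2 := by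
    rw [← Complex.normSq_eq_norm_sq, Complex.normSq_apply]
    simp [circleMap, Complex.exp_re, Complex.exp_im]
    nlinarith [Real.sin_sq_add_cos_sq u]
  simp only [sub_zero]
  rw [h1, norm_mul (circleMap 0 1 θ), mul_pow ‖circleMap 0 1 θ‖, h2]
  simp

lemma integral_poissonAngle {ρ : ℝ} (h0 : 0 < ρ) (h1 : ρ < 1) :
    ∫ t in -Real.pi..Real.pi, poissonAngle ρ t = 2 * Real.pi := by
  have h := circleAverage_poissonKernel_eq_integral (ρ := ρ) 0 (fun _ => 1)
  have hw : (ρ * circleMap 0 1 0 : ℂ) ∈ ball (0 : ℂ) 1 := by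
    simp [circleMap, abs_of_pos h0, h1]
  have h2 := DiffContOnCl.circleAverage_poissonKernel_smul
    (f := fun _ => (1 : ℂ)) (c := 0) (R := 1) diffContOnCl_const hw
  have h3 : Real.circleAverage (fun ξ => poissonKernel 0 (ρ * circleMap 0 1 0) ξ * 1) 0 1
      = 1 := by
    have h4 : (poissonKernel 0 (ρ * circleMap 0 1 0) • fun _ => (1 : ℂ)) =
        fun ξ => ((poissonKernel 0 (ρ * circleMap 0 1 0) ξ * 1 : ℝ) : ℂ) := by
      ext ξ; simp
    rw [h4, Real.circleAverage_def, intervalIntegral.integral_ofReal] at h2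
    rw [Real.circleAverage_def]
    rw [Complex.real_smul, ← Complex.ofReal_mul] at h2
    exact_mod_cast h2
  rw [h3] at h
  simp only [mul_one] at h
  field_simp at h
  linarith

/-- The kernel decreases away from `0`, so the integrand is `-t` times the derivative. Integration
by parts gives the total mass `2π` plus a boundary term of favourable sign. -/
lemma integral_abs_mul_poissonAngleDeriv_le {ρ : ℝ} (h0 : 0 < ρ) (h1 : ρ < 1) :
    ∫ t in -Real.pi..Real.pi, |t| * |poissonAngleDeriv ρ t| ≤ 2 * Real.pi := by
  have hsgn : ∀ t ∈ Set.uIcc (-Real.pi) Real.pi,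
      |t| * |poissonAngleDeriv ρ t| = -(t * poissonAngleDeriv ρ t) := by
    intro t ht
    rw [Set.uIcc_of_le (by linarith [Real.pi_pos])] at ht
    rw [← abs_mul, abs_of_nonpos]
    have hs : 0 ≤ t * Real.sin t := by
      rcases le_total 0 t with h | h
      · exact mul_nonneg h (Real.sin_nonneg_of_nonneg_of_le_pi h ht.2)
      · exact mul_nonneg_of_nonpos_of_nonpos h (Real.sin_nonpos_of_nonpos_of_neg_pi_le h ht.1)
    have : t * poissonAngleDeriv ρ t =
        -((1 - ρ ^ 2) * (2 * ρ) * (t * Real.sin t) / (1 - 2 * ρ * Real.cos t + ρ ^ 2) ^ 2) := by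
      unfold poissonAngleDeriv; ring
    rw [this, neg_nonpos]
    have : 0 ≤ 1 - ρ ^ 2 := by nlinarith
    positivity
  rw [intervalIntegral.integral_congr hsgn, intervalIntegral.integral_neg,
    intervalIntegral.integral_mul_deriv_eq_deriv_mul (u := fun t => t) (u' := fun _ => 1)
      (v := poissonAngle ρ) (fun t _ => hasDerivAt_id t)
      (fun t _ => hasDerivAt_poissonAngle h0 h1 t) (by simp)
      ((continuous_poissonAngleDeriv h0 h1).intervalIntegrable _ _)]
  simp only [one_mul, integral_poissonAngle h0 h1, poissonAngle_neg, poissonAngle_pi h0]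
  have : 0 ≤ (1 - ρ) / (1 + ρ) := div_nonneg (by linarith) (by linarith)
  nlinarith [Real.pi_pos]

/-- The denominator is `(1 - ρ)² + 2ρ(1 - cos t)`, so it dominates `2ρ(1 - cos t)`. The bound tends
to `0` as `ρ → 1`, which controls the kernel away from the origin. -/
lemma one_sub_cos_sq_mul_poissonAngleDeriv_le {ρ : ℝ} (h0 : 0 < ρ) (h1 : ρ < 1) (t : ℝ) :
    (1 - Real.cos t) ^ 2 * |poissonAngleDeriv ρ t| ≤ (1 - ρ ^ 2) / (2 * ρ) := by
  have hD := poissonAngle_denom_pos h0 h1 t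
  have hc : 0 ≤ 1 - Real.cos t := by linarith [Real.cos_le_one t]
  have hr : 0 ≤ 1 - ρ ^ 2 := by nlinarith
  have hle : 2 * ρ * (1 - Real.cos t) ≤ 1 - 2 * ρ * Real.cos t + ρ ^ 2 := by nlinarith
  have hsq : (2 * ρ * (1 - Real.cos t)) ^ 2 ≤ (1 - 2 * ρ * Real.cos t + ρ ^ 2) ^ 2 := by
    gcongr
  unfold poissonAngleDeriv
  rw [abs_div, abs_neg, abs_of_pos (pow_pos hD 2), abs_mul, abs_of_nonneg hr, abs_mul,
    abs_of_pos (by positivity : 0 < 2 * ρ), mul_div_assoc', div_le_div_iff₀ (by positivity)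
    (by positivity)]
  have hs := Real.abs_sin_le_one t
  calc (1 - Real.cos t) ^ 2 * ((1 - ρ ^ 2) * (2 * ρ * |Real.sin t|)) * (2 * ρ)
      ≤ (1 - Real.cos t) ^ 2 * ((1 - ρ ^ 2) * (2 * ρ * 1)) * (2 * ρ) := by gcongr
    _ = (1 - ρ ^ 2) * (2 * ρ * (1 - Real.cos t)) ^ 2 := by ring
    _ ≤ _ := by gcongr

/-- Integration by parts against the primitive of `h`. As `h` is only integrable, this needs
absolute continuity of the primitive and its almost everywhere derivative. -/
lemma integral_poissonAngle_mul {ρ : ℝ} (h0 : 0 < ρ) (h1 : ρ < 1) {h : ℝ → ℝ}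
    (hh : IntervalIntegrable h volume (-Real.pi) Real.pi) :
    ∫ t in -Real.pi..Real.pi, poissonAngle ρ t * h t =
      (1 - ρ) / (1 + ρ) * (∫ s in 0..Real.pi, h s) - (1 - ρ) / (1 + ρ) * (∫ s in 0..-Real.pi, h s)
      - ∫ t in -Real.pi..Real.pi, poissonAngleDeriv ρ t * ∫ s in 0..t, h s := by
  have hpi := Real.pi_pos
  have hF := hh.absolutelyContinuousOnInterval_intervalIntegral (c := 0)
    (by rw [Set.uIcc_of_le (by linarith)]; constructor <;> linarith)
  have hd : deriv (poissonAngle ρ) = poissonAngleDeriv ρ :=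
    funext fun t => (hasDerivAt_poissonAngle h0 h1 t).deriv
  have hP : AbsolutelyContinuousOnInterval (poissonAngle ρ) (-Real.pi) Real.pi := by
    have h3 := ((continuous_poissonAngleDeriv h0 h1).intervalIntegrable
      (μ := volume) (-Real.pi) Real.pi).absolutelyContinuousOnInterval_intervalIntegral (c := 0)
      (by rw [Set.uIcc_of_le (by linarith)]; constructor <;> linarith)
    have h4 : (fun x => ∫ t in (0 : ℝ)..x, poissonAngleDeriv ρ t) =
        fun x => poissonAngle ρ x - poissonAngle ρ 0 := by
      ext x
      exact intervalIntegral.integral_eq_sub_of_hasDerivAt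
        (fun t _ => hasDerivAt_poissonAngle h0 h1 t)
        ((continuous_poissonAngleDeriv h0 h1).intervalIntegrable _ _)
    rw [h4] at h3
    have h5 : AbsolutelyContinuousOnInterval (fun _ : ℝ => poissonAngle ρ 0)
        (-Real.pi) Real.pi := by
      have := (intervalIntegrable_const (c := (0 : ℝ)) (μ := volume) (a := -Real.pi)
        (b := Real.pi)).absolutelyContinuousOnInterval_intervalIntegral (c := 0)
        (by rw [Set.uIcc_of_le (by linarith)]; constructor <;> linarith)
      exact (LipschitzWith.const (poissonAngle ρ 0)).lipschitzOnWith.absolutelyContinuousOnInterval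
    convert! h3.add h5 using 1
    ext x; simp
  have key := hP.integral_mul_deriv_eq_deriv_mul hF
  rw [hd, poissonAngle_neg, poissonAngle_pi h0] at key
  rw [← key]
  refine intervalIntegral.integral_congr_ae ?_
  filter_upwards [hh.ae_hasDerivAt_integral] with t ht htm
  rw [(ht (Set.uIoc_subset_uIcc htm) 0
    (by rw [Set.uIcc_of_le (by linarith)]; constructor <;> linarith)).deriv]

/-- The Poisson means of a function converge to `0` at a point where the derivative of its
primitive vanishes. -/
lemma tendsto_integral_poissonAngle_mul {h : ℝ → ℝ}
    (hh : IntervalIntegrable h volume (-Real.pi) Real.pi)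
    (hF : HasDerivAt (fun x => ∫ s in 0..x, h s) 0 0) :
    Tendsto (fun ρ => ∫ t in -Real.pi..Real.pi, poissonAngle ρ t * h t) (𝓝[<] 1) (𝓝 0) := by
  have hpi := Real.pi_pos
  set F : ℝ → ℝ := fun x => ∫ s in 0..x, h s with hFdef
  have hFc : ContinuousOn F (Set.uIcc (-Real.pi) Real.pi) :=
    (hh.absolutelyContinuousOnInterval_intervalIntegral (c := 0)
      (by rw [Set.uIcc_of_le (by linarith)]; constructor <;> linarith)).continuousOn
  have hFc' := hFc
  rw [Set.uIcc_of_le (by linarith)] at hFc'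
  obtain ⟨M, hM⟩ := isCompact_Icc.exists_bound_of_continuousOn hFc'
  have hin : ∀ᶠ ρ : ℝ in 𝓝[<] 1, 0 < ρ ∧ ρ < 1 := by
    filter_upwards [Ioo_mem_nhdsLT (show (0 : ℝ) < 1 by norm_num)] with ρ hρ using hρ
  -- Near `0` the vanishing derivative makes the primitive at most `ε|t|`. Elsewhere it is bounded
  -- while `1 - cos t` stays away from `0`. The two terms match the two kernel estimates above.
  have hbound : ∀ ε > 0, ∃ K, ∀ t ∈ Set.Icc (-Real.pi) Real.pi,
      |F t| ≤ ε * |t| + K * (1 - Real.cos t) ^ 2 := by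
    intro ε hε
    have h1 := (hasDerivAt_iff_isLittleO.1 hF).def hε
    have h1' := Metric.eventually_nhds_iff.1 h1
    obtain ⟨δ, hδ, h2⟩ := h1'
    set d := min (δ / 2) 1 with hd
    have hd0 : 0 < d := by positivity
    have hdpi : d ≤ Real.pi := (min_le_right _ _).trans (by linarith [Real.pi_gt_three])
    have hcos : 0 < 1 - Real.cos d := by
      have := Real.cos_lt_cos_of_nonneg_of_le_pi le_rfl hdpi hd0
      rw [Real.cos_zero] at this
      linarith
    have hM0 : 0 ≤ M := (norm_nonneg _).trans (hM 0 ⟨by linarith, by linarith⟩)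
    refine ⟨M / (1 - Real.cos d) ^ 2, fun t ht => ?_⟩
    rcases lt_or_ge |t| d with htd | htd
    · have h3 := h2 (y := t) (by
        rw [dist_zero_right, Real.norm_eq_abs]
        exact htd.trans_le ((min_le_left _ _).trans (by linarith)))
      simp only [F, intervalIntegral.integral_same, sub_zero, smul_zero, Real.norm_eq_abs] at h3
      refine h3.trans ?_
      have : 0 ≤ M / (1 - Real.cos d) ^ 2 * (1 - Real.cos t) ^ 2 := by positivity
      linarith
    · have h4 : 1 - Real.cos d ≤ 1 - Real.cos t := by
        have := Real.cos_le_cos_of_nonneg_of_le_pi hd0.le (abs_le.2 ⟨ht.1, ht.2⟩) htd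
        rw [Real.cos_abs] at this
        linarith
      have h5 : M ≤ M / (1 - Real.cos d) ^ 2 * (1 - Real.cos t) ^ 2 := by
        rw [div_mul_eq_mul_div, le_div_iff₀ (by positivity)]
        gcongr
      have h6 := hM t ht
      rw [Real.norm_eq_abs] at h6
      have : 0 ≤ ε * |t| := by positivity
      linarith
  have hint : ∀ ε > 0, ∃ K, ∀ ρ : ℝ, 0 < ρ → ρ < 1 →
      |∫ t in -Real.pi..Real.pi, poissonAngleDeriv ρ t * F t| ≤
        ε * (2 * Real.pi) + K * ((1 - ρ ^ 2) / (2 * ρ)) := by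
    intro ε hε
    obtain ⟨K, hK⟩ := hbound ε hε
    refine ⟨|K| * (2 * Real.pi), fun ρ h0 h1 => ?_⟩
    have hc := continuous_poissonAngleDeriv h0 h1
    calc |∫ t in -Real.pi..Real.pi, poissonAngleDeriv ρ t * F t|
        ≤ ∫ t in -Real.pi..Real.pi, |poissonAngleDeriv ρ t * F t| :=
          intervalIntegral.abs_integral_le_integral_abs (by linarith)
      _ ≤ ∫ t in -Real.pi..Real.pi, (ε * (|t| * |poissonAngleDeriv ρ t|) +
            |K| * ((1 - ρ ^ 2) / (2 * ρ))) := by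
          refine intervalIntegral.integral_mono_on (by linarith) ?_ ?_ fun t ht => ?_
          · exact ((hc.continuousOn.mul hFc).abs).intervalIntegrable
          · exact Continuous.intervalIntegrable (by fun_prop) _ _
          · have h2 := hK t ht
            have h3 := one_sub_cos_sq_mul_poissonAngleDeriv_le h0 h1 t
            rw [abs_mul]
            calc |poissonAngleDeriv ρ t| * |F t|
                ≤ |poissonAngleDeriv ρ t| * (ε * |t| + |K| * (1 - Real.cos t) ^ 2) := by
                  gcongr
                  refine h2.trans ?_
                  gcongr
                  exact le_abs_self K
              _ = ε * (|t| * |poissonAngleDeriv ρ t|) +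
                  |K| * ((1 - Real.cos t) ^ 2 * |poissonAngleDeriv ρ t|) := by ring
              _ ≤ _ := by gcongr
      _ = ε * (∫ t in -Real.pi..Real.pi, |t| * |poissonAngleDeriv ρ t|) +
            2 * Real.pi * (|K| * ((1 - ρ ^ 2) / (2 * ρ))) := by
          rw [intervalIntegral.integral_add (Continuous.intervalIntegrable (by fun_prop) _ _)
            (by simp), intervalIntegral.integral_const_mul, intervalIntegral.integral_const]
          simp only [smul_eq_mul]
          ring
      _ ≤ _ := by
          have := integral_abs_mul_poissonAngleDeriv_le h0 h1
          have h5 : ε * (∫ t in -Real.pi..Real.pi, |t| * |poissonAngleDeriv ρ t|) ≤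
            ε * (2 * Real.pi) := by gcongr
          linarith
  have hI : Tendsto (fun ρ => ∫ t in -Real.pi..Real.pi, poissonAngleDeriv ρ t * F t)
      (𝓝[<] 1) (𝓝 0) := by
    rw [Metric.tendsto_nhds]
    intro ε hε
    obtain ⟨K, hK⟩ := hint (ε / (4 * Real.pi)) (by positivity)
    have hlim : Tendsto (fun ρ : ℝ => K * ((1 - ρ ^ 2) / (2 * ρ))) (𝓝[<] 1) (𝓝 0) := by
      have : ContinuousAt (fun ρ : ℝ => K * ((1 - ρ ^ 2) / (2 * ρ))) 1 := by
        refine ContinuousAt.mul continuousAt_const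
          (ContinuousAt.div (by fun_prop) (by fun_prop) (by norm_num))
      have h2 := this.tendsto
      norm_num at h2
      exact h2.mono_left nhdsWithin_le_nhds
    filter_upwards [hin, hlim.eventually (gt_mem_nhds (half_pos hε))] with ρ hρ h2
    rw [Real.dist_eq, sub_zero]
    refine (hK ρ hρ.1 hρ.2).trans_lt ?_
    have : ε / (4 * Real.pi) * (2 * Real.pi) = ε / 2 := by field_simp; ring
    linarith
  have hb : Tendsto (fun ρ : ℝ => (1 - ρ) / (1 + ρ)) (𝓝[<] 1) (𝓝 0) := by
    have : ContinuousAt (fun ρ : ℝ => (1 - ρ) / (1 + ρ)) 1 :=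
      ContinuousAt.div (by fun_prop) (by fun_prop) (by norm_num)
    have h2 := this.tendsto
    norm_num at h2
    exact h2.mono_left nhdsWithin_le_nhds
  have hfin := ((hb.mul_const (F Real.pi)).sub (hb.mul_const (F (-Real.pi)))).sub hI
  simp only [zero_mul, sub_zero] at hfin
  refine hfin.congr' ?_
  filter_upwards [hin] with ρ hρ
  exact (integral_poissonAngle_mul hρ.1 hρ.2 hh).symm

lemma circleIntegrable_intervalIntegrable {E : Type*} [NormedAddCommGroup E] {g : ℂ → E}
    (hg : CircleIntegrable g 0 1) (a b : ℝ) :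
    IntervalIntegrable (fun t => g (circleMap 0 1 t)) volume a b :=
  Function.Periodic.intervalIntegrable (T := 2 * Real.pi)
    (fun t => by simp [periodic_circleMap 0 1 t]) Real.two_pi_pos.ne' (t := 0)
    (by simpa [CircleIntegrable] using hg) a b

/-- **Fatou's theorem**: the Poisson integral of an integrable function on the circle has this
function as its radial limit almost everywhere. -/
theorem ae_tendsto_circleAverage_poissonKernel {g : ℂ → ℝ} (hg : CircleIntegrable g 0 1) :
    ∀ᵐ θ : ℝ, Tendsto (fun ρ : ℝ => Real.circleAverage
      (fun ξ => poissonKernel 0 (ρ * circleMap 0 1 θ) ξ * g ξ) 0 1) (𝓝[<] 1)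
      (𝓝 (g (circleMap 0 1 θ))) := by
  have hII := circleIntegrable_intervalIntegrable hg
  have hloc : LocallyIntegrable (fun t => g (circleMap 0 1 t)) volume := by
    rw [locallyIntegrable_iff]
    intro k hk
    obtain ⟨R, hR⟩ := hk.isBounded.subset_closedBall 0
    have := hII (-|R| - 1) (|R| + 1)
    rw [intervalIntegrable_iff_integrableOn_Icc_of_le (by linarith [abs_nonneg R])] at this
    refine this.mono_set (hR.trans ?_)
    rw [Real.closedBall_eq_Icc]
    exact Set.Icc_subset_Icc (by linarith [le_abs_self R]) (by linarith [le_abs_self R])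
  filter_upwards [LocallyIntegrable.ae_hasDerivAt_integral hloc] with θ hθ
  -- Subtracting the value at a Lebesgue point makes the derivative of the primitive zero there. The
  -- kernel has mean one, so the constant is restored at the end.
  set h : ℝ → ℝ := fun t => g (circleMap 0 1 (θ + t)) - g (circleMap 0 1 θ) with hh
  have hi1 : ∀ a b, IntervalIntegrable (fun t => g (circleMap 0 1 (θ + t))) volume a b := by
    intro a b
    have hp : Function.Periodic (fun t => g (circleMap 0 1 (θ + t))) (2 * Real.pi) := fun t => by
      simp only [← add_assoc, periodic_circleMap 0 1 (θ + t)]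
    refine hp.intervalIntegrable Real.two_pi_pos.ne' (t := -θ) ?_ a b
    have := (hII 0 (2 * Real.pi)).comp_sub_right (-θ)
    simp only [sub_neg_eq_add, add_zero, add_comm _ (-θ), add_comm _ θ] at this
    exact this
  have hi : ∀ a b, IntervalIntegrable h volume a b := fun a b => (hi1 a b).sub (by simp)
  have hF : HasDerivAt (fun x => ∫ s in 0..x, h s) 0 0 := by
    have h1 : (fun x => ∫ s in 0..x, h s) = fun x =>
        (∫ s in θ..(θ + x), g (circleMap 0 1 s)) - x * g (circleMap 0 1 θ) := by
      ext x
      rw [hh, intervalIntegral.integral_sub (hi1 _ _) (by simp),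
        intervalIntegral.integral_comp_add_left (fun s => g (circleMap 0 1 s))]
      simp
    rw [h1]
    have h2 : HasDerivAt (fun x => ∫ s in θ..(θ + x), g (circleMap 0 1 s))
        (g (circleMap 0 1 θ)) 0 := by
      have := hθ θ
      rw [show θ = θ + 0 by ring] at this
      have h3 := HasDerivAt.comp_const_add θ 0 this
      simpa using h3
    have h4 := h2.sub ((hasDerivAt_id (0 : ℝ)).mul_const (g (circleMap 0 1 θ)))
    exact h4.congr_deriv (by simp)
  have hlim := tendsto_integral_poissonAngle_mul (hi _ _) hF
  have hlim2 := (hlim.const_mul (2 * Real.pi)⁻¹).add_const (g (circleMap 0 1 θ))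
  simp only [mul_zero, zero_add] at hlim2
  refine hlim2.congr' ?_
  filter_upwards [Ioo_mem_nhdsLT (show (0 : ℝ) < 1 by norm_num)] with ρ hρ
  rw [circleAverage_poissonKernel_eq_integral]
  have hc := (continuous_poissonAngle hρ.1 hρ.2)
  have h5 : ∫ t in -Real.pi..Real.pi, poissonAngle ρ t * h t =
      (∫ t in -Real.pi..Real.pi, poissonAngle ρ t * g (circleMap 0 1 (θ + t))) -
        2 * Real.pi * g (circleMap 0 1 θ) := by
    simp only [hh, mul_sub]
    rw [intervalIntegral.integral_sub ((hi1 _ _).continuousOn_mul hc.continuousOn)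
      (Continuous.intervalIntegrable (by fun_prop) _ _), intervalIntegral.integral_mul_const,
      integral_poissonAngle hρ.1 hρ.2]
  rw [h5]
  have := Real.pi_pos.ne'
  field_simp
  ring

/-! ### Circle averages -/

lemma circleAverage_congr_ae {E : Type*} [NormedAddCommGroup E] [NormedSpace ℝ E] {f g : ℂ → E}
    {R : ℝ} (h : ∀ᵐ θ : ℝ, f (circleMap 0 R θ) = g (circleMap 0 R θ)) :
    Real.circleAverage f 0 R = Real.circleAverage g 0 R := by
  rw [Real.circleAverage_def, Real.circleAverage_def]
  congr 1
  refine intervalIntegral.integral_congr_ae ?_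
  filter_upwards [h] with θ hθ _ using hθ

lemma circleIntegrable_congr_ae {E : Type*} [NormedAddCommGroup E] {f g : ℂ → E}
    {R : ℝ} (hf : CircleIntegrable f 0 R)
    (h : ∀ᵐ θ : ℝ, f (circleMap 0 R θ) = g (circleMap 0 R θ)) : CircleIntegrable g 0 R :=
  IntervalIntegrable.congr_ae hf (ae_restrict_of_ae h)

lemma circleAverage_ofReal (f : ℂ → ℝ) (R : ℝ) :
    Real.circleAverage (fun ξ => (f ξ : ℂ)) 0 R = ((Real.circleAverage f 0 R : ℝ) : ℂ) := by
  rw [Real.circleAverage_def, Real.circleAverage_def, intervalIntegral.integral_ofReal]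
  simp

lemma circleIntegrable_ofReal {f : ℂ → ℝ} {R : ℝ} (hf : CircleIntegrable f 0 R) :
    CircleIntegrable (fun ξ => (f ξ : ℂ)) 0 R := by
  simp only [CircleIntegrable, intervalIntegrable_iff] at hf ⊢
  exact Complex.ofRealCLM.integrable_comp hf

lemma norm_circleAverage_le (f : ℂ → ℂ) (R : ℝ) :
    ‖Real.circleAverage f 0 R‖ ≤ Real.circleAverage (fun ξ => ‖f ξ‖) 0 R := by
  rw [Real.circleAverage_def, Real.circleAverage_def, norm_smul, smul_eq_mul, Real.norm_eq_abs,
    abs_of_pos (by positivity)]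
  gcongr
  exact intervalIntegral.norm_integral_le_integral_norm Real.two_pi_pos.le

lemma circleAverage_mono_ae {f g : ℂ → ℝ} {R : ℝ} (hf : CircleIntegrable f 0 R)
    (hg : CircleIntegrable g 0 R)
    (h : ∀ᵐ θ : ℝ, f (circleMap 0 R θ) ≤ g (circleMap 0 R θ)) :
    Real.circleAverage f 0 R ≤ Real.circleAverage g 0 R := by
  rw [Real.circleAverage_def, Real.circleAverage_def, smul_eq_mul, smul_eq_mul]
  gcongr
  exact intervalIntegral.integral_mono_ae Real.two_pi_pos.le hf hg h

/-- Dominated convergence for circle averages. -/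
lemma tendsto_circleAverage_of_dominated {E ι : Type*} [NormedAddCommGroup E] [NormedSpace ℝ E]
    {l : Filter ι} [l.IsCountablyGenerated] {F : ι → ℂ → E} {f : ℂ → E} {R : ℝ} (bound : ℂ → ℝ)
    (hF : ∀ᶠ i in l, CircleIntegrable (F i) 0 R)
    (hb : ∀ᶠ i in l, ∀ᵐ θ : ℝ, ‖F i (circleMap 0 R θ)‖ ≤ bound (circleMap 0 R θ))
    (hbi : CircleIntegrable bound 0 R)
    (hlim : ∀ᵐ θ : ℝ, Tendsto (fun i => F i (circleMap 0 R θ)) l (𝓝 (f (circleMap 0 R θ)))) :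
    Tendsto (fun i => Real.circleAverage (F i) 0 R) l (𝓝 (Real.circleAverage f 0 R)) := by
  simp only [Real.circleAverage_def]
  refine Tendsto.const_smul ?_ _
  refine intervalIntegral.tendsto_integral_filter_of_dominated_convergence
    (fun θ => bound (circleMap 0 R θ)) ?_ ?_ hbi ?_
  · filter_upwards [hF] with i hi using (intervalIntegrable_iff.1 hi).aestronglyMeasurable
  · filter_upwards [hb] with i hi
    filter_upwards [hi] with θ h _ using h
  · filter_upwards [hlim] with θ h _ using h

lemma circleIntegrable_of_bounded {E : Type*} [NormedAddCommGroup E] {f : ℂ → E} {R : ℝ} {C : ℝ}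
    (hm : AEStronglyMeasurable (fun θ => f (circleMap 0 R θ))
      (volume.restrict (Set.uIoc 0 (2 * Real.pi))))
    (hb : ∀ᵐ θ : ℝ, ‖f (circleMap 0 R θ)‖ ≤ C) : CircleIntegrable f 0 R := by
  rw [CircleIntegrable, intervalIntegrable_iff]
  refine Integrable.mono' (g := fun _ => C) (intervalIntegrable_iff.1 (by simp)) hm (ae_restrict_of_ae hb)

/-- Geometric expansion of the kernel. With `w = conj ξ` it reads off the nonnegative Fourier
coefficients, with `w = ξ` the nonpositive ones. -/
lemma hasSum_circleAverage_div_one_sub {G w : ℂ → ℂ} (hG : CircleIntegrable G 0 1)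
    (hw : Continuous w) (hw1 : ∀ θ, ‖w (circleMap 0 1 θ)‖ ≤ 1) {z : ℂ} (hz : ‖z‖ < 1) :
    HasSum (fun n : ℕ => Real.circleAverage (fun ξ => w ξ ^ n * G ξ) 0 1 * z ^ n)
      (Real.circleAverage (fun ξ => G ξ / (1 - w ξ * z)) 0 1) := by
  have h := intervalIntegral.hasSum_integral_of_dominated_convergence (a := 0) (b := 2 * Real.pi)
    (μ := volume)
    (F := fun (n : ℕ) θ => (w (circleMap 0 1 θ) * z) ^ n * G (circleMap 0 1 θ))
    (f := fun θ => G (circleMap 0 1 θ) / (1 - w (circleMap 0 1 θ) * z))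
    (fun n θ => ‖z‖ ^ n * ‖G (circleMap 0 1 θ)‖) ?_ ?_ ?_ ?_ ?_
  · have h2 := h.const_smul (2 * Real.pi)⁻¹
    convert! h2 using 2 with n
    rw [Real.circleAverage_def, smul_mul_assoc, ← intervalIntegral.integral_mul_const]
    congr 2
    ext θ
    ring
  · intro n
    refine (Continuous.aestronglyMeasurable ?_).mul
      (intervalIntegrable_iff.1 hG).aestronglyMeasurable
    have := continuous_circleMap 0 1
    fun_prop
  · intro n
    refine ae_of_all _ fun θ _ => ?_
    rw [norm_mul, norm_pow, norm_mul]
    gcongr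
    exact mul_le_of_le_one_left (norm_nonneg _) (hw1 θ)
  · exact ae_of_all _ fun θ _ =>
      (summable_geometric_of_lt_one (norm_nonneg _) hz).mul_right _
  · simp only [tsum_mul_right]
    exact hG.norm.const_mul _
  · refine ae_of_all _ fun θ _ => ?_
    have h1 : ‖w (circleMap 0 1 θ) * z‖ < 1 := by
      rw [norm_mul]
      exact (mul_le_of_le_one_left (norm_nonneg _) (hw1 θ)).trans_lt hz
    have := (hasSum_geometric_of_norm_lt_one h1).mul_right (G (circleMap 0 1 θ))
    rwa [inv_mul_eq_div] at this

/-! ### The sequence space model of the Hardy space -/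

/-- Square summable sequences of Taylor coefficients. -/
abbrev HardySeq : Type := lp (fun _ : ℕ => ℂ) 2

/-- The analytic function on the unit disc with given Taylor coefficients. -/
def hardyEval (x : HardySeq) (z : ℂ) : ℂ := ∑' n, x n * z ^ n

lemma HardySeq.norm_coeff_le (x : HardySeq) (n : ℕ) : ‖x n‖ ≤ ‖x‖ :=
  lp.norm_apply_le_norm two_ne_zero x n

lemma HardySeq.hasSum_norm_sq (x : HardySeq) : HasSum (fun n => ‖x n‖ ^ 2) (‖x‖ ^ 2) := by
  have := lp.hasSum_norm (p := 2) (by norm_num) x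
  simpa using this

lemma HardySeq.memℓp {ι : Type*} {c : ι → ℂ} (h : Summable fun n => ‖c n‖ ^ 2) : Memℓp c 2 := by
  refine (memℓp_gen_iff (by norm_num)).2 ?_
  simpa using h

lemma summable_norm_hardyEval (x : HardySeq) {z : ℂ} (hz : ‖z‖ < 1) :
    Summable fun n => ‖x n * z ^ n‖ := by
  refine Summable.of_nonneg_of_le (fun _ => norm_nonneg _) (fun n => ?_)
    ((summable_geometric_of_lt_one (norm_nonneg z) hz).mul_left ‖x‖)
  rw [norm_mul, norm_pow]
  gcongr
  exact x.norm_coeff_le n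

lemma hasSum_hardyEval (x : HardySeq) {z : ℂ} (hz : ‖z‖ < 1) :
    HasSum (fun n => x n * z ^ n) (hardyEval x z) :=
  (summable_norm_hardyEval x hz).of_norm.hasSum

lemma hardyEval_add (x y : HardySeq) {z : ℂ} (hz : ‖z‖ < 1) :
    hardyEval (x + y) z = hardyEval x z + hardyEval y z := by
  refine (hasSum_hardyEval _ hz).unique ?_
  convert (hasSum_hardyEval x hz).add (hasSum_hardyEval y hz) using 2 with n
  simp [add_mul]

lemma hardyEval_smul (c : ℂ) (x : HardySeq) {z : ℂ} (hz : ‖z‖ < 1) :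
    hardyEval (c • x) z = c * hardyEval x z := by
  refine (hasSum_hardyEval _ hz).unique ?_
  have h := (hasSum_hardyEval x hz).mul_left c
  simp only [← mul_assoc] at h
  exact h

lemma hardyEval_neg (x : HardySeq) {z : ℂ} (hz : ‖z‖ < 1) :
    hardyEval (-x) z = -hardyEval x z := by
  rw [← neg_one_smul ℂ, hardyEval_smul _ _ hz, neg_one_mul]

lemma hardyEval_sub (x y : HardySeq) {z : ℂ} (hz : ‖z‖ < 1) :
    hardyEval (x - y) z = hardyEval x z - hardyEval y z := by
  rw [sub_eq_add_neg, hardyEval_add _ _ hz, hardyEval_neg _ hz, sub_eq_add_neg]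

lemma hardyEval_zero_left (z : ℂ) : hardyEval 0 z = 0 := by simp [hardyEval]

lemma hardyEval_zero_right (x : HardySeq) : hardyEval x 0 = x 0 := by
  refine (hasSum_hardyEval x (by simp)).unique ?_
  have h := hasSum_single (f := fun n => x n * (0 : ℂ) ^ n) 0 fun n hn => by simp [hn]
  simpa using h

lemma differentiableOn_hardyEval (x : HardySeq) :
    DifferentiableOn ℂ (hardyEval x) (ball 0 1) := by
  intro z hz
  rw [mem_ball_zero_iff] at hz
  obtain ⟨r, hr1, hr2⟩ := exists_between hz
  have h := Complex.differentiableOn_tsum_of_summable_norm (U := ball (0 : ℂ) r)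
    (F := fun n z => x n * z ^ n) (u := fun n => ‖x‖ * r ^ n)
    ((summable_geometric_of_lt_one ((norm_nonneg z).trans hr1.le) hr2).mul_left _)
    (fun n => by fun_prop) isOpen_ball (fun n w hw => ?_)
  · exact ((h z (by simpa using hr1)).differentiableAt
      (isOpen_ball.mem_nhds (by simpa using hr1))).differentiableWithinAt
  · rw [norm_mul, norm_pow]
    rw [mem_ball_zero_iff] at hw
    gcongr
    exact x.norm_coeff_le n

/-- Riesz–Fischer: extend the coefficients by zero to the negative integers and take the `L²`
function with this Fourier series. -/
lemma exists_boundary_function (x : HardySeq) : ∃ G : ℂ → ℂ, CircleIntegrable G 0 1 ∧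
    CircleIntegrable (fun ξ => ‖G ξ‖ ^ 2) 0 1 ∧
    (∀ n : ℕ, Real.circleAverage (fun ξ => conj ξ ^ n * G ξ) 0 1 = x n) ∧
    (∀ n : ℕ, Real.circleAverage (fun ξ => ξ ^ (n + 1) * G ξ) 0 1 = 0) ∧
    Real.circleAverage (fun ξ => ‖G ξ‖ ^ 2) 0 1 = ‖x‖ ^ 2 := by
  have : Fact (0 < 2 * Real.pi) := ⟨Real.two_pi_pos⟩
  have hinj : Function.Injective (fun n : ℕ => (n : ℤ)) := Nat.cast_injective
  have hext : (fun m : ℤ => ‖Function.extend (fun n : ℕ => (n : ℤ)) (x : ℕ → ℂ) 0 m‖ ^ 2) =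
      Function.extend (fun n : ℕ => (n : ℤ)) (fun n => ‖x n‖ ^ 2) 0 := by
    ext m
    by_cases hm : ∃ n : ℕ, (n : ℤ) = m
    · obtain ⟨n, rfl⟩ := hm
      have h1 := hinj.extend_apply (x : ℕ → ℂ) 0 n
      have h2 := hinj.extend_apply (fun n => ‖x n‖ ^ 2) 0 n
      simp only at h1 h2
      rw [h1, h2]
    · rw [Function.extend_apply' _ _ _ hm, Function.extend_apply' _ _ _ hm]
      simp
  have hsum : HasSum (fun m : ℤ =>
      ‖Function.extend (fun n : ℕ => (n : ℤ)) (x : ℕ → ℂ) 0 m‖ ^ 2) (‖x‖ ^ 2) := by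
    rw [hext]
    exact (hasSum_extend_zero hinj).2 x.hasSum_norm_sq
  let y : lp (fun _ : ℤ => ℂ) 2 := ⟨_, HardySeq.memℓp hsum.summable⟩
  let g : Lp ℂ 2 (AddCircle.haarAddCircle (T := 2 * Real.pi)) := fourierBasis.repr.symm y
  have hcoef : ∀ m : ℤ, fourierCoeff g m =
      Function.extend (fun n : ℕ => (n : ℤ)) (x : ℕ → ℂ) 0 m := by
    intro m
    rw [← fourierBasis_repr]
    simp [g, y]
  have hmem : MemLp (fun θ : ℝ => g (θ : AddCircle (2 * Real.pi))) 2
      (volume.restrict (Set.Ioc 0 (0 + 2 * Real.pi))) :=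
    (memLp_haarAddCircle_iff.1 (Lp.memLp g)).comp_measurePreserving
      (AddCircle.measurePreserving_mk (2 * Real.pi) 0)
  -- A function on the additive circle becomes one on the unit circle through `arg`, which recovers
  -- the angle modulo `2π`.
  have hG : ∀ θ : ℝ, g ((Complex.arg (circleMap 0 1 θ) : ℝ) : AddCircle (2 * Real.pi)) =
      g (θ : AddCircle (2 * Real.pi)) := by
    intro θ
    have h := Complex.arg_cos_add_sin_mul_I_coe_angle (θ : Real.Angle)
    have h2 : circleMap 0 1 θ = Real.Angle.cos θ + Real.Angle.sin θ * Complex.I := by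
      simp [circleMap, Complex.exp_mul_I]
    rw [h2]
    exact congrArg g h
  rw [zero_add] at hmem
  have hIoc : Set.uIoc 0 (2 * Real.pi) = Set.Ioc 0 (2 * Real.pi) :=
    Set.uIoc_of_le Real.two_pi_pos.le
  have hfour : ∀ (m : ℤ) (w : ℂ → ℂ),
      (∀ θ : ℝ, w (circleMap 0 1 θ) = fourier (-m) (θ : AddCircle (2 * Real.pi))) →
      Real.circleAverage (fun ξ => w ξ *
        g ((Complex.arg ξ : ℝ) : AddCircle (2 * Real.pi))) 0 1 = fourierCoeff g m := by
    intro m w hw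
    rw [fourierCoeff_eq_intervalIntegral _ _ 0, Real.circleAverage_def, zero_add, one_div]
    simp only [hG, hw, smul_eq_mul]
  refine ⟨fun ξ => g ((Complex.arg ξ : ℝ) : AddCircle (2 * Real.pi)), ?_, ?_, ?_, ?_, ?_⟩
  · simp only [CircleIntegrable, hG, intervalIntegrable_iff, hIoc]
    exact hmem.integrable one_le_two
  · simp only [CircleIntegrable, hG, intervalIntegrable_iff, hIoc]
    exact hmem.norm.integrable_sq
  · intro n
    rw [hfour n (fun ξ => conj ξ ^ n), hcoef]
    · exact hinj.extend_apply _ _ n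
    · intro θ
      rw [fourier_coe_apply, circleMap_zero, Complex.ofReal_one, one_mul, ← Complex.exp_conj,
        ← Complex.exp_nat_mul]
      congr 1
      simp
      field_simp
  · intro n
    rw [hfour (-(n + 1)) (fun ξ => ξ ^ (n + 1)), hcoef, Function.extend_apply']
    · rfl
    · rintro ⟨k, hk⟩
      omega
    · intro θ
      rw [fourier_coe_apply, circleMap_zero, Complex.ofReal_one, one_mul, ← Complex.exp_nat_mul]
      congr 1
      simp
      field_simp
  · have h1 := (hasSum_sq_fourierCoeff g).unique (by simpa only [hcoef] using hsum)
    rw [← h1, AddCircle.integral_haarAddCircle, Real.circleAverage_def]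
    congr 1
    have := AddCircle.intervalIntegral_preimage (2 * Real.pi) 0 (fun t => ‖g t‖ ^ 2)
    rw [zero_add] at this
    rw [← this]
    simp only [hG]

/-! ### Boundary values of Hardy functions -/

lemma continuousOn_poissonKernel {z : ℂ} (hz : ‖z‖ < 1) :
    ContinuousOn (poissonKernel 0 z) (sphere 0 |1|) := by
  rw [poissonKernel_eq_re_herglotzRieszKernel]
  exact Complex.continuous_re.comp_continuousOn
    (continuousOn_herglotzRieszKernel_sphere (by simpa using hz))

/-- The Poisson kernel is the Cauchy kernel plus its conjugate, minus the constant term counted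
twice. This is the form to which the Fourier coefficients apply. -/
lemma poissonKernel_eq_add {z ξ : ℂ} (hz : ‖z‖ < 1) (hξ : ‖ξ‖ = 1) :
    (poissonKernel 0 z ξ : ℂ) = 1 / (1 - conj ξ * z) + 1 / (1 - ξ * conj z) - 1 := by
  have hξ0 : ξ ≠ 0 := by rintro rfl; simp at hξ
  have hc : ξ * conj ξ = 1 := by rw [Complex.mul_conj, Complex.normSq_eq_norm_sq, hξ]; simp
  have hne : ∀ w : ℂ, ‖w‖ < 1 → 1 - w ≠ 0 := by
    rintro w hw h
    rw [← sub_eq_zero.1 h] at hw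
    simp at hw
  have h1 : 1 - conj ξ * z ≠ 0 := hne _ (by simpa [hξ] using hz)
  have h2 : 1 - ξ * conj z ≠ 0 := hne _ (by simpa [hξ] using hz)
  have h3 : ((‖ξ - z‖ ^ 2 : ℝ) : ℂ) = (1 - conj ξ * z) * (1 - ξ * conj z) := by
    rw [← Complex.normSq_eq_norm_sq, ← Complex.mul_conj, map_sub]
    linear_combination (1 - z * conj z) * hc
  have h4 : ((‖z‖ ^ 2 : ℝ) : ℂ) = z * conj z := by
    rw [← Complex.normSq_eq_norm_sq, ← Complex.mul_conj]
  rw [poissonKernel_def]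
  simp only [sub_zero, hξ]
  rw [Complex.ofReal_div, h3, Complex.ofReal_sub, h4, div_add_div _ _ h1 h2, div_sub_one
    (mul_ne_zero h1 h2)]
  congr 1
  push_cast
  linear_combination (z * conj z) * hc

lemma poissonKernel_pos {z ξ : ℂ} (hz : ‖z‖ < 1) (hξ : ‖ξ‖ = 1) : 0 < poissonKernel 0 z ξ := by
  rw [poissonKernel_def]
  simp only [sub_zero, hξ]
  have h1 : 0 < ‖ξ - z‖ := by
    rw [norm_pos_iff, sub_ne_zero]
    rintro rfl
    linarith
  have h2 : 0 < 1 ^ 2 - ‖z‖ ^ 2 := by nlinarith [norm_nonneg z]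
  positivity

lemma circleAverage_poissonKernel {z : ℂ} (hz : ‖z‖ < 1) :
    Real.circleAverage (poissonKernel 0 z) 0 1 = 1 := by
  have h := DiffContOnCl.circleAverage_poissonKernel_smul
    (f := fun _ => (1 : ℂ)) (c := 0) (R := 1) diffContOnCl_const (w := z) (by simpa using hz)
  have h2 : (poissonKernel 0 z • fun _ => (1 : ℂ)) = fun ξ => ((poissonKernel 0 z ξ : ℝ) : ℂ) := by
    ext ξ; simp
  rw [h2, circleAverage_ofReal] at h
  exact_mod_cast h

/-- **Fatou's theorem** for complex functions. -/
theorem ae_tendsto_circleAverage_poissonKernel_complex {G : ℂ → ℂ} (hG : CircleIntegrable G 0 1) :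
    ∀ᵐ θ : ℝ, Tendsto (fun ρ : ℝ => Real.circleAverage
      (fun ξ => (poissonKernel 0 (ρ * circleMap 0 1 θ) ξ : ℂ) * G ξ) 0 1) (𝓝[<] 1)
      (𝓝 (G (circleMap 0 1 θ))) := by
  have hre : CircleIntegrable (fun ξ => (G ξ).re) 0 1 := by
    simp only [CircleIntegrable, intervalIntegrable_iff] at hG ⊢
    exact Complex.reCLM.integrable_comp hG
  have him : CircleIntegrable (fun ξ => (G ξ).im) 0 1 := by
    simp only [CircleIntegrable, intervalIntegrable_iff] at hG ⊢
    exact Complex.imCLM.integrable_comp hG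
  filter_upwards [ae_tendsto_circleAverage_poissonKernel hre,
    ae_tendsto_circleAverage_poissonKernel him] with θ h1 h2
  have h3 := ((Complex.continuous_ofReal.tendsto _).comp h1).add
    (((Complex.continuous_ofReal.tendsto _).comp h2).mul_const Complex.I)
  rw [Complex.re_add_im] at h3
  refine h3.congr' ?_
  filter_upwards [Ioo_mem_nhdsLT (show (0 : ℝ) < 1 by norm_num)] with ρ hρ
  have hz : ‖(ρ * circleMap 0 1 θ : ℂ)‖ < 1 := by simp [abs_of_pos hρ.1, hρ.2]
  have hk := continuousOn_poissonKernel hz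
  have e1 : CircleIntegrable (fun ξ => ((poissonKernel 0 (ρ * circleMap 0 1 θ) ξ * (G ξ).re : ℝ) : ℂ))
    0 1 := circleIntegrable_ofReal (hre.continuousOn_mul hk)
  have e2 : CircleIntegrable (fun ξ => Complex.I •
      ((poissonKernel 0 (ρ * circleMap 0 1 θ) ξ * (G ξ).im : ℝ) : ℂ)) 0 1 :=
    (circleIntegrable_ofReal (him.continuousOn_mul hk)).const_smul
  simp only [Function.comp_apply]
  rw [← circleAverage_ofReal, ← circleAverage_ofReal, mul_comm _ Complex.I, ← smul_eq_mul
    (Complex.I), ← Real.circleAverage_fun_smul, ← Real.circleAverage_fun_add e1 e2]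
  congr 1
  ext ξ
  push_cast
  conv_rhs => rw [← Complex.re_add_im (G ξ)]
  rw [smul_eq_mul]
  ring

/-- The Cauchy kernel yields the power series. Since the negative coefficients vanish, the conjugate
kernel contributes only the mean, which the `-1` cancels. -/
lemma circleAverage_poissonKernel_mul_eq_hardyEval {x : HardySeq} {G : ℂ → ℂ}
    (hG : CircleIntegrable G 0 1)
    (h1 : ∀ n : ℕ, Real.circleAverage (fun ξ => conj ξ ^ n * G ξ) 0 1 = x n)
    (h2 : ∀ n : ℕ, Real.circleAverage (fun ξ => ξ ^ (n + 1) * G ξ) 0 1 = 0)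
    {z : ℂ} (hz : ‖z‖ < 1) :
    Real.circleAverage (fun ξ => (poissonKernel 0 z ξ : ℂ) * G ξ) 0 1 = hardyEval x z := by
  have hne : ∀ w : ℂ, ‖w‖ < 1 → 1 - w ≠ 0 := by
    rintro w hw h
    rw [← sub_eq_zero.1 h] at hw
    simp at hw
  have s1 := hasSum_circleAverage_div_one_sub hG (w := fun ξ => conj ξ) (by fun_prop)
    (by simp) hz
  have s2 := hasSum_circleAverage_div_one_sub hG (w := fun ξ => ξ) (by fun_prop)
    (by simp) (z := conj z) (by simpa using hz)
  have e1 : Real.circleAverage (fun ξ => G ξ / (1 - conj ξ * z)) 0 1 = hardyEval x z := by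
    refine s1.unique ?_
    simp only [h1]
    exact hasSum_hardyEval x hz
  have e2 : Real.circleAverage (fun ξ => G ξ / (1 - ξ * conj z)) 0 1 =
      Real.circleAverage G 0 1 := by
    refine s2.unique ?_
    have := hasSum_single (f := fun n : ℕ =>
      Real.circleAverage (fun ξ => ξ ^ n * G ξ) 0 1 * conj z ^ n) 0 fun n hn => ?_
    · simpa using this
    · obtain ⟨m, rfl⟩ := Nat.exists_eq_succ_of_ne_zero hn
      simp only [Nat.succ_eq_add_one, h2, zero_mul]
  have i1 : CircleIntegrable (fun ξ => G ξ / (1 - conj ξ * z)) 0 1 := by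
    simp only [div_eq_mul_inv]
    refine hG.mul_continuousOn (ContinuousOn.inv₀ (by fun_prop) fun ξ hξ => hne _ ?_)
    simp only [mem_sphere_iff_norm, sub_zero, abs_one] at hξ
    simpa [hξ] using hz
  have i2 : CircleIntegrable (fun ξ => G ξ / (1 - ξ * conj z)) 0 1 := by
    simp only [div_eq_mul_inv]
    refine hG.mul_continuousOn (ContinuousOn.inv₀ (by fun_prop) fun ξ hξ => hne _ ?_)
    simp only [mem_sphere_iff_norm, sub_zero, abs_one] at hξ
    simpa [hξ] using hz
  have : Real.circleAverage (fun ξ => (poissonKernel 0 z ξ : ℂ) * G ξ) 0 1 =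
      Real.circleAverage (fun ξ => (G ξ / (1 - conj ξ * z) + G ξ / (1 - ξ * conj z)) - G ξ) 0 1 := by
    refine Real.circleAverage_congr_sphere fun ξ hξ => ?_
    simp only [mem_sphere_iff_norm, sub_zero, abs_one] at hξ
    simp only [poissonKernel_eq_add hz hξ]
    ring
  have i3 : CircleIntegrable (fun ξ => G ξ / (1 - conj ξ * z) + G ξ / (1 - ξ * conj z)) 0 1 :=
    i1.add i2
  rw [this, Real.circleAverage_fun_sub i3 hG, Real.circleAverage_fun_add i1 i2, e1, e2]
  ring

lemma radialLimit_eq_of_tendsto {f : ℂ → ℂ} {ξ a : ℂ}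
    (h : Tendsto (fun ρ : ℝ => f (ρ * ξ)) (𝓝[<] 1) (𝓝 a)) : radialLimit f ξ = a :=
  h.limUnder_eq

lemma eventually_radius_mem_ball {ξ : ℂ} (hξ : ‖ξ‖ = 1) :
    ∀ᶠ ρ : ℝ in 𝓝[<] 1, (ρ : ℂ) * ξ ∈ ball (0 : ℂ) 1 := by
  filter_upwards [Ioo_mem_nhdsLT (show (0 : ℝ) < 1 by norm_num)] with ρ hρ
  simp [hξ, abs_of_pos hρ.1, hρ.2]

lemma radialLimit_congr {f g : ℂ → ℂ} (h : Set.EqOn f g (ball 0 1)) {ξ : ℂ} (hξ : ‖ξ‖ = 1) :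
    radialLimit f ξ = radialLimit g ξ := by
  unfold radialLimit limUnder
  congr 1
  refine Filter.map_congr ?_
  filter_upwards [eventually_radius_mem_ball hξ] with ρ hρ using h hρ

lemma tendsto_radius (ξ : ℂ) : Tendsto (fun ρ : ℝ => (ρ : ℂ) * ξ) (𝓝[<] 1) (𝓝 ξ) := by
  have : Continuous fun ρ : ℝ => (ρ : ℂ) * ξ := by fun_prop
  have h := this.tendsto 1
  simp only [Complex.ofReal_one, one_mul] at h
  exact h.mono_left nhdsWithin_le_nhds

lemma radialLimit_of_continuousWithinAt {f : ℂ → ℂ} {ξ : ℂ} (hξ : ‖ξ‖ = 1)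
    (h : ContinuousWithinAt f (closedBall 0 1) ξ) : radialLimit f ξ = f ξ := by
  refine radialLimit_eq_of_tendsto (h.tendsto.comp (tendsto_nhdsWithin_iff.2
    ⟨tendsto_radius ξ, ?_⟩))
  filter_upwards [eventually_radius_mem_ball hξ] with ρ hρ using ball_subset_closedBall hρ

/-- Radial limits of a function of the Hardy space exist almost everywhere, and they form a square
integrable function with the expected Fourier coefficients. -/
theorem hardyEval_boundary (x : HardySeq) :
    (∀ᵐ θ : ℝ, Tendsto (fun ρ : ℝ => hardyEval x (ρ * circleMap 0 1 θ)) (𝓝[<] 1)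
      (𝓝 (radialLimit (hardyEval x) (circleMap 0 1 θ)))) ∧
    CircleIntegrable (radialLimit (hardyEval x)) 0 1 ∧
    CircleIntegrable (fun ξ => ‖radialLimit (hardyEval x) ξ‖ ^ 2) 0 1 ∧
    (∀ n : ℕ, Real.circleAverage (fun ξ => conj ξ ^ n * radialLimit (hardyEval x) ξ) 0 1 = x n) ∧
    (∀ z : ℂ, ‖z‖ < 1 → Real.circleAverage
      (fun ξ => (poissonKernel 0 z ξ : ℂ) * radialLimit (hardyEval x) ξ) 0 1 = hardyEval x z) ∧
    Real.circleAverage (fun ξ => ‖radialLimit (hardyEval x) ξ‖ ^ 2) 0 1 = ‖x‖ ^ 2 := by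
  obtain ⟨G, hG, hG2, h1, h2, h3⟩ := exists_boundary_function x
  have hlim : ∀ᵐ θ : ℝ, Tendsto (fun ρ : ℝ => hardyEval x (ρ * circleMap 0 1 θ)) (𝓝[<] 1)
      (𝓝 (G (circleMap 0 1 θ))) := by
    filter_upwards [ae_tendsto_circleAverage_poissonKernel_complex hG] with θ hθ
    refine hθ.congr' ?_
    filter_upwards [eventually_radius_mem_ball (ξ := circleMap 0 1 θ) (by simp)] with ρ hρ
    exact circleAverage_poissonKernel_mul_eq_hardyEval hG h1 h2 (by simpa using hρ)
  have heq : ∀ᵐ θ : ℝ, radialLimit (hardyEval x) (circleMap 0 1 θ) = G (circleMap 0 1 θ) := by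
    filter_upwards [hlim] with θ hθ using radialLimit_eq_of_tendsto hθ
  have heq' : ∀ᵐ θ : ℝ, G (circleMap 0 1 θ) = radialLimit (hardyEval x) (circleMap 0 1 θ) := by
    filter_upwards [heq] with θ hθ using hθ.symm
  refine ⟨?_, circleIntegrable_congr_ae hG heq', circleIntegrable_congr_ae hG2 ?_, fun n => ?_,
    fun z hz => ?_, ?_⟩
  · filter_upwards [hlim, heq] with θ h h' using h' ▸ h
  · filter_upwards [heq] with θ hθ using by rw [hθ]
  · rw [← h1 n]
    refine circleAverage_congr_ae ?_
    filter_upwards [heq] with θ hθ using by rw [hθ]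
  · rw [← circleAverage_poissonKernel_mul_eq_hardyEval hG h1 h2 hz]
    refine circleAverage_congr_ae ?_
    filter_upwards [heq] with θ hθ using by rw [hθ]
  · rw [← h3]
    refine circleAverage_congr_ae ?_
    filter_upwards [heq] with θ hθ using by rw [hθ]

/-- **Parseval's identity** on the circle of radius `ρ < 1`. -/
lemma hasSum_circleAverage_norm_sq {f : ℂ → ℂ} {c : ℕ → ℂ}
    (hf : DifferentiableOn ℂ f (ball 0 1))
    (h : ∀ z ∈ ball (0 : ℂ) 1, HasSum (fun n => c n * z ^ n) (f z)) {ρ : ℝ} (h0 : 0 < ρ)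
    (h1 : ρ < 1) :
    HasSum (fun n => ‖c n * (ρ : ℂ) ^ n‖ ^ 2) (Real.circleAverage (fun z => ‖f z‖ ^ 2) 0 ρ) := by
  have hρ : (ρ : ℂ) ∈ ball (0 : ℂ) 1 := by simp [abs_of_pos h0, h1]
  -- The dilation `f (ρ z)` has absolutely summable, hence square summable, coefficients. It is
  -- continuous up to the circle, so its radial limits are its values.
  have hs : Summable fun n => ‖c n * (ρ : ℂ) ^ n‖ := (h _ hρ).summable.norm
  have hm : Memℓp (fun n => c n * (ρ : ℂ) ^ n) 2 :=
    ((memℓp_gen_iff (p := 1) (by norm_num)).2 (by simpa using hs)).of_exponent_ge (by norm_num)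
  let x : HardySeq := ⟨_, hm⟩
  have hxe : ∀ z : ℂ, ‖z‖ < 1 → hardyEval x z = f (ρ * z) := by
    intro z hz
    have hz' : (ρ : ℂ) * z ∈ ball (0 : ℂ) 1 := by
      simp only [mem_ball_zero_iff, norm_mul, Complex.norm_real, Real.norm_eq_abs, abs_of_pos h0]
      nlinarith [norm_nonneg z]
    refine (hasSum_hardyEval x hz).unique ?_
    convert h _ hz' using 2 with n
    simp only [x]
    ring
  have hrl : ∀ θ : ℝ, radialLimit (hardyEval x) (circleMap 0 1 θ) = f (ρ * circleMap 0 1 θ) := by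
    intro θ
    rw [radialLimit_congr (g := fun z => f (ρ * z)) (fun z hz => hxe z (by simpa using hz))
      (by simp)]
    have hmem : (ρ : ℂ) * circleMap 0 1 θ ∈ ball (0 : ℂ) 1 := by simp [abs_of_pos h0, h1]
    have hc : ContinuousAt (fun z => f (ρ * z)) (circleMap 0 1 θ) :=
      ContinuousAt.comp (f := fun z : ℂ => (ρ : ℂ) * z)
        (hf.differentiableAt (isOpen_ball.mem_nhds hmem)).continuousAt (by fun_prop)
    exact radialLimit_of_continuousWithinAt (by simp) hc.continuousWithinAt
  have := (hardyEval_boundary x).2.2.2.2.2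
  rw [Real.circleAverage_eq_circleAverage_zero_one]
  have e : Real.circleAverage (fun z => ‖f (ρ * z + 0)‖ ^ 2) 0 1 = ‖x‖ ^ 2 := by
    rw [← this]
    refine circleAverage_congr_ae (ae_of_all _ fun θ => ?_)
    simp only [hrl, add_zero]
  rw [e]
  exact x.hasSum_norm_sq

lemma hasSum_circleAverage_hardyEval (x : HardySeq) {ρ : ℝ} (h0 : 0 < ρ) (h1 : ρ < 1) :
    HasSum (fun n => ‖x n * (ρ : ℂ) ^ n‖ ^ 2)
      (Real.circleAverage (fun z => ‖hardyEval x z‖ ^ 2) 0 ρ) :=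
  hasSum_circleAverage_norm_sq (differentiableOn_hardyEval x)
    (fun z hz => hasSum_hardyEval x (by simpa using hz)) h0 h1

lemma circleAverage_hardyEval_le (x : HardySeq) {ρ : ℝ} (h0 : 0 < ρ) (h1 : ρ < 1) :
    Real.circleAverage (fun z => ‖hardyEval x z‖ ^ 2) 0 ρ ≤ ‖x‖ ^ 2 := by
  refine hasSum_le (fun n => ?_) (hasSum_circleAverage_hardyEval x h0 h1) x.hasSum_norm_sq
  rw [norm_mul, norm_pow, Complex.norm_real, Real.norm_eq_abs, abs_of_pos h0]
  gcongr
  exact mul_le_of_le_one_right (norm_nonneg _) (pow_le_one₀ h0.le h1.le)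

/-- Parseval bounds each finite sum with weights `ρ ^ (2n)`; then `ρ → 1`. -/
lemma sum_norm_sq_le_of_circleAverage_le {f : ℂ → ℂ} {c : ℕ → ℂ} {C : ℝ}
    (hf : DifferentiableOn ℂ f (ball 0 1))
    (h : ∀ z ∈ ball (0 : ℂ) 1, HasSum (fun n => c n * z ^ n) (f z))
    (hC : ∀ ρ ∈ Set.Ioo (0 : ℝ) 1, Real.circleAverage (fun z => ‖f z‖ ^ 2) 0 ρ ≤ C)
    (s : Finset ℕ) : ∑ n ∈ s, ‖c n‖ ^ 2 ≤ C := by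
  have hcont : Continuous fun ρ : ℝ => ∑ n ∈ s, ‖c n * (ρ : ℂ) ^ n‖ ^ 2 := by fun_prop
  have hlim := hcont.tendsto 1
  simp only [Complex.ofReal_one, one_pow, mul_one] at hlim
  refine le_of_tendsto (hlim.mono_left (nhdsWithin_le_nhds (s := Set.Iio 1))) ?_
  filter_upwards [Ioo_mem_nhdsLT (show (0 : ℝ) < 1 by norm_num)] with ρ hρ
  have hs := hasSum_circleAverage_norm_sq hf h hρ.1 hρ.2
  exact (sum_le_hasSum s (fun _ _ => by positivity) hs).trans (hC ρ hρ)

lemma memH2_hardyEval (x : HardySeq) : MemH2 (hardyEval x) :=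
  ⟨differentiableOn_hardyEval x, ‖x‖ ^ 2, fun _ hρ => circleAverage_hardyEval_le x hρ.1 hρ.2⟩

lemma circleAverage_norm_sq_congr {f g : ℂ → ℂ} (h : Set.EqOn f g (ball 0 1)) {ρ : ℝ}
    (hρ : ρ ∈ Set.Ioo (0 : ℝ) 1) : Real.circleAverage (fun z => ‖f z‖ ^ 2) 0 ρ =
      Real.circleAverage (fun z => ‖g z‖ ^ 2) 0 ρ := by
  refine Real.circleAverage_congr_sphere fun z hz => ?_
  simp only [mem_sphere_iff_norm, sub_zero, abs_of_pos hρ.1] at hz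
  simp only [h (show z ∈ ball (0 : ℂ) 1 by simpa [hz] using hρ.2)]

lemma MemH2.congr {f g : ℂ → ℂ} (hf : MemH2 f) (h : Set.EqOn g f (ball 0 1)) : MemH2 g := by
  obtain ⟨h1, C, hC⟩ := hf
  refine ⟨h1.congr h, C, fun ρ hρ => ?_⟩
  rw [circleAverage_norm_sq_congr h hρ]
  exact hC ρ hρ

lemma MemH2.exists_hardyEval {f : ℂ → ℂ} (hf : MemH2 f) :
    ∃ x : HardySeq, Set.EqOn f (hardyEval x) (ball 0 1) := by
  obtain ⟨h1, C, hC⟩ := hf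
  let c : ℕ → ℂ := fun n => ((n.factorial : ℂ))⁻¹ * iteratedDeriv n f 0
  have hs : ∀ z ∈ ball (0 : ℂ) 1, HasSum (fun n => c n * z ^ n) (f z) := by
    intro z hz
    have := Complex.hasSum_taylorSeries_on_ball h1 hz
    convert! this using 2 with n
    simp [c]
    ring
  have hsum : Summable fun n => ‖c n‖ ^ 2 :=
    summable_of_sum_le (fun _ => by positivity) (sum_norm_sq_le_of_circleAverage_le h1 hs hC)
  let x : HardySeq := ⟨c, HardySeq.memℓp hsum⟩
  exact ⟨x, fun z hz => (hs z hz).unique (hasSum_hardyEval x (by simpa using hz))⟩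

lemma norm_sq_le_of_circleAverage_le {x : HardySeq} {C : ℝ}
    (hC : ∀ ρ ∈ Set.Ioo (0 : ℝ) 1, Real.circleAverage (fun z => ‖hardyEval x z‖ ^ 2) 0 ρ ≤ C) :
    ‖x‖ ^ 2 ≤ C :=
  le_of_tendsto' x.hasSum_norm_sq (sum_norm_sq_le_of_circleAverage_le
    (differentiableOn_hardyEval x) (fun z hz => hasSum_hardyEval x (by simpa using hz)) hC)

lemma hardyEval_injective {x y : HardySeq}
    (h : Set.EqOn (hardyEval x) (hardyEval y) (ball 0 1)) : x = y := by
  rw [← sub_eq_zero, ← norm_eq_zero]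
  have h0 : Set.EqOn (hardyEval (x - y)) (fun _ => 0) (ball 0 1) := fun z hz => by
    rw [hardyEval_sub _ _ (by simpa using hz), h hz, sub_self]
  have := norm_sq_le_of_circleAverage_le (x := x - y) (C := 0) fun ρ hρ => by
    rw [circleAverage_norm_sq_congr h0 hρ]
    simp [Real.circleAverage_const]
  exact pow_eq_zero_iff two_ne_zero |>.1 (le_antisymm this (by positivity))

lemma h2Norm_eq {f : ℂ → ℂ} {x : HardySeq} (h : Set.EqOn f (hardyEval x) (ball 0 1)) :
    h2Norm f = ‖x‖ := by
  have : Nonempty (Set.Ioo (0 : ℝ) 1) := ⟨⟨1 / 2, by norm_num⟩⟩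
  have hb : ∀ ρ : Set.Ioo (0 : ℝ) 1, Real.circleAverage (fun z => ‖f z‖ ^ 2) 0 ρ ≤ ‖x‖ ^ 2 :=
    fun ρ => by
      rw [circleAverage_norm_sq_congr h ρ.2]
      exact circleAverage_hardyEval_le x ρ.2.1 ρ.2.2
  have : (⨆ ρ : Set.Ioo (0 : ℝ) 1, Real.circleAverage (fun z => ‖f z‖ ^ 2) 0 ρ) = ‖x‖ ^ 2 := by
    refine le_antisymm (ciSup_le hb) (norm_sq_le_of_circleAverage_le fun ρ hρ => ?_)
    rw [← circleAverage_norm_sq_congr h hρ]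
    exact le_ciSup (f := fun ρ : Set.Ioo (0 : ℝ) 1 =>
      Real.circleAverage (fun z => ‖f z‖ ^ 2) 0 ρ) ⟨_, Set.forall_mem_range.2 hb⟩ ⟨ρ, hρ⟩
  rw [h2Norm, this, Real.sqrt_sq (norm_nonneg _)]

/-! ### Bounded analytic functions -/

lemma MemHInfty.nonneg_of_bound {f : ℂ → ℂ} {C : ℝ} (hC : ∀ z ∈ ball (0 : ℂ) 1, ‖f z‖ ≤ C) :
    0 ≤ C := (norm_nonneg _).trans (hC 0 (by simp))

lemma MemHInfty.congr {f g : ℂ → ℂ} (hf : MemHInfty f) (h : Set.EqOn g f (ball 0 1)) :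
    MemHInfty g :=
  ⟨hf.1.congr h, hf.2.imp fun C hC z hz => by rw [h hz]; exact hC z hz⟩

lemma circleAverage_norm_sq_mul_le {f g : ℂ → ℂ} {C : ℝ} (hC : ∀ z ∈ ball (0 : ℂ) 1, ‖f z‖ ≤ C)
    (hf : DifferentiableOn ℂ f (ball 0 1)) (hg : DifferentiableOn ℂ g (ball 0 1))
    {ρ : ℝ} (hρ : ρ ∈ Set.Ioo (0 : ℝ) 1) :
    Real.circleAverage (fun z => ‖f z * g z‖ ^ 2) 0 ρ ≤
      C ^ 2 * Real.circleAverage (fun z => ‖g z‖ ^ 2) 0 ρ := by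
  have hC0 := MemHInfty.nonneg_of_bound hC
  have hs : sphere (0 : ℂ) |ρ| ⊆ ball 0 1 := fun z hz => by
    rw [mem_sphere_zero_iff_norm, abs_of_pos hρ.1] at hz
    simpa [hz] using hρ.2
  rw [← smul_eq_mul (C ^ 2), ← Real.circleAverage_fun_smul]
  refine Real.circleAverage_mono (ContinuousOn.circleIntegrable' ?_)
    (ContinuousOn.circleIntegrable' ?_) fun z hz => ?_
  · exact (((hf.mul hg).continuousOn.mono hs).norm).pow 2
  · exact (((hg.continuousOn.mono hs).norm).pow 2).const_smul (C ^ 2)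
  · rw [norm_mul, mul_pow, smul_eq_mul]
    gcongr
    exact hC z (hs hz)

lemma MemH2.mul_left {f g : ℂ → ℂ} (hf : MemHInfty f) (hg : MemH2 g) :
    MemH2 fun z => f z * g z := by
  obtain ⟨hfd, C, hC⟩ := hf
  obtain ⟨hgd, D, hD⟩ := hg
  refine ⟨hfd.mul hgd, C ^ 2 * D, fun ρ hρ => (circleAverage_norm_sq_mul_le hC hfd hgd hρ).trans ?_⟩
  gcongr
  exact hD ρ hρ

/-- The constant function `1` as an element of the Hardy space. -/
def hardyOne : HardySeq := lp.single 2 0 1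

lemma hardyEval_hardyOne (z : ℂ) : hardyEval hardyOne z = 1 := by
  unfold hardyEval
  rw [tsum_eq_single 0 fun n hn => by simp [hardyOne, hn]]
  simp [hardyOne]

lemma MemHInfty.memH2 {f : ℂ → ℂ} (hf : MemHInfty f) : MemH2 f :=
  (MemH2.mul_left hf (memH2_hardyEval hardyOne)).congr fun z _ => by simp [hardyEval_hardyOne]

lemma norm_le_mul_of_hardyEval_eq {f : ℂ → ℂ} {C : ℝ} (hf : DifferentiableOn ℂ f (ball 0 1))
    (hC : ∀ z ∈ ball (0 : ℂ) 1, ‖f z‖ ≤ C) {x y : HardySeq}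
    (h : Set.EqOn (hardyEval y) (fun z => f z * hardyEval x z) (ball 0 1)) :
    ‖y‖ ≤ C * ‖x‖ := by
  have hC0 := MemHInfty.nonneg_of_bound hC
  refine le_of_sq_le_sq ?_ (by positivity)
  rw [mul_pow]
  refine norm_sq_le_of_circleAverage_le fun ρ hρ => ?_
  rw [circleAverage_norm_sq_congr h hρ]
  refine (circleAverage_norm_sq_mul_le hC hf (differentiableOn_hardyEval x) hρ).trans ?_
  gcongr
  exact circleAverage_hardyEval_le x hρ.1 hρ.2

lemma exists_hardyMul {f : ℂ → ℂ} (hf : MemHInfty f) : ∃ M : HardySeq →L[ℂ] HardySeq,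
    ∀ x, Set.EqOn (hardyEval (M x)) (fun z => f z * hardyEval x z) (ball 0 1) := by
  choose M hM using fun x => (MemH2.mul_left hf (memH2_hardyEval x)).exists_hardyEval
  obtain ⟨hfd, C, hC⟩ := hf
  refine ⟨LinearMap.mkContinuous
    { toFun := M
      map_add' := fun x y => hardyEval_injective fun z hz => ?_
      map_smul' := fun c x => hardyEval_injective fun z hz => ?_ } C fun x => ?_, fun x z hz => ?_⟩
  · have hz' : ‖z‖ < 1 := by simpa using hz
    rw [hardyEval_add _ _ hz', ← hM _ hz, ← hM _ hz, ← hM _ hz]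
    simp only [hardyEval_add _ _ hz', mul_add]
  · have hz' : ‖z‖ < 1 := by simpa using hz
    rw [RingHom.id_apply, hardyEval_smul _ _ hz', ← hM _ hz, ← hM _ hz]
    simp only [hardyEval_smul _ _ hz']
    ring
  · exact norm_le_mul_of_hardyEval_eq hfd hC (hM x).symm
  · exact (hM x hz).symm

/-- Multiplication by a bounded analytic function on the Hardy space. -/
def hardyMul {f : ℂ → ℂ} (hf : MemHInfty f) : HardySeq →L[ℂ] HardySeq :=
  (exists_hardyMul hf).choose

lemma hardyEval_hardyMul {f : ℂ → ℂ} (hf : MemHInfty f) (x : HardySeq) {z : ℂ} (hz : ‖z‖ < 1) :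
    hardyEval (hardyMul hf x) z = f z * hardyEval x z :=
  (exists_hardyMul hf).choose_spec x (by simpa using hz)

lemma MemH2.ae_tendsto_radialLimit {f : ℂ → ℂ} (hf : MemH2 f) :
    ∀ᵐ θ : ℝ, Tendsto (fun ρ : ℝ => f (ρ * circleMap 0 1 θ)) (𝓝[<] 1)
      (𝓝 (radialLimit f (circleMap 0 1 θ))) := by
  obtain ⟨x, hx⟩ := hf.exists_hardyEval
  filter_upwards [(hardyEval_boundary x).1] with θ hθ
  rw [radialLimit_congr hx (by simp)]
  refine hθ.congr' ?_
  filter_upwards [eventually_radius_mem_ball (ξ := circleMap 0 1 θ) (by simp)] with ρ hρ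
  exact (hx hρ).symm

lemma MemH2.circleIntegrable_radialLimit {f : ℂ → ℂ} (hf : MemH2 f) :
    CircleIntegrable (radialLimit f) 0 1 := by
  obtain ⟨x, hx⟩ := hf.exists_hardyEval
  refine circleIntegrable_congr_ae (hardyEval_boundary x).2.1 (ae_of_all _ fun θ => ?_)
  rw [radialLimit_congr hx (by simp)]

lemma MemH2.circleAverage_poissonKernel_radialLimit {f : ℂ → ℂ} (hf : MemH2 f) {z : ℂ}
    (hz : ‖z‖ < 1) :
    Real.circleAverage (fun ξ => (poissonKernel 0 z ξ : ℂ) * radialLimit f ξ) 0 1 = f z := by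
  obtain ⟨x, hx⟩ := hf.exists_hardyEval
  rw [hx (by simpa using hz), ← (hardyEval_boundary x).2.2.2.2.1 z hz]
  refine circleAverage_congr_ae (ae_of_all _ fun θ => ?_)
  rw [radialLimit_congr hx (by simp)]

lemma norm_sq_eq_circleAverage_radialLimit {f : ℂ → ℂ} {x : HardySeq}
    (hx : Set.EqOn f (hardyEval x) (ball 0 1)) :
    ‖x‖ ^ 2 = Real.circleAverage (fun ξ => ‖radialLimit f ξ‖ ^ 2) 0 1 := by
  rw [← (hardyEval_boundary x).2.2.2.2.2]
  refine circleAverage_congr_ae (ae_of_all _ fun θ => ?_)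
  rw [radialLimit_congr hx (by simp)]

lemma MemH2.ae_norm_radialLimit_le {f : ℂ → ℂ} (hf : MemH2 f) {C : ℝ}
    (hC : ∀ z ∈ ball (0 : ℂ) 1, ‖f z‖ ≤ C) :
    ∀ᵐ θ : ℝ, ‖radialLimit f (circleMap 0 1 θ)‖ ≤ C := by
  filter_upwards [hf.ae_tendsto_radialLimit] with θ hθ
  refine le_of_tendsto hθ.norm ?_
  filter_upwards [eventually_radius_mem_ball (ξ := circleMap 0 1 θ) (by simp)] with ρ hρ
  exact hC _ hρ

/-- A bounded analytic function is bounded by its boundary values. -/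
lemma norm_le_one_of_ae_norm_radialLimit_le {f : ℂ → ℂ} (hf : MemH2 f)
    (h : ∀ᵐ θ : ℝ, ‖radialLimit f (circleMap 0 1 θ)‖ ≤ 1) {z : ℂ} (hz : ‖z‖ < 1) :
    ‖f z‖ ≤ 1 := by
  rw [← hf.circleAverage_poissonKernel_radialLimit hz]
  have hk := continuousOn_poissonKernel hz
  refine (norm_circleAverage_le _ _).trans
    ((?_ : _ ≤ Real.circleAverage (poissonKernel 0 z) 0 1).trans_eq
      (circleAverage_poissonKernel hz))
  refine circleAverage_mono_ae ?_ (ContinuousOn.circleIntegrable' hk) ?_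
  · exact (hf.circleIntegrable_radialLimit.continuousOn_mul
      (Complex.continuous_ofReal.comp_continuousOn hk)).norm
  · filter_upwards [h] with θ hθ
    have := (poissonKernel_pos hz (ξ := circleMap 0 1 θ) (by simp)).le
    rw [norm_mul, Complex.norm_real, Real.norm_eq_abs, abs_of_nonneg this]
    exact mul_le_of_le_one_right this hθ

/-! ### Poisson and Herglotz integrals -/

/-- The Poisson integral of a real function on the circle. -/
def poissonInt (u : ℂ → ℝ) (z : ℂ) : ℝ :=
  Real.circleAverage (fun ξ => poissonKernel 0 z ξ * u ξ) 0 1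

/-- The Herglotz integral of a real function on the circle. -/
def herglotz (u : ℂ → ℝ) (z : ℂ) : ℂ :=
  Real.circleAverage (fun ξ => (ξ + z) / (ξ - z) * (u ξ : ℂ)) 0 1

lemma circleIntegrable_poissonKernel_mul {u : ℂ → ℝ} (hu : CircleIntegrable u 0 1) {z : ℂ}
    (hz : ‖z‖ < 1) : CircleIntegrable (fun ξ => poissonKernel 0 z ξ * u ξ) 0 1 :=
  hu.continuousOn_mul (continuousOn_poissonKernel hz)

lemma poissonInt_mono {u v : ℂ → ℝ} (hu : CircleIntegrable u 0 1) (hv : CircleIntegrable v 0 1)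
    (h : ∀ᵐ θ : ℝ, u (circleMap 0 1 θ) ≤ v (circleMap 0 1 θ)) {z : ℂ} (hz : ‖z‖ < 1) :
    poissonInt u z ≤ poissonInt v z := by
  refine circleAverage_mono_ae (circleIntegrable_poissonKernel_mul hu hz)
    (circleIntegrable_poissonKernel_mul hv hz) ?_
  filter_upwards [h] with θ hθ
  exact mul_le_mul_of_nonneg_left hθ (poissonKernel_pos hz (by simp)).le

lemma poissonInt_const (c : ℝ) {z : ℂ} (hz : ‖z‖ < 1) : poissonInt (fun _ => c) z = c := by
  unfold poissonInt
  have : (fun ξ => poissonKernel 0 z ξ * c) = fun ξ => c • poissonKernel 0 z ξ := by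
    ext; simp [mul_comm]
  rw [this, Real.circleAverage_fun_smul, circleAverage_poissonKernel hz]
  simp

lemma poissonInt_zero_right (u : ℂ → ℝ) : poissonInt u 0 = Real.circleAverage u 0 1 := by
  refine Real.circleAverage_congr_sphere fun ξ hξ => ?_
  have : ‖ξ‖ = 1 := by simpa using hξ
  simp [poissonKernel_def, this]

lemma re_herglotz {u : ℂ → ℝ} (hu : CircleIntegrable u 0 1) {z : ℂ} (hz : ‖z‖ < 1) :
    (herglotz u z).re = poissonInt u z := by
  have := re_circleAverage_herglotzRieszKernel_smul hu (w := z) (by simpa using hz)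
  rw [← poissonKernel_eq_re_herglotzRieszKernel] at this
  simp only [herglotzRieszKernel_def, sub_zero, smul_eq_mul] at this
  exact this

lemma norm_exp_herglotz {u : ℂ → ℝ} (hu : CircleIntegrable u 0 1) {z : ℂ} (hz : ‖z‖ < 1) :
    ‖Complex.exp (herglotz u z)‖ = Real.exp (poissonInt u z) := by
  rw [Complex.norm_exp, re_herglotz hu hz]

lemma norm_exp_neg_herglotz {u : ℂ → ℝ} (hu : CircleIntegrable u 0 1) {z : ℂ} (hz : ‖z‖ < 1) :
    ‖Complex.exp (-herglotz u z)‖ = Real.exp (-poissonInt u z) := by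
  rw [Complex.norm_exp, Complex.neg_re, re_herglotz hu hz]

lemma differentiableOn_herglotz {u : ℂ → ℝ} (hu : CircleIntegrable u 0 1) :
    DifferentiableOn ℂ (herglotz u) (ball 0 1) := by
  intro z hz
  have := hasDerivAt_circleAverage_herglotzRieszKernel_smul (circleIntegrable_ofReal hu) hz
  simp only [herglotzRieszKernel_def, sub_zero, smul_eq_mul] at this
  exact this.differentiableAt.differentiableWithinAt

lemma herglotz_zero_right (u : ℂ → ℝ) :
    herglotz u 0 = ((Real.circleAverage u 0 1 : ℝ) : ℂ) := by
  rw [← circleAverage_ofReal]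
  refine Real.circleAverage_congr_sphere fun ξ hξ => ?_
  have : ξ ≠ 0 := by
    rintro rfl
    simp at hξ
  simp [this]

lemma ae_tendsto_poissonInt {u : ℂ → ℝ} (hu : CircleIntegrable u 0 1) :
    ∀ᵐ θ : ℝ, Tendsto (fun ρ : ℝ => poissonInt u (ρ * circleMap 0 1 θ)) (𝓝[<] 1)
      (𝓝 (u (circleMap 0 1 θ))) :=
  ae_tendsto_circleAverage_poissonKernel hu

lemma memHInfty_exp_herglotz {u : ℂ → ℝ} (hu : CircleIntegrable u 0 1) {C : ℝ}
    (hC : ∀ᵐ θ : ℝ, u (circleMap 0 1 θ) ≤ C) : MemHInfty fun z => Complex.exp (herglotz u z) := by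
  refine ⟨(differentiableOn_herglotz hu).cexp, Real.exp C, fun z hz => ?_⟩
  have hz' : ‖z‖ < 1 := by simpa using hz
  rw [norm_exp_herglotz hu hz', Real.exp_le_exp, ← poissonInt_const C hz']
  exact poissonInt_mono hu (circleIntegrable_const _ _ _) hC hz'

lemma memHInfty_exp_neg_herglotz {u : ℂ → ℝ} (hu : CircleIntegrable u 0 1) {C : ℝ}
    (hC : ∀ᵐ θ : ℝ, C ≤ u (circleMap 0 1 θ)) :
    MemHInfty fun z => Complex.exp (-herglotz u z) := by
  refine ⟨(differentiableOn_herglotz hu).neg.cexp, Real.exp (-C), fun z hz => ?_⟩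
  have hz' : ‖z‖ < 1 := by simpa using hz
  rw [norm_exp_neg_herglotz hu hz', Real.exp_le_exp, neg_le_neg_iff, ← poissonInt_const C hz']
  exact poissonInt_mono (circleIntegrable_const _ _ _) hu hC hz'

lemma MemHInfty.mul {f g : ℂ → ℂ} (hf : MemHInfty f) (hg : MemHInfty g) :
    MemHInfty fun z => f z * g z := by
  obtain ⟨hfd, C, hC⟩ := hf
  obtain ⟨hgd, D, hD⟩ := hg
  refine ⟨hfd.mul hgd, C * D, fun z hz => ?_⟩
  rw [norm_mul]
  have := MemHInfty.nonneg_of_bound hC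
  gcongr
  exacts [hC z hz, hD z hz]

/-- One period suffices: countably many translates by multiples of `2π` cover the line. -/
lemma ae_circleMap_of_ae_restrict {p : ℂ → Prop}
    (h : ∀ᵐ θ ∂(volume.restrict (Set.uIoc 0 (2 * Real.pi))), p (circleMap 0 1 θ)) :
    ∀ᵐ θ : ℝ, p (circleMap 0 1 θ) := by
  rw [Set.uIoc_of_le Real.two_pi_pos.le, ae_restrict_iff' measurableSet_Ioc] at h
  have h2 : ∀ n : ℤ, ∀ᵐ θ : ℝ, θ + n • (2 * Real.pi) ∈ Set.Ioc 0 (2 * Real.pi) →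
      p (circleMap 0 1 (θ + n • (2 * Real.pi))) := fun n =>
    (measurePreserving_add_right volume (n • (2 * Real.pi))).quasiMeasurePreserving.ae h
  filter_upwards [ae_all_iff.2 h2] with θ hθ
  obtain ⟨n, hn, -⟩ := existsUnique_add_zsmul_mem_Ioc Real.two_pi_pos θ 0
  have := hθ n (by simpa using hn)
  rwa [(periodic_circleMap 0 1).zsmul n θ] at this

/-! ### Outer functions -/

/-- The logarithm of the modulus of the boundary values, regularized to be bounded below. -/
def regLog (ψ : ℂ → ℂ) (ε : ℝ) (ξ : ℂ) : ℝ := Real.log (‖radialLimit ψ ξ‖ + ε)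

lemma aestronglyMeasurable_radialLimit {ψ : ℂ → ℂ} (hψ : MemH2 ψ) :
    AEStronglyMeasurable (fun θ => radialLimit ψ (circleMap 0 1 θ))
      (volume.restrict (Set.uIoc 0 (2 * Real.pi))) :=
  (intervalIntegrable_iff.1 hψ.circleIntegrable_radialLimit).aestronglyMeasurable

lemma MemHInfty.exists_bound {ψ : ℂ → ℂ} (hψ : MemHInfty ψ) :
    ∃ C : ℝ, 0 ≤ C ∧ (∀ z ∈ ball (0 : ℂ) 1, ‖ψ z‖ ≤ C) ∧
      ∀ᵐ θ : ℝ, ‖radialLimit ψ (circleMap 0 1 θ)‖ ≤ C := by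
  obtain ⟨C, hC⟩ := hψ.2
  exact ⟨C, MemHInfty.nonneg_of_bound hC, hC, hψ.memH2.ae_norm_radialLimit_le hC⟩

lemma log_le_regLog {ψ : ℂ → ℂ} {ε : ℝ} (hε : 0 < ε) (ξ : ℂ) : Real.log ε ≤ regLog ψ ε ξ :=
  Real.log_le_log hε (by linarith [norm_nonneg (radialLimit ψ ξ)])

lemma log_norm_le_regLog {ψ : ℂ → ℂ} {ε : ℝ} (hε : 0 < ε) {ξ : ℂ} (h : radialLimit ψ ξ ≠ 0) :
    Real.log ‖radialLimit ψ ξ‖ ≤ regLog ψ ε ξ :=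
  Real.log_le_log (norm_pos_iff.2 h) (by linarith)

lemma circleIntegrable_regLog {ψ : ℂ → ℂ} (hψ : MemHInfty ψ) {ε : ℝ} (hε : 0 < ε) :
    CircleIntegrable (regLog ψ ε) 0 1 := by
  obtain ⟨C, hC0, -, hC⟩ := hψ.exists_bound
  refine circleIntegrable_of_bounded (C := |Real.log ε| + |Real.log (C + ε)|) ?_ ?_
  · exact (Real.measurable_log.comp_aemeasurable
      ((aestronglyMeasurable_radialLimit hψ.memH2).norm.aemeasurable.add_const
        ε)).aestronglyMeasurable
  · filter_upwards [hC] with θ hθ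
    have h1 := log_le_regLog (ψ := ψ) hε (circleMap 0 1 θ)
    have h2 : regLog ψ ε (circleMap 0 1 θ) ≤ Real.log (C + ε) :=
      Real.log_le_log (by positivity) (by linarith)
    rw [Real.norm_eq_abs, abs_le]
    constructor
    · linarith [neg_abs_le (Real.log ε), abs_nonneg (Real.log (C + ε))]
    · linarith [le_abs_self (Real.log (C + ε)), abs_nonneg (Real.log ε)]

/-- Divide `ψ` by the outer function of boundary modulus `|ψ| + ε`. The quotient is bounded because
of the regularization, and its boundary modulus is at most `1`. -/
lemma norm_le_exp_poissonInt_regLog {ψ : ℂ → ℂ} (hψ : MemHInfty ψ) {ε : ℝ} (hε : 0 < ε) {z : ℂ}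
    (hz : ‖z‖ < 1) : ‖ψ z‖ ≤ Real.exp (poissonInt (regLog ψ ε) z) := by
  have hu := circleIntegrable_regLog hψ hε
  have hg : MemHInfty fun z => ψ z * Complex.exp (-herglotz (regLog ψ ε) z) :=
    hψ.mul (memHInfty_exp_neg_herglotz hu (ae_of_all _ fun θ => log_le_regLog hε _))
  have h1 := norm_le_one_of_ae_norm_radialLimit_le hg.memH2 ?_ hz
  · rw [norm_mul, norm_exp_neg_herglotz hu hz, Real.exp_neg] at h1
    rwa [← div_eq_mul_inv, div_le_one (Real.exp_pos _)] at h1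
  · filter_upwards [hg.memH2.ae_tendsto_radialLimit, hψ.memH2.ae_tendsto_radialLimit,
      ae_tendsto_poissonInt hu] with θ t1 t2 t3
    have t4 := t2.norm.mul ((Real.continuous_exp.tendsto _).comp t3.neg)
    have t5 := tendsto_nhds_unique (t1.norm.congr' ?_) t4
    · rw [t5]
      have : 0 < ‖radialLimit ψ (circleMap 0 1 θ)‖ + ε := by positivity
      rw [Real.exp_neg, regLog, Real.exp_log this, ← div_eq_mul_inv, div_le_one this]
      linarith
    · filter_upwards [eventually_radius_mem_ball (ξ := circleMap 0 1 θ) (by simp)] with ρ hρ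
      rw [norm_mul, norm_exp_neg_herglotz hu (by simpa using hρ)]
      rfl

/-- The boundary values of a bounded analytic function which is not `0` have an integrable
logarithm. -/
lemma log_norm_radialLimit_integrable {ψ : ℂ → ℂ} (hψ : MemHInfty ψ) (h0 : ψ 0 ≠ 0) :
    (∀ᵐ θ : ℝ, radialLimit ψ (circleMap 0 1 θ) ≠ 0) ∧
      CircleIntegrable (fun ξ => Real.log ‖radialLimit ψ ξ‖) 0 1 := by
  obtain ⟨C, hC0, -, hC⟩ := hψ.exists_bound
  let e : ℕ → ℝ := fun n => 1 / ((n : ℝ) + 1)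
  have he : ∀ n, 0 < e n := fun n => Nat.one_div_pos_of_nat
  have he1 : ∀ n, e n ≤ 1 := fun n => by
    simp only [e]
    rw [div_le_one (by positivity)]
    linarith [Nat.cast_nonneg (α := ℝ) n]
  have helim : Tendsto e atTop (𝓝 0) := tendsto_one_div_add_atTop_nhds_zero_nat
  -- The shift by `log (C + 1)` makes these functions nonnegative almost everywhere, as Fatou's
  -- lemma requires.
  let v : ℕ → ℝ → ℝ := fun n θ => Real.log (C + 1) - regLog ψ (e n) (circleMap 0 1 θ)
  set μ : Measure ℝ := volume.restrict (Set.uIoc 0 (2 * Real.pi)) with hμ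
  have hvi : ∀ n, Integrable (v n) μ := fun n =>
    intervalIntegrable_iff.1 (IntervalIntegrable.sub (by simp)
      (circleIntegrable_regLog hψ (he n)))
  have hv0 : ∀ n, 0 ≤ᵐ[μ] v n := fun n => by
    filter_upwards [ae_restrict_of_ae hC] with θ hθ
    have : regLog ψ (e n) (circleMap 0 1 θ) ≤ Real.log (C + 1) :=
      Real.log_le_log (add_pos_of_nonneg_of_pos (norm_nonneg _) (he n))
        (add_le_add hθ (he1 n))
    simpa [v] using this
  set K := 2 * Real.pi * (Real.log (C + 1) - Real.log ‖ψ 0‖) with hK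
  -- Evaluating the previous bound at `0` is Jensen's inequality; the condition `ψ 0 ≠ 0` makes it
  -- uniform in `n`.
  have hvK : ∀ n, ∫ θ, v n θ ∂μ ≤ K := fun n => by
    have h1 := norm_le_exp_poissonInt_regLog hψ (he n) (z := 0) (by simp)
    rw [poissonInt_zero_right, ← Real.log_le_iff_le_exp (norm_pos_iff.2 h0),
      Real.circleAverage_def, smul_eq_mul] at h1
    have h2 : ∫ θ, v n θ ∂μ = 2 * Real.pi * Real.log (C + 1) -
        ∫ θ in 0..2 * Real.pi, regLog ψ (e n) (circleMap 0 1 θ) := by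
      rw [hμ, Set.uIoc_of_le Real.two_pi_pos.le,
        ← intervalIntegral.integral_of_le Real.two_pi_pos.le, intervalIntegral.integral_sub
        (by simp) (circleIntegrable_regLog hψ (he n)), intervalIntegral.integral_const]
      simp
    rw [h2, hK, mul_sub]
    have h3 : 2 * Real.pi * Real.log ‖ψ 0‖ ≤ 2 * Real.pi * ((2 * Real.pi)⁻¹ *
        ∫ θ in 0..2 * Real.pi, regLog ψ (e n) (circleMap 0 1 θ)) := by
      have := Real.pi_pos
      gcongr
    rw [← mul_assoc, mul_inv_cancel₀ Real.two_pi_pos.ne', one_mul] at h3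
    linarith
  have hlint : ∀ n, ∫⁻ θ, ENNReal.ofReal (v n θ) ∂μ ≤ ENNReal.ofReal K := fun n => by
    rw [← ofReal_integral_eq_lintegral_ofReal (hvi n) (hv0 n)]
    exact ENNReal.ofReal_le_ofReal (hvK n)
  have hmeas : ∀ n, AEMeasurable (fun θ => ENNReal.ofReal (v n θ)) μ := fun n =>
    (hvi n).aemeasurable.ennreal_ofReal
  have hliminf : ∫⁻ θ, liminf (fun n => ENNReal.ofReal (v n θ)) atTop ∂μ ≠ ⊤ := by
    refine ne_top_of_le_ne_top ENNReal.ofReal_ne_top (b := ENNReal.ofReal K)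
      ((lintegral_liminf_le' hmeas).trans ?_)
    exact liminf_le_of_le (by isBoundedDefault) fun b hb => by
      obtain ⟨n, hn⟩ := hb.exists
      exact hn.trans (hlint n)
  -- At a zero of the boundary function `v n` tends to infinity, whereas its lower limit is finite
  -- almost everywhere.
  have hne : ∀ᵐ θ ∂μ, radialLimit ψ (circleMap 0 1 θ) ≠ 0 := by
    have hm : AEMeasurable (fun θ => liminf (fun n => ENNReal.ofReal (v n θ)) atTop) μ := by
      refine ⟨_, Measurable.liminf fun n => (hmeas n).measurable_mk, ?_⟩
      filter_upwards [ae_all_iff.2 fun n => (hmeas n).ae_eq_mk] with θ hθ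
      simp only [hθ]
    filter_upwards [ae_lt_top' hm hliminf] with θ hθ hzero
    have hlim : Tendsto (fun n => v n θ) atTop atTop := by
      have h1 : Tendsto (fun n => Real.log (e n)) atTop atBot :=
        Real.tendsto_log_nhdsGT_zero.comp (tendsto_nhdsWithin_iff.2
          ⟨helim, Eventually.of_forall fun n => he n⟩)
      have h2 := tendsto_const_nhds (x := Real.log (C + 1)).add_atTop
        (tendsto_neg_atBot_atTop.comp h1)
      refine h2.congr fun n => ?_
      simp [v, regLog, hzero, sub_eq_add_neg]
    have hl : Tendsto (fun n => ENNReal.ofReal (v n θ)) atTop (𝓝 ⊤) :=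
      ENNReal.tendsto_ofReal_atTop.comp hlim
    rw [hl.liminf_eq] at hθ
    exact lt_irrefl _ hθ
  refine ⟨ae_circleMap_of_ae_restrict (p := fun ξ => radialLimit ψ ξ ≠ 0) hne, ?_⟩
  have hint : Integrable (fun θ => Real.log (C + 1) -
      Real.log ‖radialLimit ψ (circleMap 0 1 θ)‖) μ := by
    refine integrable_of_tendsto (G := v) ?_ (fun n => (hvi n).aestronglyMeasurable) ?_
    · filter_upwards [hne] with θ hθ
      have h1 : Tendsto (fun n => ‖radialLimit ψ (circleMap 0 1 θ)‖ + e n) atTop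
          (𝓝 ‖radialLimit ψ (circleMap 0 1 θ)‖) := by
        simpa using tendsto_const_nhds.add helim
      exact tendsto_const_nhds.sub (h1.log (norm_ne_zero_iff.2 hθ))
    · refine ne_top_of_le_ne_top ENNReal.ofReal_ne_top (b := ENNReal.ofReal K) ?_
      refine liminf_le_of_le (by isBoundedDefault) fun b hb => ?_
      obtain ⟨n, hn⟩ := hb.exists
      refine hn.trans ((lintegral_congr_ae ?_).trans_le (hlint n))
      filter_upwards [hv0 n] with θ hθ
      exact Real.enorm_of_nonneg hθ
  have h3 : IntervalIntegrable (fun θ => Real.log (C + 1) -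
      Real.log ‖radialLimit ψ (circleMap 0 1 θ)‖) volume 0 (2 * Real.pi) :=
    intervalIntegrable_iff.2 hint
  have h4 := (intervalIntegrable_const (c := Real.log (C + 1))).sub h3
  simpa [CircleIntegrable] using h4

/-- Dominated convergence: the regularized logarithm lies between `log |ψ|`, now known to be
integrable, and the constant `log (C + 1)`. -/
lemma tendsto_poissonInt_regLog {ψ : ℂ → ℂ} (hψ : MemHInfty ψ) (h0 : ψ 0 ≠ 0) {z : ℂ}
    (hz : ‖z‖ < 1) : Tendsto (fun n : ℕ => poissonInt (regLog ψ (1 / ((n : ℝ) + 1))) z) atTop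
      (𝓝 (poissonInt (fun ξ => Real.log ‖radialLimit ψ ξ‖) z)) := by
  obtain ⟨hne, hint⟩ := log_norm_radialLimit_integrable hψ h0
  obtain ⟨C, hC0, -, hC⟩ := hψ.exists_bound
  have he : ∀ n : ℕ, 0 < 1 / ((n : ℝ) + 1) := fun n => Nat.one_div_pos_of_nat
  have he1 : ∀ n : ℕ, 1 / ((n : ℝ) + 1) ≤ 1 := fun n => by
    rw [div_le_one (by positivity)]
    linarith [Nat.cast_nonneg (α := ℝ) n]
  refine tendsto_circleAverage_of_dominated (fun ξ => poissonKernel 0 z ξ *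
    (|Real.log ‖radialLimit ψ ξ‖| + |Real.log (C + 1)|)) ?_ ?_ ?_ ?_
  · exact Eventually.of_forall fun n =>
      circleIntegrable_poissonKernel_mul (circleIntegrable_regLog hψ (he n)) hz
  · refine Eventually.of_forall fun n => ?_
    filter_upwards [hne, hC] with θ h1 h2
    have hp := poissonKernel_pos hz (ξ := circleMap 0 1 θ) (by simp)
    have h3 := log_norm_le_regLog (he n) h1
    have h4 : regLog ψ (1 / ((n : ℝ) + 1)) (circleMap 0 1 θ) ≤ Real.log (C + 1) :=
      Real.log_le_log (add_pos_of_nonneg_of_pos (norm_nonneg _) (he n))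
        (add_le_add h2 (he1 n))
    rw [norm_mul, Real.norm_eq_abs, abs_of_pos hp]
    gcongr
    rw [Real.norm_eq_abs, abs_le]
    constructor
    · linarith [neg_abs_le (Real.log ‖radialLimit ψ (circleMap 0 1 θ)‖),
        abs_nonneg (Real.log (C + 1))]
    · linarith [le_abs_self (Real.log (C + 1)),
        abs_nonneg (Real.log ‖radialLimit ψ (circleMap 0 1 θ)‖)]
  · exact circleIntegrable_poissonKernel_mul (u := fun ξ => |Real.log ‖radialLimit ψ ξ‖| +
      |Real.log (C + 1)|) (CircleIntegrable.add hint.abs (circleIntegrable_const _ _ _)) hz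
  · filter_upwards [hne] with θ hθ
    have h1 : Tendsto (fun n : ℕ => ‖radialLimit ψ (circleMap 0 1 θ)‖ + 1 / ((n : ℝ) + 1)) atTop
        (𝓝 ‖radialLimit ψ (circleMap 0 1 θ)‖) := by
      simpa using tendsto_const_nhds.add (tendsto_one_div_add_atTop_nhds_zero_nat (𝕜 := ℝ))
    exact (h1.log (norm_ne_zero_iff.2 hθ)).const_mul (poissonKernel 0 z (circleMap 0 1 θ))

lemma norm_le_exp_poissonInt_log {ψ : ℂ → ℂ} (hψ : MemHInfty ψ) (h0 : ψ 0 ≠ 0) {z : ℂ}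
    (hz : ‖z‖ < 1) :
    ‖ψ z‖ ≤ Real.exp (poissonInt (fun ξ => Real.log ‖radialLimit ψ ξ‖) z) :=
  ge_of_tendsto' ((Real.continuous_exp.tendsto _).comp (tendsto_poissonInt_regLog hψ h0 hz))
    fun _ => norm_le_exp_poissonInt_regLog hψ Nat.one_div_pos_of_nat hz

lemma isOuter_iff {ψ : ℂ → ℂ} : IsOuter ψ ↔ MemHInfty ψ ∧
    CircleIntegrable (fun ξ => Real.log ‖radialLimit ψ ξ‖) 0 1 ∧ ∃ c : ℂ, ‖c‖ = 1 ∧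
      ∀ z ∈ ball (0 : ℂ) 1,
        ψ z = c * Complex.exp (herglotz (fun ξ => Real.log ‖radialLimit ψ ξ‖) z) := Iff.rfl

lemma norm_hardyOne : ‖hardyOne‖ = 1 := by
  simp [hardyOne, lp.norm_single]

/-- A bounded analytic function whose multiples approximate `1` in the Hardy space is outer. -/
lemma isOuter_of_approx {ψ : ℂ → ℂ} (hψ : MemHInfty ψ)
    (h : ∀ ε > 0, ∃ x, ‖hardyMul hψ x - hardyOne‖ < ε) : IsOuter ψ := by
  have hcoef : ∀ x, (hardyMul hψ x - hardyOne) 0 = ψ 0 * x 0 - 1 := fun x => by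
    rw [← hardyEval_zero_right, hardyEval_sub _ _ (by simp), hardyEval_hardyMul hψ x (by simp),
      hardyEval_hardyOne, hardyEval_zero_right]
  have h0 : ψ 0 ≠ 0 := by
    obtain ⟨x, hx⟩ := h 1 one_pos
    intro h0
    have := (HardySeq.norm_coeff_le _ 0).trans_lt hx
    rw [hcoef, h0] at this
    simp at this
  obtain ⟨hne, hint⟩ := log_norm_radialLimit_integrable hψ h0
  set U : ℂ → ℝ := fun ξ => Real.log ‖radialLimit ψ ξ‖ with hU
  obtain ⟨C, hC0, -, hC⟩ := hψ.exists_bound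
  -- This is the outer factor of `ψ`. It has the same boundary modulus, so multiplication by either
  -- function produces vectors of equal norm.
  have hO : MemHInfty fun z => Complex.exp (herglotz U z) := by
    refine memHInfty_exp_herglotz hint (C := Real.log (C + 1)) ?_
    filter_upwards [hne, hC] with θ h1 h2
    exact Real.log_le_log (norm_pos_iff.2 h1) (by linarith)
  have hnorm : ∀ x, ‖hardyMul hO x‖ = ‖hardyMul hψ x‖ := by
    intro x
    rw [← sq_eq_sq₀ (norm_nonneg _) (norm_nonneg _),
      norm_sq_eq_circleAverage_radialLimit (Set.eqOn_refl _ _),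
      norm_sq_eq_circleAverage_radialLimit (Set.eqOn_refl _ _)]
    refine circleAverage_congr_ae ?_
    filter_upwards [(memH2_hardyEval (hardyMul hO x)).ae_tendsto_radialLimit,
      (memH2_hardyEval (hardyMul hψ x)).ae_tendsto_radialLimit, hne,
      (memH2_hardyEval x).ae_tendsto_radialLimit, hψ.memH2.ae_tendsto_radialLimit,
      ae_tendsto_poissonInt hint] with θ t1 t2 hθ t3 t4 t5
    congr 1
    have hball := eventually_radius_mem_ball (ξ := circleMap 0 1 θ) (by simp)
    have t6 := ((Real.continuous_exp.tendsto _).comp t5).mul t3.norm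
    rw [hU, Real.exp_log (norm_pos_iff.2 hθ)] at t6
    have t7 := t4.norm.mul t3.norm
    rw [tendsto_nhds_unique (t1.norm.congr' ?_) t6, tendsto_nhds_unique (t2.norm.congr' ?_) t7]
    · filter_upwards [hball] with ρ hρ
      rw [hardyEval_hardyMul hψ x (by simpa using hρ), norm_mul]
    · filter_upwards [hball] with ρ hρ
      rw [hardyEval_hardyMul hO x (by simpa using hρ), norm_mul,
        norm_exp_herglotz hint (by simpa using hρ)]
      rfl
  -- The inner factor. The aim is `‖I 0‖ = 1`, after which the maximum principle makes it constant.
  set I : ℂ → ℂ := fun z => ψ z * Complex.exp (-herglotz U z) with hI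
  have hψI : ∀ z, ψ z = I z * Complex.exp (herglotz U z) := fun z => by
    rw [hI]
    simp only
    rw [mul_assoc, ← Complex.exp_add]
    simp
  have hI1 : ∀ z ∈ ball (0 : ℂ) 1, ‖I z‖ ≤ 1 := by
    intro z hz
    have hz' : ‖z‖ < 1 := by simpa using hz
    rw [hI, norm_mul, norm_exp_neg_herglotz hint hz', Real.exp_neg, ← div_eq_mul_inv,
      div_le_one (Real.exp_pos _)]
    exact norm_le_exp_poissonInt_log hψ h0 hz'
  have hI0 : 1 ≤ ‖I 0‖ := by
    -- If `ψ x` is within `ε` of `1`, the outer factor times `x` has value at most `‖ψ x‖ ≤ 1 + ε`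
    -- at `0`, while `ψ x` has value at least `1 - ε` there.
    have key : ∀ ε > 0, 1 - ε ≤ ‖I 0‖ * (1 + ε) := by
      intro ε hε
      obtain ⟨x, hx⟩ := h ε hε
      have e1 : ‖Complex.exp (herglotz U 0) * x 0‖ ≤ 1 + ε := by
        have : Complex.exp (herglotz U 0) * x 0 = (hardyMul hO x) 0 := by
          rw [← hardyEval_zero_right (hardyMul hO x), hardyEval_hardyMul hO x (by simp),
            hardyEval_zero_right]
        rw [this]
        refine (HardySeq.norm_coeff_le _ 0).trans ?_
        rw [hnorm]
        calc ‖hardyMul hψ x‖ = ‖hardyOne + (hardyMul hψ x - hardyOne)‖ := by congr 1; abel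
          _ ≤ ‖hardyOne‖ + ‖hardyMul hψ x - hardyOne‖ := norm_add_le _ _
          _ ≤ 1 + ε := by rw [norm_hardyOne]; linarith
      have e2 : 1 - ε ≤ ‖ψ 0 * x 0‖ := by
        have h1 := ((HardySeq.norm_coeff_le _ 0).trans_lt hx).le
        rw [hcoef] at h1
        have h2 := norm_sub_norm_le (1 : ℂ) (ψ 0 * x 0)
        rw [norm_sub_rev, norm_one] at h2
        linarith
      refine e2.trans ?_
      rw [hψI 0, mul_assoc, norm_mul]
      gcongr
    by_contra! hlt
    have h1 : 0 ≤ ‖I 0‖ := norm_nonneg _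
    have := key ((1 - ‖I 0‖) / 4) (by linarith)
    nlinarith
  have hId : DifferentiableOn ℂ I (ball 0 1) :=
    hψ.1.mul (differentiableOn_herglotz hint).neg.cexp
  have hconst := Complex.eqOn_of_isPreconnected_of_isMaxOn_norm
    (convex_ball (0 : ℂ) 1).isPreconnected isOpen_ball hId (by simp : (0 : ℂ) ∈ ball (0 : ℂ) 1)
    (fun z hz => (hI1 z hz).trans hI0)
  refine isOuter_iff.2 ⟨hψ, hint, I 0, le_antisymm (hI1 0 (by simp)) hI0, fun z hz => ?_⟩
  rw [hψI z, hconst hz]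
  rfl

/-- The multiples of an outer function approximate `1` in the Hardy space. -/
lemma IsOuter.approx {ψ : ℂ → ℂ} (hψ : MemHInfty ψ) (ho : IsOuter ψ) {ε : ℝ} (hε : 0 < ε) :
    ∃ x, ‖hardyMul hψ x - hardyOne‖ < ε := by
  obtain ⟨-, hint, c, hc, hψc⟩ := isOuter_iff.1 ho
  have h0 : ψ 0 ≠ 0 := by
    rw [hψc 0 (by simp)]
    exact mul_ne_zero (norm_ne_zero_iff.1 (by rw [hc]; norm_num)) (Complex.exp_ne_zero _)
  obtain ⟨hne, -⟩ := log_norm_radialLimit_integrable hψ h0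
  set U : ℂ → ℝ := fun ξ => Real.log ‖radialLimit ψ ξ‖ with hU
  have hlim := ((Real.continuous_exp.tendsto _).comp
    ((tendsto_const_nhds (x := poissonInt U 0)).sub
      (tendsto_poissonInt_regLog hψ h0 (z := 0) (by simp)))).const_sub 1
  simp only [← hU, sub_self, Real.exp_zero] at hlim
  obtain ⟨n, hn⟩ := (hlim.eventually (gt_mem_nhds (show (0 : ℝ) < ε ^ 2 / 2 by positivity))).exists
  have he : 0 < 1 / ((n : ℝ) + 1) := Nat.one_div_pos_of_nat
  set u := regLog ψ (1 / ((n : ℝ) + 1)) with hu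
  have hui : CircleIntegrable u 0 1 := circleIntegrable_regLog hψ he
  have hE : MemHInfty fun z => Complex.exp (-herglotz u z) :=
    memHInfty_exp_neg_herglotz hui (ae_of_all _ fun θ => log_le_regLog he _)
  -- The approximate inverse is `conj c` over the outer function of modulus `|ψ| + 1/(n+1)`. The
  -- product with `ψ` is bounded by `1`, and its value at `0` is positive and close to `1`.
  refine ⟨conj c • hardyMul hE hardyOne, ?_⟩
  set y := hardyMul hψ (conj c • hardyMul hE hardyOne) with hy
  have hcc : conj c * c = 1 := by
    rw [mul_comm, Complex.mul_conj, Complex.normSq_eq_norm_sq, hc]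
    simp
  have hyz : ∀ z, ‖z‖ < 1 → hardyEval y z =
      Complex.exp (herglotz U z) * Complex.exp (-herglotz u z) := by
    intro z hz
    rw [hy, hardyEval_hardyMul hψ _ hz, hardyEval_smul _ _ hz, hardyEval_hardyMul hE _ hz,
      hardyEval_hardyOne, hψc z (by simpa using hz)]
    linear_combination (Complex.exp (herglotz U z) * Complex.exp (-herglotz u z)) * hcc
  have hy1 : ‖y‖ ≤ 1 := by
    have := norm_le_mul_of_hardyEval_eq (f := hardyEval y) (C := 1) (x := hardyOne) (y := y)
      (differentiableOn_hardyEval y) (fun z hz => ?_) (fun z _ => by simp [hardyEval_hardyOne])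
    · simpa [norm_hardyOne] using this
    · have hz' : ‖z‖ < 1 := by simpa using hz
      rw [hyz z hz', norm_mul, norm_exp_herglotz hint hz', norm_exp_neg_herglotz hui hz',
        ← Real.exp_add, Real.exp_le_one_iff, ← sub_eq_add_neg, sub_nonpos]
      refine poissonInt_mono hint hui ?_ hz'
      filter_upwards [hne] with θ hθ using log_norm_le_regLog he hθ
  have hy0 : y 0 = ((Real.exp (poissonInt U 0 - poissonInt u 0) : ℝ) : ℂ) := by
    rw [← hardyEval_zero_right, hyz 0 (by simp), herglotz_zero_right, herglotz_zero_right,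
      poissonInt_zero_right, poissonInt_zero_right, ← Complex.exp_add]
    push_cast
    rfl
  -- Expand the square: `‖y‖ ≤ 1`, `‖1‖ = 1`, and the inner product with `1` is the real number `y
  -- 0`.
  have hsq : ‖y - hardyOne‖ ^ 2 ≤ 2 * (1 - Real.exp (poissonInt U 0 - poissonInt u 0)) := by
    rw [@norm_sub_sq ℂ, norm_hardyOne, hardyOne, lp.inner_single_right, hy0]
    have h2 : ‖y‖ ^ 2 ≤ 1 := pow_le_one₀ (norm_nonneg _) hy1
    generalize Real.exp (poissonInt U 0 - poissonInt u 0) = t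
    generalize ‖y‖ ^ 2 = s at h2 ⊢
    simp
    linarith
  refine lt_of_pow_lt_pow_left₀ 2 hε.le (hsq.trans_lt ?_)
  simp only [Function.comp_apply] at hn
  linarith

/-! ### Polynomials in the Hardy space -/

open Polynomial in
/-- A polynomial as an element of the Hardy space. -/
def polySeq : ℂ[X] →ₗ[ℂ] HardySeq where
  toFun p := ⟨p.coeff, HardySeq.memℓp (summable_of_hasFiniteSupport
    (p.support.finite_toSet.subset fun n hn => by
      simp only [Function.mem_support] at hn
      simp only [Finset.mem_coe, mem_support_iff]
      intro h
      simp [h] at hn))⟩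
  map_add' p q := by
    ext n
    exact coeff_add p q n
  map_smul' c p := by
    ext n
    exact coeff_smul c p n

lemma polySeq_apply (p : Polynomial ℂ) (n : ℕ) : polySeq p n = p.coeff n := rfl

lemma hardyEval_polySeq (p : Polynomial ℂ) (z : ℂ) : hardyEval (polySeq p) z = p.eval z := by
  rw [hardyEval, Polynomial.eval_eq_sum_range, tsum_eq_sum fun n hn => ?_]
  · rfl
  · rw [polySeq_apply, Polynomial.coeff_eq_zero_of_natDegree_lt (by simpa using hn), zero_mul]

lemma polySeq_one : polySeq 1 = hardyOne :=
  hardyEval_injective fun z _ => by simp [hardyEval_polySeq, hardyEval_hardyOne]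

lemma polySeq_monomial (n : ℕ) (c : ℂ) : polySeq (Polynomial.monomial n c) = lp.single 2 n c := by
  ext k
  rw [polySeq_apply, Polynomial.coeff_monomial, lp.single_apply, Pi.single_apply]
  simp [eq_comm]

lemma denseRange_polySeq : DenseRange polySeq := fun x => by
  refine mem_closure_of_tendsto (lp.hasSum_single ENNReal.ofNat_ne_top x)
    (Eventually.of_forall fun s => ⟨∑ i ∈ s, Polynomial.monomial i (x i), ?_⟩)
  simp [polySeq_monomial]

lemma memHInfty_eval (p : Polynomial ℂ) : MemHInfty fun z => p.eval z := by
  refine ⟨p.differentiable.differentiableOn, ?_⟩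
  obtain ⟨C, hC⟩ := (isCompact_closedBall (0 : ℂ) 1).exists_bound_of_continuousOn
    p.continuous.continuousOn
  exact ⟨C, fun z hz => hC z (ball_subset_closedBall hz)⟩

/-- Multiplication by a polynomial on the Hardy space. -/
def polyMul (p : Polynomial ℂ) : HardySeq →L[ℂ] HardySeq := hardyMul (memHInfty_eval p)

lemma hardyEval_polyMul (p : Polynomial ℂ) (x : HardySeq) {z : ℂ} (hz : ‖z‖ < 1) :
    hardyEval (polyMul p x) z = p.eval z * hardyEval x z := hardyEval_hardyMul _ x hz

lemma polyMul_mul (p q : Polynomial ℂ) : polyMul (p * q) = polyMul p ∘L polyMul q := by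
  ext1 x
  refine hardyEval_injective fun z hz => ?_
  have hz' : ‖z‖ < 1 := by simpa using hz
  rw [ContinuousLinearMap.comp_apply, hardyEval_polyMul _ _ hz', hardyEval_polyMul _ _ hz',
    hardyEval_polyMul _ _ hz', Polynomial.eval_mul, mul_assoc]

lemma polyMul_X_sub_C (ζ : ℂ) :
    polyMul (Polynomial.X - Polynomial.C ζ) = polyMul Polynomial.X - ζ • .id ℂ HardySeq := by
  ext1 x
  refine hardyEval_injective fun z hz => ?_
  have hz' : ‖z‖ < 1 := by simpa using hz
  simp only [sub_apply, smul_apply,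
    ContinuousLinearMap.id_apply]
  rw [hardyEval_sub _ _ hz', hardyEval_smul _ _ hz', hardyEval_polyMul _ _ hz',
    hardyEval_polyMul _ _ hz']
  simp [sub_mul]

lemma polyMul_C (c : ℂ) : polyMul (Polynomial.C c) = c • .id ℂ HardySeq := by
  ext1 x
  refine hardyEval_injective fun z hz => ?_
  have hz' : ‖z‖ < 1 := by simpa using hz
  simp only [smul_apply, ContinuousLinearMap.id_apply]
  rw [hardyEval_smul _ _ hz', hardyEval_polyMul _ _ hz', Polynomial.eval_C]

lemma polyMul_polySeq (p q : Polynomial ℂ) : polyMul p (polySeq q) = polySeq (p * q) :=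
  hardyEval_injective fun z hz => by
    rw [hardyEval_polyMul _ _ (by simpa using hz), hardyEval_polySeq, hardyEval_polySeq,
      Polynomial.eval_mul]

lemma hardyMul_polyMul {f : ℂ → ℂ} (hf : MemHInfty f) (p : Polynomial ℂ) (x : HardySeq) :
    hardyMul hf (polyMul p x) = polyMul p (hardyMul hf x) :=
  hardyEval_injective fun z hz => by
    have hz' : ‖z‖ < 1 := by simpa using hz
    rw [hardyEval_polyMul _ _ hz', hardyEval_hardyMul _ _ hz', hardyEval_hardyMul _ _ hz',
      hardyEval_polyMul _ _ hz', mul_left_comm]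

/-- The polynomial multiples of a bounded outer function are dense in the Hardy space. -/
lemma IsOuter.denseRange_polySeq {ψ : ℂ → ℂ} (hψ : MemHInfty ψ) (ho : IsOuter ψ) :
    DenseRange fun q => hardyMul hψ (polySeq q) := by
  set K : Submodule ℂ HardySeq :=
    (LinearMap.range ((hardyMul hψ : HardySeq →ₗ[ℂ] HardySeq) ∘ₗ polySeq)).topologicalClosure
    with hK
  have hKs : (K : Set HardySeq) = closure (Set.range fun q => hardyMul hψ (polySeq q)) := by
    rw [hK, Submodule.topologicalClosure_coe]
    rfl
  have hrange : ∀ x, hardyMul hψ x ∈ K := fun x => by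
    rw [← SetLike.mem_coe, hKs]
    have := image_closure_subset_closure_image (hardyMul hψ).continuous
      (Set.mem_image_of_mem _ (_root_.denseRange_polySeq x))
    rwa [← Set.range_comp] at this
  have hone : hardyOne ∈ K := by
    rw [← SetLike.mem_coe, ← (Submodule.isClosed_topologicalClosure _).closure_eq,
      Metric.mem_closure_iff]
    intro ε hε
    obtain ⟨x, hx⟩ := ho.approx hψ hε
    exact ⟨_, hrange x, by rwa [dist_comm, dist_eq_norm]⟩
  -- The closed span is invariant under multiplication by polynomials, so it contains all of them
  -- once it contains `1`.
  have hpoly : ∀ q, polySeq q ∈ K := fun q => by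
    rw [← SetLike.mem_coe, hKs] at hone ⊢
    have := image_closure_subset_closure_image (polyMul q).continuous
      (Set.mem_image_of_mem _ hone)
    rw [← polySeq_one, polyMul_polySeq, mul_one] at this
    refine closure_mono ?_ this
    rintro _ ⟨_, ⟨p, rfl⟩, rfl⟩
    exact ⟨q * p, by rw [← hardyMul_polyMul, polyMul_polySeq]⟩
  intro x
  rw [← hKs]
  have : closure (Set.range polySeq) ⊆ K :=
    closure_minimal (Set.range_subset_iff.2 hpoly) (Submodule.isClosed_topologicalClosure _)
  exact this (_root_.denseRange_polySeq x)

/-- The backward shift on the Hardy space. -/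
def backShift : HardySeq →L[ℂ] HardySeq :=
  ContinuousLinearMap.adjoint (polyMul Polynomial.X)

lemma backShift_apply (x : HardySeq) (n : ℕ) : backShift x n = x (n + 1) := by
  have h1 : inner ℂ (polySeq (Polynomial.monomial n 1)) (backShift x) = backShift x n := by
    rw [polySeq_monomial, lp.inner_single_left]
    simp
  rw [← h1, backShift, ContinuousLinearMap.adjoint_inner_right, polyMul_polySeq,
    Polynomial.X_mul_monomial, polySeq_monomial, lp.inner_single_left]
  simp

lemma mul_hardyEval_backShift (x : HardySeq) {z : ℂ} (hz : ‖z‖ < 1) :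
    z * hardyEval (backShift x) z = hardyEval x z - x 0 := by
  have h1 := (hasSum_hardyEval (backShift x) hz).mul_left z
  have h2 := (hasSum_nat_add_iff' 1).2 (hasSum_hardyEval x hz)
  simp only [Finset.sum_range_one, pow_zero, mul_one] at h2
  refine h1.unique (h2.congr_fun ?_)
  intro n
  rw [backShift_apply]
  ring

/-- A unimodular eigenvalue would give coefficients of constant modulus, which are square summable
only if they vanish. -/
lemma backShift_sub_injective {ζ : ℂ} (hζ : ‖ζ‖ = 1) {x : HardySeq}
    (h : backShift x = ζ • x) : x = 0 := by
  have hn : ∀ n, ‖x n‖ = ‖x 0‖ := fun n => by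
    induction n with
    | zero => rfl
    | succ n ih =>
      rw [← backShift_apply, h, lp.coeFn_smul, Pi.smul_apply, norm_smul, hζ, one_mul, ih]
  have h0 : ‖x 0‖ = 0 := by
    have := x.hasSum_norm_sq.summable.tendsto_atTop_zero
    simp only [hn] at this
    exact pow_eq_zero_iff two_ne_zero |>.1 (tendsto_nhds_unique tendsto_const_nhds this)
  ext n
  exact norm_eq_zero.1 ((hn n).trans h0)

/-- Splitting off the first Taylor coefficients. -/
lemma exists_polySeq_add (N : ℕ) (x : HardySeq) : ∃ q : Polynomial ℂ, ∃ y, q.degree < N ∧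
    x = polySeq q + polyMul (Polynomial.X ^ N) y := by
  induction N with
  | zero =>
    refine ⟨0, x, by simp, ?_⟩
    rw [pow_zero, ← Polynomial.C_1, polyMul_C]
    simp
  | succ N ih =>
    obtain ⟨q, y, hq, rfl⟩ := ih
    refine ⟨q + Polynomial.C (y 0) * Polynomial.X ^ N, backShift y, ?_, ?_⟩
    · refine (Polynomial.degree_add_le _ _).trans_lt (max_lt (hq.trans ?_)
        ((Polynomial.degree_C_mul_X_pow_le _ _).trans_lt ?_))
      all_goals exact_mod_cast N.lt_succ_self
    · refine hardyEval_injective fun z hz => ?_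
      have hz' : ‖z‖ < 1 := by simpa using hz
      rw [hardyEval_add _ _ hz', hardyEval_add _ _ hz', hardyEval_polyMul _ _ hz',
        hardyEval_polyMul _ _ hz', hardyEval_polySeq, hardyEval_polySeq]
      simp only [Polynomial.eval_add, Polynomial.eval_mul, Polynomial.eval_pow, Polynomial.eval_X,
        Polynomial.eval_C]
      linear_combination (-z ^ N) * mul_hardyEval_backShift y hz'

/-- A polynomial of degree less than `N` does not vanish to order `N` at `0`. -/
lemma eq_zero_of_eval_eq_pow_mul {q : Polynomial ℂ} {N : ℕ} (hq : q.degree < N) {G : ℂ → ℂ}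
    (hG : DifferentiableOn ℂ G (ball 0 1)) (h : ∀ z ∈ ball (0 : ℂ) 1, q.eval z = z ^ N * G z) :
    q = 0 := by
  by_contra hq0
  obtain ⟨p, hp, hpd⟩ := Polynomial.exists_eq_pow_rootMultiplicity_mul_and_not_dvd q hq0 0
  set m := q.rootMultiplicity 0 with hm
  simp only [map_zero, sub_zero] at hp hpd
  have hmN : m < N := by
    have h1 : m ≤ q.natDegree := by
      rw [hm, ← Polynomial.count_roots]
      exact (Multiset.count_le_card _ _).trans (Polynomial.card_roots' q)
    exact h1.trans_lt ((Polynomial.natDegree_lt_iff_degree_lt hq0).2 hq)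
  rw [Polynomial.X_dvd_iff, Polynomial.coeff_zero_eq_eval_zero] at hpd
  have hc : ContinuousAt G 0 := (hG.continuousOn.continuousAt (ball_mem_nhds _ one_pos))
  have h1 : Tendsto (fun z => z ^ (N - m) * G z) (𝓝[≠] 0) (𝓝 (0 ^ (N - m) * G 0)) :=
    ((continuousAt_id.pow _).mul hc).mono_left nhdsWithin_le_nhds
  have h2 : Tendsto (fun z => p.eval z) (𝓝[≠] 0) (𝓝 (p.eval 0)) :=
    p.continuous.continuousAt.mono_left nhdsWithin_le_nhds
  rw [zero_pow (Nat.sub_ne_zero_of_lt hmN), zero_mul] at h1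
  refine hpd (tendsto_nhds_unique (h2.congr' ?_) h1)
  filter_upwards [self_mem_nhdsWithin, mem_nhdsWithin_of_mem_nhds (ball_mem_nhds (0 : ℂ) one_pos)]
    with z hz hzb
  have h3 := h z hzb
  rw [hp, Polynomial.eval_mul, Polynomial.eval_pow, Polynomial.eval_X,
    ← Nat.add_sub_cancel' hmN.le, pow_add, mul_assoc] at h3
  exact mul_left_cancel₀ (pow_ne_zero m hz) h3

/-! ### Co-analytic Toeplitz operators with polynomial symbols -/

open Polynomial in
lemma Polynomial.induction_of_norm_root_eq_one {P : ℂ[X] → Prop} (hC : ∀ c, c ≠ 0 → P (C c))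
    (hmul : ∀ ζ b, ‖ζ‖ = 1 → b ≠ 0 → P b → P (b * (X - C ζ))) {a : ℂ[X]} (h0 : a ≠ 0)
    (ha : ∀ z, a.IsRoot z → ‖z‖ = 1) : P a := by
  induction hn : a.natDegree generalizing a with
  | zero =>
    rw [eq_C_of_natDegree_eq_zero hn] at h0 ⊢
    exact hC _ fun h => h0 (by rw [h, C_0])
  | succ n ih =>
    obtain ⟨ζ, hζ⟩ := IsAlgClosed.exists_root a (by
      rw [degree_eq_natDegree h0, hn]
      exact_mod_cast n.succ_ne_zero)
    obtain ⟨b, rfl⟩ := dvd_iff_isRoot.2 hζ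
    have hb : b ≠ 0 := right_ne_zero_of_mul h0
    rw [natDegree_mul (X_sub_C_ne_zero ζ) hb, natDegree_X_sub_C] at hn
    rw [mul_comm]
    exact hmul ζ b (ha ζ hζ) hb (ih hb (fun z hz => ha z (by
      rw [root_mul]
      exact Or.inr hz)) (by omega))

/-- The co-analytic Toeplitz operator with polynomial symbol on the coefficient space. -/
def conjMul (a : Polynomial ℂ) : HardySeq →L[ℂ] HardySeq :=
  ContinuousLinearMap.adjoint (polyMul a)

lemma conjMul_C (c : ℂ) (x : HardySeq) : conjMul (Polynomial.C c) x = conj c • x := by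
  refine ext_inner_left ℂ fun y => ?_
  rw [conjMul, ContinuousLinearMap.adjoint_inner_right, polyMul_C]
  simp [inner_smul_left, inner_smul_right]

lemma conjMul_mul_X_sub_C (b : Polynomial ℂ) (ζ : ℂ) (x : HardySeq) :
    conjMul (b * (Polynomial.X - Polynomial.C ζ)) x =
      backShift (conjMul b x) - conj ζ • conjMul b x := by
  refine ext_inner_left ℂ fun y => ?_
  rw [conjMul, ContinuousLinearMap.adjoint_inner_right, polyMul_mul, polyMul_X_sub_C, conjMul,
    inner_sub_right, inner_smul_right, backShift, ContinuousLinearMap.adjoint_inner_right,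
    ContinuousLinearMap.adjoint_inner_right, ContinuousLinearMap.adjoint_inner_right]
  simp [inner_sub_left, inner_smul_left]

/-- The identity `z ^ N * A x = κ * (a * x - p x)` for `A` the co-analytic Toeplitz operator with
symbol `a` of degree `N`, where `p x` is a polynomial of degree less than `N`. -/
structure IsRemainder (a : Polynomial ℂ) (κ : ℂ) (p : HardySeq →ₗ[ℂ] Polynomial ℂ) : Prop where
  ne_zero : a ≠ 0
  norm_root : ∀ z, a.IsRoot z → ‖z‖ = 1
  const_ne_zero : κ ≠ 0
  degree_lt : ∀ x, (p x).degree < a.degree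
  continuous_eval : ∀ ζ, Continuous fun x => (p x).eval ζ
  pow_mul_eq : ∀ x z, ‖z‖ < 1 → z ^ a.natDegree * hardyEval (conjMul a x) z =
    κ * (a.eval z * hardyEval x z - (p x).eval z)
  injective : Function.Injective (conjMul a)

lemma continuous_coeff (n : ℕ) : Continuous fun x : HardySeq => x n :=
  (lp.evalCLM ℂ (fun _ : ℕ => ℂ) 2 n).continuous

/-- Induction on the zeros. On the circle `conj (ξ - ζ) = -conj ζ * (ξ - ζ) / ξ`, so each linear
factor costs one power of `z` and multiplies `κ` by `-conj ζ`. -/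
lemma exists_isRemainder {a : Polynomial ℂ} (h0 : a ≠ 0) (ha : ∀ z, a.IsRoot z → ‖z‖ = 1) :
    ∃ κ p, IsRemainder a κ p := by
  refine Polynomial.induction_of_norm_root_eq_one (P := fun a => ∃ κ p, IsRemainder a κ p)
    ?_ ?_ h0 ha
  · intro c hc
    have hcc : conj c ≠ 0 := by simpa using hc
    refine ⟨conj c / c, 0, by simpa using hc, fun z hz => absurd (by simpa using hz) hc,
      div_ne_zero hcc hc, by simp [Polynomial.degree_C hc],
      fun ζ => by simpa using continuous_const, fun x z hz => ?_,
      fun x y h => ?_⟩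
    · rw [conjMul_C, hardyEval_smul _ _ hz]
      simp
      field_simp
    · simpa [conjMul_C, hcc] using h
  · rintro ζ b hζ hb ⟨κ, p, hp⟩
    have hζ0 : ζ ≠ 0 := norm_ne_zero_iff.1 (by rw [hζ]; exact one_ne_zero)
    have hζc : conj ζ * ζ = 1 := by
      rw [mul_comm, Complex.mul_conj, Complex.normSq_eq_norm_sq, hζ]
      simp
    have hζc0 : conj ζ ≠ 0 := by simpa using hζ0
    set κ' := -(conj ζ * κ) with hκ'
    have hκ0 : κ' ≠ 0 := neg_ne_zero.2 (mul_ne_zero hζc0 hp.const_ne_zero)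
    -- With `y = conjMul b x`, the relation `z * (backShift y) = y - y 0` adds a term in `y 0 * z ^
    -- b.natDegree` to the old remainder times `z - ζ`; both have degree below the new one.
    set p' : HardySeq →ₗ[ℂ] Polynomial ℂ :=
      LinearMap.mulLeft ℂ (Polynomial.X - Polynomial.C ζ) ∘ₗ p +
        (κ'⁻¹ • ((lp.evalCLM ℂ (fun _ : ℕ => ℂ) 2 0 ∘L conjMul b : HardySeq →L[ℂ] ℂ) :
          HardySeq →ₗ[ℂ] ℂ)).smulRight (Polynomial.X ^ b.natDegree) with hp'
    have hp'x : ∀ x, p' x = (Polynomial.X - Polynomial.C ζ) * p x +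
        (κ'⁻¹ * conjMul b x 0) • Polynomial.X ^ b.natDegree := fun x => rfl
    have hdeg : (b * (Polynomial.X - Polynomial.C ζ)).degree = b.degree + 1 := by
      rw [Polynomial.degree_mul, Polynomial.degree_X_sub_C]
    have hnat : (b * (Polynomial.X - Polynomial.C ζ)).natDegree = b.natDegree + 1 := by
      rw [Polynomial.natDegree_mul hb (Polynomial.X_sub_C_ne_zero ζ), Polynomial.natDegree_X_sub_C]
    refine ⟨κ', p', mul_ne_zero hb (Polynomial.X_sub_C_ne_zero ζ), ?_, hκ0, fun x => ?_,
      fun w => ?_, fun x z hz => ?_, ?_⟩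
    · intro z hz
      rw [Polynomial.root_mul] at hz
      rcases hz with hz | hz
      · exact hp.norm_root z hz
      · rw [← Polynomial.root_X_sub_C.1 hz, hζ]
    · rw [hp'x, hdeg]
      have hbd : b.degree < b.degree + 1 := by
        rw [Polynomial.degree_eq_natDegree hb]
        exact_mod_cast b.natDegree.lt_succ_self
      refine (Polynomial.degree_add_le _ _).trans_lt (max_lt ?_ ?_)
      · rw [mul_comm, Polynomial.degree_mul, Polynomial.degree_X_sub_C]
        exact WithBot.add_lt_add_right (by simp) (hp.degree_lt x)
      · refine (Polynomial.degree_smul_le _ _).trans_lt ?_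
        rwa [Polynomial.degree_X_pow, ← Polynomial.degree_eq_natDegree hb]
    · simp only [hp'x, Polynomial.eval_add, Polynomial.eval_mul, Polynomial.eval_smul]
      refine (continuous_const.mul (hp.continuous_eval w)).add ?_
      exact (continuous_const.mul ((continuous_coeff 0).comp (conjMul b).continuous)).smul
        continuous_const
    · rw [hnat, conjMul_mul_X_sub_C, hardyEval_sub _ _ hz, hardyEval_smul _ _ hz, hp'x]
      simp only [Polynomial.eval_add, Polynomial.eval_mul, Polynomial.eval_smul, smul_eq_mul,
        Polynomial.eval_sub, Polynomial.eval_X, Polynomial.eval_C, Polynomial.eval_pow]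
      have e1 := mul_hardyEval_backShift (conjMul b x) hz
      have e2 := hp.pow_mul_eq x z hz
      have e3 : κ' * κ'⁻¹ = 1 := mul_inv_cancel₀ hκ0
      rw [hκ'] at e3 ⊢
      linear_combination z ^ b.natDegree * e1 - (conj ζ * (z - ζ)) * e2 +
        (conjMul b x 0 * z ^ b.natDegree) * e3 -
        (z ^ b.natDegree * hardyEval (conjMul b x) z) * hζc
    -- A kernel vector makes `conjMul b x` an eigenvector of the backward shift with unimodular
    -- eigenvalue `conj ζ`.
    · rw [injective_iff_map_eq_zero]
      intro x hx
      rw [conjMul_mul_X_sub_C, sub_eq_zero] at hx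
      exact hp.injective ((backShift_sub_injective (by simpa using hζ) hx).trans (map_zero _).symm)

namespace IsRemainder

variable {a : Polynomial ℂ} {κ : ℂ} {p : HardySeq →ₗ[ℂ] Polynomial ℂ}

/-- Subtracting the identity for `h` leaves a polynomial of degree less than `N` equal to `z ^ N`
times an analytic function. It must vanish, and then the two functions agree off `0` and, by
continuity, at `0`. -/
lemma eq_of_pow_mul_eq (hp : IsRemainder a κ p) {F : ℂ → ℂ} (hF : DifferentiableOn ℂ F (ball 0 1))
    {h : HardySeq} {q : Polynomial ℂ} (hq : q.degree < a.degree)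
    (heq : ∀ z ∈ ball (0 : ℂ) 1,
      z ^ a.natDegree * F z = κ * (a.eval z * hardyEval h z - q.eval z)) :
    p h = q ∧ Set.EqOn (hardyEval (conjMul a h)) F (ball 0 1) := by
  have hd : DifferentiableOn ℂ (fun z => F z - hardyEval (conjMul a h) z) (ball 0 1) :=
    hF.sub (differentiableOn_hardyEval _)
  have h1 : ∀ z ∈ ball (0 : ℂ) 1, (Polynomial.C κ * (p h - q)).eval z =
      z ^ a.natDegree * (F z - hardyEval (conjMul a h) z) := by
    intro z hz
    rw [mul_sub (z ^ a.natDegree), heq z hz, hp.pow_mul_eq h z (by simpa using hz)]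
    simp only [Polynomial.eval_mul, Polynomial.eval_C, Polynomial.eval_sub]
    ring
  have h2 : Polynomial.C κ * (p h - q) = 0 := by
    refine eq_zero_of_eval_eq_pow_mul ?_ hd h1
    rw [Polynomial.degree_C_mul hp.const_ne_zero, ← Polynomial.degree_eq_natDegree hp.ne_zero]
    exact (Polynomial.degree_sub_le _ _).trans_lt (max_lt (hp.degree_lt h) hq)
  refine ⟨?_, ?_⟩
  · rw [mul_eq_zero, or_iff_right (by simpa using hp.const_ne_zero), sub_eq_zero] at h2
    exact h2
  · have h3 : ∀ z ∈ ball (0 : ℂ) 1, z ≠ 0 → hardyEval (conjMul a h) z = F z := by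
      intro z hz hz0
      have := h1 z hz
      rw [h2, Polynomial.eval_zero, eq_comm, mul_eq_zero, or_iff_right (pow_ne_zero _ hz0),
        sub_eq_zero] at this
      exact this.symm
    intro z hz
    by_cases hz0 : z = 0
    · subst hz0
      have c1 : ContinuousAt F 0 := hF.continuousOn.continuousAt (ball_mem_nhds _ one_pos)
      have c2 : ContinuousAt (hardyEval (conjMul a h)) 0 :=
        (differentiableOn_hardyEval _).continuousOn.continuousAt (ball_mem_nhds _ one_pos)
      refine tendsto_nhds_unique (c2.mono_left (nhdsWithin_le_nhds (s := {0}ᶜ)))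
        ((c1.mono_left (nhdsWithin_le_nhds (s := {0}ᶜ))).congr' ?_)
      filter_upwards [self_mem_nhdsWithin,
        mem_nhdsWithin_of_mem_nhds (ball_mem_nhds (0 : ℂ) one_pos)] with w hw hwb
      exact (h3 w hwb hw).symm
    · exact h3 z hz hz0

/-- Polynomials belong to the range. -/
lemma exists_conjMul_eq_eval (hp : IsRemainder a κ p) (G : Polynomial ℂ) : ∃ x,
    Set.EqOn (hardyEval (conjMul a x)) (fun z => G.eval z) (ball 0 1) ∧
    ∃ Q, p x = a * Q - Polynomial.C κ⁻¹ * Polynomial.X ^ a.natDegree * G := by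
  -- Dividing `κ⁻¹ X ^ N G` by `a` puts `G` in the required form: the quotient is the vector and
  -- minus the remainder is its polynomial. In particular `p x` is `-κ⁻¹ X ^ N G` modulo `a`.
  set R := Polynomial.C κ⁻¹ * Polynomial.X ^ a.natDegree * G with hR
  have hdiv : a * (R / a) + R % a = R := EuclideanDomain.div_add_mod R a
  have h := hp.eq_of_pow_mul_eq (F := fun z => G.eval z) (h := polySeq (R / a)) (q := -(R % a))
    G.differentiable.differentiableOn
    (by rw [Polynomial.degree_neg]; exact Polynomial.degree_mod_lt R hp.ne_zero) fun z hz => ?_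
  · refine ⟨_, h.2, R / a, ?_⟩
    rw [h.1]
    linear_combination -hdiv
  · have h1 := congrArg (Polynomial.eval z) hdiv
    have h2 : κ * κ⁻¹ = 1 := mul_inv_cancel₀ hp.const_ne_zero
    rw [hardyEval_polySeq]
    simp only [hR, Polynomial.eval_add, Polynomial.eval_mul, Polynomial.eval_C,
      Polynomial.eval_pow, Polynomial.eval_X, Polynomial.eval_neg] at h1 ⊢
    linear_combination (-κ) * h1 - (z ^ a.natDegree * G.eval z) * h2

end IsRemainder

/-! ### Multiplication on the range of a co-analytic Toeplitz operator -/

lemma conjMul_eq_of_eqOn {a : Polynomial ℂ} {κ : ℂ} {p : HardySeq →ₗ[ℂ] Polynomial ℂ}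
    (hp : IsRemainder a κ p) {x y : HardySeq}
    (h : Set.EqOn (hardyEval (conjMul a x)) (hardyEval (conjMul a y)) (ball 0 1)) : x = y :=
  hp.injective (hardyEval_injective h)

namespace IsRemainder

variable {a r : Polynomial ℂ} {κ : ℂ} {p : HardySeq →ₗ[ℂ] Polynomial ℂ} {ψ : ℂ → ℂ} {t : HardySeq}

/-- Since `ψ * p x = a * (t * p x) + r * p x`, the first term is absorbed into the vector and only
`r * p x`, reduced modulo `a`, remains. This is where the decomposition of `ψ` enters. -/
lemma exists_mul (hp : IsRemainder a κ p) (hψ : MemHInfty ψ)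
    (ht : ∀ z ∈ ball (0 : ℂ) 1, ψ z = a.eval z * hardyEval t z + r.eval z) (x : HardySeq) :
    ∃ y, (∀ z ∈ ball (0 : ℂ) 1,
      hardyEval (conjMul a y) z = ψ z * hardyEval (conjMul a x) z) ∧ a ∣ p x * r - p y := by
  have hdiv : a * ((p x * r) / a) + (p x * r) % a = p x * r := EuclideanDomain.div_add_mod _ a
  set Q := (p x * r) / a
  set s := (p x * r) % a
  have h := hp.eq_of_pow_mul_eq (F := fun z => ψ z * hardyEval (conjMul a x) z) (q := s)
    (h := hardyMul hψ x - polyMul (p x) t - polySeq Q)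
    (hψ.1.mul (differentiableOn_hardyEval _)) (Polynomial.degree_mod_lt _ hp.ne_zero)
    fun z hz => ?_
  · exact ⟨_, h.2, Q, by rw [h.1, ← hdiv]; ring⟩
  · have hz' : ‖z‖ < 1 := by simpa using hz
    have h1 := congrArg (Polynomial.eval z) hdiv
    rw [hardyEval_sub _ _ hz', hardyEval_sub _ _ hz', hardyEval_hardyMul _ _ hz',
      hardyEval_polyMul _ _ hz', hardyEval_polySeq]
    simp only [Polynomial.eval_add, Polynomial.eval_mul] at h1
    linear_combination ψ z * hp.pow_mul_eq x z hz' + κ * h1 -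
      κ * (p x).eval z * ht z hz

/-- The vectors of the coefficient space that represent multiples of `ψ`. -/
def mulDomain (a : Polynomial ℂ) (ψ : ℂ → ℂ) : Set HardySeq :=
  {y | ∃ x, ∀ z ∈ ball (0 : ℂ) 1,
    hardyEval (conjMul a y) z = ψ z * hardyEval (conjMul a x) z}

/-- Evaluation of the remainder at a common zero of `a` and `r` is a continuous functional that
kills all multiples of `ψ`. -/
lemma isCoprime_of_dense (hp : IsRemainder a κ p) (hψ : MemHInfty ψ)
    (ht : ∀ z ∈ ball (0 : ℂ) 1, ψ z = a.eval z * hardyEval t z + r.eval z)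
    (hd : Dense (mulDomain a ψ)) : IsCoprime a r := by
  rw [Polynomial.isCoprime_iff_aeval_ne_zero_of_isAlgClosed ℂ ℂ]
  by_contra! hζ
  obtain ⟨ζ, ha, hr⟩ := hζ
  rw [Polynomial.coe_aeval_eq_eval] at ha hr
  have hcl : IsClosed {y | (p y).eval ζ = 0} := isClosed_eq (hp.continuous_eval ζ) continuous_const
  have hsub : mulDomain a ψ ⊆ {y | (p y).eval ζ = 0} := by
    rintro y ⟨x, hx⟩
    obtain ⟨y', hy', c, hc⟩ := hp.exists_mul hψ ht x
    obtain rfl : y = y' := conjMul_eq_of_eqOn hp fun z hz => by rw [hx z hz, hy' z hz]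
    have := congrArg (Polynomial.eval ζ) hc
    simp only [Polynomial.eval_sub, Polynomial.eval_mul, ha, hr, mul_zero, zero_mul, zero_sub,
      neg_eq_zero] at this
    exact this
  -- The vector representing `1` has remainder `-κ⁻¹ ζ ^ N` at `ζ`, nonzero since `ζ` is on the
  -- circle.
  obtain ⟨y, -, Q, hQ⟩ := hp.exists_conjMul_eq_eval 1
  have hy : (p y).eval ζ = 0 := closure_minimal hsub hcl (hd y)
  have hζ0 : ζ ≠ 0 := by
    rintro rfl
    have := hp.norm_root 0 ha
    simp at this
  rw [hQ] at hy
  simp [ha, hζ0, hp.const_ne_zero] at hy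

/-- The range embeds continuously in `H^2` and contains `1`, so density in the range yields
approximation of `1` by multiples of `ψ` in `H^2`. -/
lemma isOuter_of_dense (hp : IsRemainder a κ p) (hψ : MemHInfty ψ)
    (hd : Dense (mulDomain a ψ)) : IsOuter ψ := by
  refine isOuter_of_approx hψ fun ε hε => ?_
  obtain ⟨y, hy, -⟩ := hp.exists_conjMul_eq_eval 1
  have hy1 : conjMul a y = hardyOne := hardyEval_injective fun z hz => by
    simp [hy hz, hardyEval_hardyOne]
  have hmem : conjMul a y ∈ closure (conjMul a '' mulDomain a ψ) :=
    image_closure_subset_closure_image (conjMul a).continuous (Set.mem_image_of_mem _ (hd y))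
  obtain ⟨_, ⟨w, ⟨x, hx⟩, rfl⟩, hw⟩ := Metric.mem_closure_iff.1 hmem ε hε
  refine ⟨conjMul a x, ?_⟩
  have : hardyMul hψ (conjMul a x) = conjMul a w := hardyEval_injective fun z hz => by
    rw [hardyEval_hardyMul _ _ (by simpa using hz), hx z hz]
  rwa [this, ← hy1, norm_sub_rev, ← dist_eq_norm]

lemma exists_orbit (hp : IsRemainder a κ p) (hψ : MemHInfty ψ)
    (ht : ∀ z ∈ ball (0 : ℂ) 1, ψ z = a.eval z * hardyEval t z + r.eval z) :
    ∃ u : ℕ → HardySeq, ∀ n, ∀ z ∈ ball (0 : ℂ) 1,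
      hardyEval (conjMul a (u n)) z = z ^ n * ψ z := by
  have : ∀ n : ℕ, ∃ y, ∀ z ∈ ball (0 : ℂ) 1, hardyEval (conjMul a y) z = z ^ n * ψ z := by
    intro n
    obtain ⟨x, hx, -⟩ := hp.exists_conjMul_eq_eval (Polynomial.X ^ n)
    obtain ⟨y, hy, -⟩ := hp.exists_mul hψ ht x
    exact ⟨y, fun z hz => by rw [hy z hz, hx hz]; simp [mul_comm]⟩
  choose u hu using this
  exact ⟨u, hu⟩

lemma span_orbit_subset (hp : IsRemainder a κ p) {u : ℕ → HardySeq}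
    (hu : ∀ n, ∀ z ∈ ball (0 : ℂ) 1, hardyEval (conjMul a (u n)) z = z ^ n * ψ z) :
    (Submodule.span ℂ (Set.range u) : Set HardySeq) ⊆ mulDomain a ψ := by
  intro y hy
  induction hy using Submodule.span_induction with
  | mem y hy =>
    obtain ⟨n, rfl⟩ := hy
    obtain ⟨x, hx, -⟩ := hp.exists_conjMul_eq_eval (Polynomial.X ^ n)
    exact ⟨x, fun z hz => by rw [hu n z hz, hx hz]; simp [mul_comm]⟩
  | zero => exact ⟨0, fun z hz => by simp [hardyEval_zero_left]⟩
  | add y y' _ _ h h' =>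
    obtain ⟨x, hx⟩ := h
    obtain ⟨x', hx'⟩ := h'
    refine ⟨x + x', fun z hz => ?_⟩
    have hz' : ‖z‖ < 1 := by simpa using hz
    rw [map_add, map_add, hardyEval_add _ _ hz', hardyEval_add _ _ hz', hx z hz, hx' z hz, mul_add]
  | smul c y _ h =>
    obtain ⟨x, hx⟩ := h
    refine ⟨c • x, fun z hz => ?_⟩
    have hz' : ‖z‖ < 1 := by simpa using hz
    rw [map_smul, map_smul, hardyEval_smul _ _ hz', hardyEval_smul _ _ hz', hx z hz, mul_left_comm]

lemma exists_mem_span_orbit {u : ℕ → HardySeq}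
    (hu : ∀ n, ∀ z ∈ ball (0 : ℂ) 1, hardyEval (conjMul a (u n)) z = z ^ n * ψ z)
    (Q : Polynomial ℂ) : ∃ y ∈ Submodule.span ℂ (Set.range u),
      ∀ z ∈ ball (0 : ℂ) 1, hardyEval (conjMul a y) z = Q.eval z * ψ z := by
  induction Q using Polynomial.induction_on' with
  | add P Q hP hQ =>
    obtain ⟨y, hy, h⟩ := hP
    obtain ⟨y', hy', h'⟩ := hQ
    refine ⟨y + y', Submodule.add_mem _ hy hy', fun z hz => ?_⟩
    rw [map_add, hardyEval_add _ _ (by simpa using hz), h z hz, h' z hz, Polynomial.eval_add,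
      add_mul]
  | monomial n c =>
    refine ⟨c • u n, Submodule.smul_mem _ _ (Submodule.subset_span ⟨n, rfl⟩), fun z hz => ?_⟩
    rw [map_smul, hardyEval_smul _ _ (by simpa using hz), hu n z hz, Polynomial.eval_monomial,
      mul_assoc]

/-- Multiples of `a * ψ` have remainder zero, and on them division by `a` turns the range norm into
an `H^2` norm, where outerness applies. -/
lemma polyMul_mem_closure_span_orbit (hp : IsRemainder a κ p) (hψ : MemHInfty ψ) (ho : IsOuter ψ)
    {u : ℕ → HardySeq}
    (hu : ∀ n, ∀ z ∈ ball (0 : ℂ) 1, hardyEval (conjMul a (u n)) z = z ^ n * ψ z) (y : HardySeq) :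
    polyMul (Polynomial.X ^ a.natDegree) y ∈
      (Submodule.span ℂ (Set.range u)).topologicalClosure := by
  rw [← SetLike.mem_coe, Submodule.topologicalClosure_coe]
  refine closure_mono ?_ (image_closure_subset_closure_image
    (polyMul (Polynomial.X ^ a.natDegree)).continuous
    (Set.mem_image_of_mem _ (ho.denseRange_polySeq hψ y)))
  rintro _ ⟨_, ⟨q, rfl⟩, rfl⟩
  -- The factor `a` makes the remainder zero: `a q ψ` is represented by `κ⁻¹ z ^ N ψ q`.
  obtain ⟨w, hw, h⟩ := exists_mem_span_orbit hu (a * q)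
  set v := polyMul (Polynomial.X ^ a.natDegree) (hardyMul hψ (polySeq q)) with hv
  have h1 := hp.eq_of_pow_mul_eq (h := κ⁻¹ • v) (q := 0)
    (F := fun z => (a * q).eval z * ψ z)
    ((a * q).differentiable.differentiableOn.mul hψ.1)
    (by simpa [bot_lt_iff_ne_bot] using hp.ne_zero) fun z hz => ?_
  · have h2 : w = κ⁻¹ • v := conjMul_eq_of_eqOn hp fun z hz => by rw [h z hz, h1.2 hz]
    have h3 : v = κ • w := by rw [h2, smul_inv_smul₀ hp.const_ne_zero]
    rw [h3]
    exact Submodule.smul_mem _ _ hw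
  · have hz' : ‖z‖ < 1 := by simpa using hz
    rw [hardyEval_smul _ _ hz', hv, hardyEval_polyMul _ _ hz', hardyEval_hardyMul _ _ hz',
      hardyEval_polySeq]
    have h2 : κ * κ⁻¹ = 1 := mul_inv_cancel₀ hp.const_ne_zero
    simp only [Polynomial.eval_mul, Polynomial.eval_pow, Polynomial.eval_X, Polynomial.eval_zero]
    linear_combination (-a.eval z * z ^ a.natDegree * ψ z * q.eval z) * h2

/-- Vectors without remainder vanish to order `N` at the origin. -/
lemma exists_polyMul_eq (hp : IsRemainder a κ p) {y : HardySeq} (hy : p y = 0) :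
    ∃ w, y = polyMul (Polynomial.X ^ a.natDegree) w := by
  obtain ⟨q, w, hq, rfl⟩ := exists_polySeq_add a.natDegree y
  set y := polySeq q + polyMul (Polynomial.X ^ a.natDegree) w with hyd
  refine ⟨w, ?_⟩
  have ha : ∀ z ∈ ball (0 : ℂ) 1, κ * a.eval z ≠ 0 := fun z hz h => by
    have h1 := hp.norm_root z ((mul_eq_zero.1 h).resolve_left hp.const_ne_zero)
    rw [mem_ball_zero_iff, h1] at hz
    exact lt_irrefl _ hz
  -- Zero remainder means `κ a y = z ^ N * conjMul a y`. As `a` has no zeros in the disc, `y` is `z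
  -- ^ N` times an analytic function, so its Taylor part `q` below order `N` vanishes.
  have hq0 : q = 0 := eq_zero_of_eval_eq_pow_mul hq
    (G := fun z => hardyEval (conjMul a y) z / (κ * a.eval z) - hardyEval w z)
    (((differentiableOn_hardyEval _).div ((a.differentiable.differentiableOn).const_mul κ) ha).sub
      (differentiableOn_hardyEval w)) fun z hz => by
    have hz' : ‖z‖ < 1 := by simpa using hz
    have h1 := hp.pow_mul_eq y z hz'
    rw [hy, hyd, hardyEval_add _ _ hz', hardyEval_polySeq, hardyEval_polyMul _ _ hz', ← hyd] at h1
    simp only [Polynomial.eval_zero, Polynomial.eval_pow, Polynomial.eval_X] at h1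
    have h2 := ha z hz
    rw [mul_sub, mul_div_assoc', h1, sub_zero, ← mul_assoc, mul_div_cancel_left₀ _ h2]
    ring
  rw [hyd, hq0, map_zero, zero_add]

/-- Modulo `z ^ N H^2`, already in the closure, only the remainder of `y` matters, and some
polynomial multiple of `ψ` has that remainder. -/
lemma dense_span_orbit (hp : IsRemainder a κ p) (hψ : MemHInfty ψ) (ho : IsOuter ψ)
    (hc : IsCoprime a r)
    (ht : ∀ z ∈ ball (0 : ℂ) 1, ψ z = a.eval z * hardyEval t z + r.eval z) {u : ℕ → HardySeq}
    (hu : ∀ n, ∀ z ∈ ball (0 : ℂ) 1, hardyEval (conjMul a (u n)) z = z ^ n * ψ z) :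
    Dense (Submodule.span ℂ (Set.range u) : Set HardySeq) := by
  intro y
  rw [← Submodule.topologicalClosure_coe, SetLike.mem_coe]
  -- The zeros of `a` have modulus one, so `X` is also invertible modulo `a`.
  have hX : IsCoprime a (Polynomial.X ^ a.natDegree * r) := by
    refine IsCoprime.mul_right (IsCoprime.pow_right ?_) hc
    rw [Polynomial.isCoprime_iff_aeval_ne_zero_of_isAlgClosed ℂ ℂ]
    intro z
    rw [or_iff_not_imp_left, not_not]
    intro hz
    have := hp.norm_root z (by simpa using hz)
    simpa using norm_ne_zero_iff.1 (this ▸ one_ne_zero)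
  obtain ⟨c, d, hcd⟩ := hX
  -- The product `Q ψ` has remainder `-κ⁻¹ X ^ N Q r` modulo `a`. As `d` inverts `X ^ N r`, this
  -- choice makes it `p y`.
  set Q : Polynomial ℂ := -(Polynomial.C κ * d * p y) with hQ
  obtain ⟨x, hx, P, hP⟩ := hp.exists_conjMul_eq_eval Q
  obtain ⟨w, hw, e, he⟩ := hp.exists_mul hψ ht x
  obtain ⟨w', hw', hs⟩ := exists_mem_span_orbit hu Q
  obtain rfl : w = w' := conjMul_eq_of_eqOn hp fun z hz => by
    rw [hw z hz, hs z hz, hx hz, mul_comm]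
  have hdvd : a ∣ p (y - w) := by
    have hκ : Polynomial.C κ⁻¹ * Polynomial.C κ = (1 : Polynomial ℂ) := by
      rw [← Polynomial.C_mul, inv_mul_cancel₀ hp.const_ne_zero, Polynomial.C_1]
    refine ⟨c * p y - P * r + e, ?_⟩
    rw [map_sub]
    linear_combination (-p y) * hcd + he - r * hP - (r * Polynomial.X ^ a.natDegree) *
      Polynomial.C κ⁻¹ * hQ - (Polynomial.X ^ a.natDegree * r * d * p y) * hκ
  obtain ⟨v, hv⟩ := hp.exists_polyMul_eq
    (Polynomial.eq_zero_of_dvd_of_degree_lt hdvd (hp.degree_lt _))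
  rw [← sub_add_cancel y w, hv]
  exact add_mem (hp.polyMul_mem_closure_span_orbit hψ ho hu v)
    (Submodule.le_topologicalClosure _ hw')

theorem dense_mulDomain_iff (hp : IsRemainder a κ p) (hψ : MemHInfty ψ)
    (ht : ∀ z ∈ ball (0 : ℂ) 1, ψ z = a.eval z * hardyEval t z + r.eval z) :
    Dense (mulDomain a ψ) ↔ IsOuter ψ ∧ IsCoprime a r := by
  refine ⟨fun h => ⟨hp.isOuter_of_dense hψ h, hp.isCoprime_of_dense hψ ht h⟩, fun ⟨ho, hc⟩ => ?_⟩
  obtain ⟨u, hu⟩ := hp.exists_orbit hψ ht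
  exact (hp.dense_span_orbit hψ ho hc ht hu).mono (hp.span_orbit_subset hu)

theorem dense_span_orbit_iff (hp : IsRemainder a κ p) (hψ : MemHInfty ψ)
    (ht : ∀ z ∈ ball (0 : ℂ) 1, ψ z = a.eval z * hardyEval t z + r.eval z) {u : ℕ → HardySeq}
    (hu : ∀ n, ∀ z ∈ ball (0 : ℂ) 1, hardyEval (conjMul a (u n)) z = z ^ n * ψ z) :
    Dense (Submodule.span ℂ (Set.range u) : Set HardySeq) ↔ IsOuter ψ ∧ IsCoprime a r :=
  ⟨fun h => (hp.dense_mulDomain_iff hψ ht).1 (h.mono (hp.span_orbit_subset hu)),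
    fun ⟨ho, hc⟩ => hp.dense_span_orbit hψ ho hc ht hu⟩

end IsRemainder

/-! ### The range space of a co-analytic Toeplitz operator -/

lemma circleIntegrable_conj_eval_mul (q : Polynomial ℂ) {G : ℂ → ℂ} (hG : CircleIntegrable G 0 1) :
    CircleIntegrable (fun ξ => conj (q.eval ξ) * G ξ) 0 1 := by
  refine IntervalIntegrable.continuousOn_mul hG (Continuous.continuousOn ?_)
  exact Complex.continuous_conj.comp (q.continuous.comp (continuous_circleMap 0 1))

lemma inner_polySeq_left (q : Polynomial ℂ) (x : HardySeq) : inner ℂ (polySeq q) x =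
    Real.circleAverage (fun ξ => conj (q.eval ξ) * radialLimit (hardyEval x) ξ) 0 1 := by
  obtain ⟨-, hG, -, hc, -⟩ := hardyEval_boundary x
  induction q using Polynomial.induction_on' with
  | add p q hp hq =>
    rw [map_add, inner_add_left, hp, hq, ← Real.circleAverage_add
      (circleIntegrable_conj_eval_mul p hG) (circleIntegrable_conj_eval_mul q hG)]
    congr 1
    ext ξ
    simp [add_mul]
  | monomial n c =>
    rw [polySeq_monomial, lp.inner_single_left, ← hc n]
    have : (fun ξ => conj ((Polynomial.monomial n c).eval ξ) * radialLimit (hardyEval x) ξ) =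
        fun ξ => conj c • (conj ξ ^ n * radialLimit (hardyEval x) ξ) := by
      ext ξ
      simp [mul_assoc]
    rw [this, Real.circleAverage_fun_smul]
    simp [mul_comm]

/-- The Cauchy integral and the adjoint have the same Taylor coefficients: both are inner products
with `a * z ^ n`, computed on the circle. -/
lemma eqOn_coToeplitz (a : Polynomial ℂ) {f : ℂ → ℂ} {x : HardySeq}
    (hf : Set.EqOn f (hardyEval x) (ball 0 1)) :
    Set.EqOn (coToeplitz (fun z => a.eval z) f) (hardyEval (conjMul a x)) (ball 0 1) := by
  intro z hz
  have hz' : ‖z‖ < 1 := by simpa using hz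
  have h1 : coToeplitz (fun z => a.eval z) f z = Real.circleAverage
      (fun ξ => (conj (a.eval ξ) * radialLimit (hardyEval x) ξ) / (1 - conj ξ * z)) 0 1 := by
    unfold coToeplitz rieszProjection
    refine Real.circleAverage_congr_sphere (fun ξ hξ => ?_)
    simp only
    rw [radialLimit_congr hf (by simpa using hξ)]
  have h2 := hasSum_circleAverage_div_one_sub
    (circleIntegrable_conj_eval_mul a (hardyEval_boundary x).2.1) Complex.continuous_conj
    (fun θ => by simp) hz'
  rw [h1]
  refine h2.unique ((hasSum_hardyEval (conjMul a x) hz').congr_fun fun n => ?_)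
  have h3 : conjMul a x n = inner ℂ (polySeq (Polynomial.X ^ n)) (conjMul a x) := by
    rw [← Polynomial.monomial_one_right_eq_X_pow, polySeq_monomial, lp.inner_single_left]
    simp
  rw [h3, conjMul, ContinuousLinearMap.adjoint_inner_right, polyMul_polySeq, inner_polySeq_left]
  congr 2
  ext ξ
  simp only [Polynomial.eval_mul, map_mul, Polynomial.eval_pow, Polynomial.eval_X, map_pow]
  ring

lemma mem_MBar_iff (a : Polynomial ℂ) {F : ℂ → ℂ} : F ∈ MBar (fun z => a.eval z) ↔
    ∃ x, Set.EqOn F (hardyEval (conjMul a x)) (ball 0 1) := by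
  constructor
  · rintro ⟨f, hf, hF⟩
    obtain ⟨x, hx⟩ := hf.exists_hardyEval
    exact ⟨x, hF.trans (eqOn_coToeplitz a hx)⟩
  · rintro ⟨x, hx⟩
    exact ⟨hardyEval x, memH2_hardyEval x, hx.trans (eqOn_coToeplitz a (Set.eqOn_refl _ _)).symm⟩

namespace IsRemainder

variable {a r : Polynomial ℂ} {κ : ℂ} {p : HardySeq →ₗ[ℂ] Polynomial ℂ} {ψ : ℂ → ℂ} {t : HardySeq}

/-- Injectivity leaves a single preimage up to equality on the disc, so the infimum is over one
value. -/
lemma rangeNorm_eq (hp : IsRemainder a κ p) {F : ℂ → ℂ} {x : HardySeq}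
    (hF : Set.EqOn F (hardyEval (conjMul a x)) (ball 0 1)) :
    rangeNorm (fun z => a.eval z) F = ‖x‖ := by
  have : {t | ∃ f, MemH2 f ∧ Set.EqOn F (coToeplitz (fun z => a.eval z) f) (ball 0 1) ∧
      t = h2Norm f} = {‖x‖} := by
    ext t
    simp only [Set.mem_ofPred_eq, Set.mem_singleton_iff]
    constructor
    · rintro ⟨f, hf, hFf, rfl⟩
      obtain ⟨y, hy⟩ := hf.exists_hardyEval
      rw [h2Norm_eq hy, conjMul_eq_of_eqOn hp (hF.symm.trans (hFf.trans (eqOn_coToeplitz a hy)))]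
    · rintro rfl
      exact ⟨hardyEval x, memH2_hardyEval x,
        hF.trans (eqOn_coToeplitz a (Set.eqOn_refl _ _)).symm, (h2Norm_eq (Set.eqOn_refl _ _)).symm⟩
  rw [rangeNorm, this, csInf_singleton]

lemma isDenseInMBar_iff (hp : IsRemainder a κ p) {S : Set (ℂ → ℂ)}
    (hS : S ⊆ MBar fun z => a.eval z) : IsDenseInMBar (fun z => a.eval z) S ↔
      Dense {y | ∃ G ∈ S, Set.EqOn G (hardyEval (conjMul a y)) (ball 0 1)} := by
  have hsub : ∀ {F G : ℂ → ℂ} {x y : HardySeq},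
      Set.EqOn F (hardyEval (conjMul a x)) (ball 0 1) →
      Set.EqOn G (hardyEval (conjMul a y)) (ball 0 1) →
      rangeNorm (fun z => a.eval z) (F - G) = dist x y := by
    intro F G x y hF hG
    rw [dist_eq_norm, hp.rangeNorm_eq]
    intro z hz
    rw [map_sub, hardyEval_sub _ _ (by simpa using hz), Pi.sub_apply, hF hz, hG hz]
  constructor
  · rintro ⟨-, h⟩ x
    rw [Metric.mem_closure_iff]
    intro ε hε
    obtain ⟨G, hG, hlt⟩ := h _ ((mem_MBar_iff a).2 ⟨x, Set.eqOn_refl _ _⟩) ε hε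
    obtain ⟨y, hy⟩ := (mem_MBar_iff a).1 (hS hG)
    exact ⟨y, ⟨G, hG, hy⟩, by rwa [hsub (Set.eqOn_refl _ _) hy] at hlt⟩
  · intro h
    refine ⟨hS, fun F hF ε hε => ?_⟩
    obtain ⟨x, hx⟩ := (mem_MBar_iff a).1 hF
    obtain ⟨y, ⟨G, hG, hy⟩, hlt⟩ := Metric.mem_closure_iff.1 (h x) ε hε
    exact ⟨G, hG, by rwa [hsub hx hy]⟩

lemma isMultiplier_MBar (hp : IsRemainder a κ p) (hψ : MemHInfty ψ)
    (ht : ∀ z ∈ ball (0 : ℂ) 1, ψ z = a.eval z * hardyEval t z + r.eval z) :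
    IsMultiplier (MBar fun z => a.eval z) ψ := by
  refine ⟨hψ.1, fun F hF => ?_⟩
  obtain ⟨x, hx⟩ := (mem_MBar_iff a).1 hF
  obtain ⟨y, hy, -⟩ := hp.exists_mul hψ ht x
  exact (mem_MBar_iff a).2 ⟨y, fun z hz => by rw [Pi.mul_apply, hy z hz, hx hz]⟩

lemma isDenseInMBar_mul_iff (hp : IsRemainder a κ p) (hψ : MemHInfty ψ)
    (ht : ∀ z ∈ ball (0 : ℂ) 1, ψ z = a.eval z * hardyEval t z + r.eval z) :
    IsDenseInMBar (fun z => a.eval z) {G | ∃ F ∈ MBar fun z => a.eval z, G = ψ * F} ↔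
      IsOuter ψ ∧ IsCoprime a r := by
  rw [hp.isDenseInMBar_iff, ← hp.dense_mulDomain_iff hψ ht]
  · refine iff_of_eq (congrArg Dense (Set.ext fun y => ⟨?_, ?_⟩))
    · rintro ⟨_, ⟨F, hF, rfl⟩, h⟩
      obtain ⟨x, hx⟩ := (mem_MBar_iff a).1 hF
      exact ⟨x, fun z hz => by rw [← h hz, Pi.mul_apply, hx hz]⟩
    · rintro ⟨x, hx⟩
      exact ⟨_, ⟨_, (mem_MBar_iff a).2 ⟨x, Set.eqOn_refl _ _⟩, rfl⟩, fun z hz => (hx z hz).symm⟩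
  · rintro _ ⟨F, hF, rfl⟩
    exact (hp.isMultiplier_MBar hψ ht).2 F hF

lemma isCyclicInMBar_iff (hp : IsRemainder a κ p) (hψ : MemHInfty ψ)
    (ht : ∀ z ∈ ball (0 : ℂ) 1, ψ z = a.eval z * hardyEval t z + r.eval z) :
    IsCyclicInMBar (fun z => a.eval z) ψ ↔ IsOuter ψ ∧ IsCoprime a r := by
  obtain ⟨u, hu⟩ := hp.exists_orbit hψ ht
  set S := Submodule.span ℂ (Set.range fun (n : ℕ) (z : ℂ) => z ^ n * ψ z) with hS
  have hmem : ∀ G ∈ S, ∃ y ∈ Submodule.span ℂ (Set.range u),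
      Set.EqOn G (hardyEval (conjMul a y)) (ball 0 1) := by
    intro G hG
    induction hG using Submodule.span_induction with
    | mem G hG =>
      obtain ⟨n, rfl⟩ := hG
      exact ⟨u n, Submodule.subset_span ⟨n, rfl⟩, fun z hz => (hu n z hz).symm⟩
    | zero => exact ⟨0, zero_mem _, fun z _ => by simp [hardyEval_zero_left]⟩
    | add G G' _ _ h h' =>
      obtain ⟨y, hy, e⟩ := h
      obtain ⟨y', hy', e'⟩ := h'
      refine ⟨y + y', add_mem hy hy', fun z hz => ?_⟩
      rw [map_add, hardyEval_add _ _ (by simpa using hz), Pi.add_apply, e hz, e' hz]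
    | smul c G _ h =>
      obtain ⟨y, hy, e⟩ := h
      refine ⟨c • y, Submodule.smul_mem _ _ hy, fun z hz => ?_⟩
      rw [map_smul, hardyEval_smul _ _ (by simpa using hz), Pi.smul_apply, e hz, smul_eq_mul]
  rw [IsCyclicInMBar, hp.isDenseInMBar_iff, ← hp.dense_span_orbit_iff hψ ht hu]
  · refine iff_of_eq (congrArg Dense (Set.ext fun y => ⟨?_, fun hy => ?_⟩))
    · rintro ⟨G, hG, h⟩
      obtain ⟨y', hy', h'⟩ := hmem G hG
      rwa [conjMul_eq_of_eqOn hp (h.symm.trans h')]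
    · induction hy using Submodule.span_induction with
      | mem y hy =>
        obtain ⟨n, rfl⟩ := hy
        exact ⟨_, Submodule.subset_span ⟨n, rfl⟩, fun z hz => (hu n z hz).symm⟩
      | zero => exact ⟨0, zero_mem _, fun z _ => by simp [hardyEval_zero_left]⟩
      | add y y' _ _ h h' =>
        obtain ⟨G, hG, e⟩ := h
        obtain ⟨G', hG', e'⟩ := h'
        refine ⟨G + G', add_mem hG hG', fun z hz => ?_⟩
        rw [map_add, hardyEval_add _ _ (by simpa using hz), Pi.add_apply, e hz, e' hz]
      | smul c y _ h =>
        obtain ⟨G, hG, e⟩ := h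
        refine ⟨c • G, Submodule.smul_mem _ _ hG, fun z hz => ?_⟩
        rw [map_smul, hardyEval_smul _ _ (by simpa using hz), Pi.smul_apply, e hz, smul_eq_mul]
  · intro G hG
    obtain ⟨y, -, h⟩ := hmem G hG
    exact (mem_MBar_iff a).2 ⟨y, h⟩

end IsRemainder

/-! ### Multiplication operators and their adjoints -/

lemma circleIntegrable_norm_sq_radialLimit (x : HardySeq) :
    CircleIntegrable (fun ξ => ‖radialLimit (hardyEval x) ξ‖ ^ 2) 0 1 :=
  (hardyEval_boundary x).2.2.1

lemma norm_sq_eq_circleAverage (x : HardySeq) :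
    ‖x‖ ^ 2 = Real.circleAverage (fun ξ => ‖radialLimit (hardyEval x) ξ‖ ^ 2) 0 1 :=
  norm_sq_eq_circleAverage_radialLimit (Set.eqOn_refl _ _)

lemma ae_radialLimit_hardyMul {f : ℂ → ℂ} (hf : MemHInfty f) (x : HardySeq) : ∀ᵐ θ : ℝ,
    radialLimit (hardyEval (hardyMul hf x)) (circleMap 0 1 θ) =
      radialLimit f (circleMap 0 1 θ) * radialLimit (hardyEval x) (circleMap 0 1 θ) := by
  filter_upwards [hf.memH2.ae_tendsto_radialLimit, (memH2_hardyEval x).ae_tendsto_radialLimit]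
    with θ h1 h2
  refine radialLimit_eq_of_tendsto ((h1.mul h2).congr' ?_)
  filter_upwards [eventually_radius_mem_ball (ξ := circleMap 0 1 θ) (by simp)] with ρ hρ
  rw [hardyEval_hardyMul hf x (by simpa using hρ)]

lemma ae_radialLimit_sub (x y : HardySeq) : ∀ᵐ θ : ℝ,
    radialLimit (hardyEval (x - y)) (circleMap 0 1 θ) =
      radialLimit (hardyEval x) (circleMap 0 1 θ) - radialLimit (hardyEval y) (circleMap 0 1 θ) := by
  filter_upwards [(memH2_hardyEval x).ae_tendsto_radialLimit,
    (memH2_hardyEval y).ae_tendsto_radialLimit] with θ h1 h2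
  refine radialLimit_eq_of_tendsto ((h1.sub h2).congr' ?_)
  filter_upwards [eventually_radius_mem_ball (ξ := circleMap 0 1 θ) (by simp)] with ρ hρ
  rw [hardyEval_sub x y (by simpa using hρ)]

lemma norm_hardyMul_eq_of_ae {f g : ℂ → ℂ} (hf : MemHInfty f) (hg : MemHInfty g)
    (h : ∀ᵐ θ : ℝ, ‖radialLimit f (circleMap 0 1 θ)‖ = ‖radialLimit g (circleMap 0 1 θ)‖)
    (x : HardySeq) : ‖hardyMul hf x‖ = ‖hardyMul hg x‖ := by
  rw [← sq_eq_sq₀ (norm_nonneg _) (norm_nonneg _), norm_sq_eq_circleAverage,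
    norm_sq_eq_circleAverage]
  refine circleAverage_congr_ae ?_
  filter_upwards [h, ae_radialLimit_hardyMul hf x, ae_radialLimit_hardyMul hg x] with θ h1 h2 h3
  rw [h2, h3, norm_mul, norm_mul, h1]

lemma norm_sq_add_norm_sq_hardyMul {a b : ℂ → ℂ} (ha : MemHInfty a) (hb : MemHInfty b)
    (h : ∀ᵐ θ : ℝ,
      ‖radialLimit a (circleMap 0 1 θ)‖ ^ 2 + ‖radialLimit b (circleMap 0 1 θ)‖ ^ 2 = 1)
    (x : HardySeq) : ‖hardyMul ha x‖ ^ 2 + ‖hardyMul hb x‖ ^ 2 = ‖x‖ ^ 2 := by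
  rw [norm_sq_eq_circleAverage, norm_sq_eq_circleAverage, norm_sq_eq_circleAverage,
    ← Real.circleAverage_add (circleIntegrable_norm_sq_radialLimit _)
    (circleIntegrable_norm_sq_radialLimit _)]
  refine circleAverage_congr_ae ?_
  filter_upwards [h, ae_radialLimit_hardyMul ha x, ae_radialLimit_hardyMul hb x] with θ h1 h2 h3
  rw [Pi.add_apply, h2, h3, norm_mul, norm_mul, mul_pow, mul_pow, ← add_mul, h1, one_mul]

/-- Multiplication operators on the Hardy space are hyponormal. -/
lemma norm_adjoint_hardyMul_le {b : ℂ → ℂ} (hb : MemHInfty b) (x : HardySeq) :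
    ‖ContinuousLinearMap.adjoint (hardyMul hb) x‖ ≤ ‖hardyMul hb x‖ := by
  set y := ContinuousLinearMap.adjoint (hardyMul hb) x with hy
  have hi := circleIntegrable_norm_sq_radialLimit
  -- Integrated form of `2 Re (conj β * ξ * conj η) ≤ |β ξ|² + |η|²` for boundary values. With `⟨b
  -- y, x⟩ = ‖y‖²` it yields `‖y‖ ≤ ‖b x‖`.
  have h1 : ‖x‖ ^ 2 + ‖hardyMul hb y‖ ^ 2 ≤
      ‖x - hardyMul hb y‖ ^ 2 + ‖hardyMul hb x‖ ^ 2 + ‖y‖ ^ 2 := by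
    simp only [norm_sq_eq_circleAverage]
    rw [← Real.circleAverage_add (hi _) (hi _), ← Real.circleAverage_add (hi _) (hi _),
      ← Real.circleAverage_add ((hi _).add (hi _)) (hi _)]
    refine circleAverage_mono_ae ((hi _).add (hi _)) (((hi _).add (hi _)).add (hi _)) ?_
    filter_upwards [ae_radialLimit_hardyMul hb x, ae_radialLimit_hardyMul hb y,
      ae_radialLimit_sub x (hardyMul hb y)] with θ e1 e2 e3
    simp only [Pi.add_apply]
    rw [e3, e1, e2]
    generalize radialLimit b (circleMap 0 1 θ) = β
    generalize radialLimit (hardyEval x) (circleMap 0 1 θ) = ξ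
    generalize radialLimit (hardyEval y) (circleMap 0 1 θ) = η
    have h2 := sq_nonneg (β.re * ξ.re + β.im * ξ.im - η.re)
    have h3 := sq_nonneg (β.re * ξ.im - β.im * ξ.re - η.im)
    simp only [← Complex.normSq_eq_norm_sq, Complex.normSq_apply, Complex.sub_re, Complex.sub_im,
      Complex.mul_re, Complex.mul_im]
    linarith
  have h2 : ‖x - hardyMul hb y‖ ^ 2 = ‖x‖ ^ 2 - 2 * ‖y‖ ^ 2 + ‖hardyMul hb y‖ ^ 2 := by
    rw [@norm_sub_sq ℂ, ← ContinuousLinearMap.adjoint_inner_left, ← hy, inner_self_eq_norm_sq]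
  exact le_of_sq_le_sq (by linarith) (norm_nonneg _)

lemma radialLimit_eval (p : Polynomial ℂ) {ξ : ℂ} (hξ : ‖ξ‖ = 1) :
    radialLimit (fun z => p.eval z) ξ = p.eval ξ :=
  radialLimit_of_continuousWithinAt hξ p.continuous.continuousWithinAt

lemma norm_polyMul_X_pow (n : ℕ) (x : HardySeq) : ‖polyMul (Polynomial.X ^ n) x‖ = ‖x‖ := by
  have h1 : polyMul (1 : Polynomial ℂ) x = x := by
    rw [← Polynomial.C_1, polyMul_C]
    simp
  conv_rhs => rw [← h1]
  refine norm_hardyMul_eq_of_ae _ _ (ae_of_all _ fun θ => ?_) x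
  rw [radialLimit_eval _ (by simp), radialLimit_eval _ (by simp)]
  simp

lemma conjMul_polyMul_X_pow (n : ℕ) (x : HardySeq) :
    conjMul (Polynomial.X ^ n) (polyMul (Polynomial.X ^ n) x) = x := by
  have := (ContinuousLinearMap.norm_map_iff_adjoint_comp_self _).1 (norm_polyMul_X_pow n)
  exact DFunLike.congr_fun this x

/-- The polynomial `z ^ M * conj (p (1 / conj z))`. -/
def conjReflect (M : ℕ) (p : Polynomial ℂ) : Polynomial ℂ :=
  Polynomial.reflect M (p.map (starRingEnd ℂ))

/-- On the circle `conj p * ξ ^ M` is already the polynomial `conjReflect M p`, so the projection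
does nothing. By linearity only monomials need checking. -/
lemma conjMul_eq_polyMul_conjReflect {M : ℕ} {p : Polynomial ℂ} (hp : p.natDegree ≤ M)
    (x : HardySeq) :
    conjMul p (polyMul (Polynomial.X ^ M) x) = polyMul (conjReflect M p) x := by
  refine Polynomial.induction_with_natDegree_le (fun p => conjMul p (polyMul (Polynomial.X ^ M) x) =
    polyMul (conjReflect M p) x) M ?_ ?_ ?_ p hp
  · have h0 : polyMul 0 = 0 := by
      rw [← Polynomial.C_0, polyMul_C]
      simp
    simp [conjMul, conjReflect, h0]
  · intro n c _ hn
    have h1 : conjMul (Polynomial.C c * Polynomial.X ^ n) =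
        conjMul (Polynomial.X ^ n) ∘L conjMul (Polynomial.C c) := by
      rw [conjMul, polyMul_mul, ContinuousLinearMap.adjoint_comp]
      rfl
    have h2 : (Polynomial.X ^ M : Polynomial ℂ) =
        Polynomial.X ^ n * Polynomial.X ^ (M - n) := by
      rw [← pow_add, Nat.add_sub_cancel' hn]
    rw [h1, ContinuousLinearMap.comp_apply, conjMul_C, map_smul, h2, polyMul_mul,
      ContinuousLinearMap.comp_apply, conjMul_polyMul_X_pow, conjReflect]
    simp only [Polynomial.map_mul, Polynomial.map_C, Polynomial.map_pow, Polynomial.map_X]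
    rw [Polynomial.reflect_C_mul_X_pow, Polynomial.revAt_le hn, polyMul_mul, polyMul_C]
    rfl
  · intro p q _ _ hp hq
    have h1 : ∀ p q : Polynomial ℂ, polyMul (p + q) = polyMul p + polyMul q := fun p q => by
      ext1 x
      refine hardyEval_injective fun z hz => ?_
      have hz' : ‖z‖ < 1 := by simpa using hz
      rw [add_apply, hardyEval_add _ _ hz', hardyEval_polyMul _ _ hz',
        hardyEval_polyMul _ _ hz', hardyEval_polyMul _ _ hz', Polynomial.eval_add, add_mul]
    have h2 : conjMul (p + q) = conjMul p + conjMul q := by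
      rw [conjMul, h1, map_add]
      rfl
    rw [h2, add_apply, hp, hq, conjReflect, conjReflect, conjReflect, Polynomial.map_add,
      Polynomial.reflect_add, h1, add_apply]

lemma conjReflect_eval_mul {M : ℕ} {p : Polynomial ℂ} (hp : p.natDegree ≤ M) {ξ : ℂ}
    (hξ : ‖ξ‖ = 1) : (conjReflect M p).eval ξ * conj ξ ^ M = conj (p.eval ξ) := by
  have h1 : ξ * conj ξ = 1 := by
    rw [Complex.mul_conj, Complex.normSq_eq_norm_sq, hξ]
    simp
  let : Invertible (conj ξ) := ⟨ξ, h1, by rw [mul_comm, h1]⟩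
  have h2 := Polynomial.eval₂_reflect_mul_pow (RingHom.id ℂ) (conj ξ) M (p.map (starRingEnd ℂ))
    (Polynomial.natDegree_map_le.trans hp)
  rw [Polynomial.eval₂_id, Polynomial.eval₂_id, Polynomial.eval_map_apply] at h2
  exact h2

lemma norm_conjReflect_eval {M : ℕ} {p : Polynomial ℂ} (hp : p.natDegree ≤ M) {ξ : ℂ}
    (hξ : ‖ξ‖ = 1) : ‖(conjReflect M p).eval ξ‖ = ‖p.eval ξ‖ := by
  have := congrArg norm (conjReflect_eval_mul hp hξ)
  simpa [hξ] using this

lemma norm_polyMul_conjReflect {M : ℕ} {p : Polynomial ℂ} (hp : p.natDegree ≤ M) (x : HardySeq) :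
    ‖polyMul (conjReflect M p) x‖ = ‖polyMul p x‖ := by
  refine norm_hardyMul_eq_of_ae _ _ (ae_of_all _ fun θ => ?_) x
  rw [radialLimit_eval _ (by simp), radialLimit_eval _ (by simp),
    norm_conjReflect_eval hp (by simp)]

lemma hardyMul_comm {f g : ℂ → ℂ} (hf : MemHInfty f) (hg : MemHInfty g) (x : HardySeq) :
    hardyMul hf (hardyMul hg x) = hardyMul hg (hardyMul hf x) :=
  hardyEval_injective fun z hz => by
    have hz' : ‖z‖ < 1 := by simpa using hz
    rw [hardyEval_hardyMul _ _ hz', hardyEval_hardyMul _ _ hz', hardyEval_hardyMul _ _ hz',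
      hardyEval_hardyMul _ _ hz', mul_left_comm]

/-- For a rational function `b = p / q`, the adjoint of the multiplication by `b` preserves the
norm of the multiples of the reflected denominator. -/
lemma norm_adjoint_hardyMul_conjReflect {b : ℂ → ℂ} (hb : MemHInfty b) {p q : Polynomial ℂ}
    (hpq : ∀ z ∈ ball (0 : ℂ) 1, b z * q.eval z = p.eval z) {M : ℕ} (hpM : p.natDegree ≤ M)
    (hqM : q.natDegree ≤ M) (x : HardySeq) :
    ‖ContinuousLinearMap.adjoint (hardyMul hb) (polyMul (conjReflect M q) x)‖ =
      ‖hardyMul hb (polyMul (conjReflect M q) x)‖ := by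
  have h1 : polyMul q ∘L hardyMul hb = polyMul p := by
    ext1 x
    refine hardyEval_injective fun z hz => ?_
    have hz' : ‖z‖ < 1 := by simpa using hz
    rw [ContinuousLinearMap.comp_apply, hardyEval_polyMul _ _ hz', hardyEval_hardyMul _ _ hz',
      hardyEval_polyMul _ _ hz', ← hpq z hz]
    ring
  -- The adjoint form of `b q = p`: on multiples of the reflected denominator, `conj b` acts by an
  -- analytic function and the projection loses no norm.
  have h2 : ContinuousLinearMap.adjoint (hardyMul hb) (polyMul (conjReflect M q) x) =
      polyMul (conjReflect M p) x := by
    rw [← conjMul_eq_polyMul_conjReflect hqM, ← conjMul_eq_polyMul_conjReflect hpM, conjMul,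
      ← ContinuousLinearMap.comp_apply, ← ContinuousLinearMap.adjoint_comp, h1, conjMul]
  rw [h2, norm_polyMul_conjReflect hpM, hardyMul_polyMul, norm_polyMul_conjReflect hqM, ← h1]
  rfl

/-! ### The defect of a rational function with a Pythagorean mate -/

lemma memHInfty_div {p q : Polynomial ℂ} (hq : ∀ z ∈ closedBall (0 : ℂ) 1, q.eval z ≠ 0) :
    MemHInfty fun z => p.eval z / q.eval z := by
  refine ⟨p.differentiable.differentiableOn.div q.differentiable.differentiableOn
    fun z hz => hq z (ball_subset_closedBall hz), ?_⟩
  obtain ⟨C, hC⟩ := (isCompact_closedBall (0 : ℂ) 1).exists_bound_of_continuousOn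
    (p.continuous.continuousOn.div q.continuous.continuousOn hq)
  exact ⟨C, fun z hz => hC z (ball_subset_closedBall hz)⟩

/-- A rational function that is bounded on the disc has no poles on the circle. -/
lemma IsRationalOnDisc.exists_denominator_ne_zero {b : ℂ → ℂ} (hr : IsRationalOnDisc b)
    (hb : ∀ z ∈ ball (0 : ℂ) 1, ‖b z‖ ≤ 1) : ∃ p q : Polynomial ℂ,
      (∀ z ∈ ball (0 : ℂ) 1, b z * q.eval z = p.eval z) ∧ ∀ ζ : ℂ, ‖ζ‖ = 1 → q.eval ζ ≠ 0 := by
  classical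
  obtain ⟨p, q, hpq⟩ := hr
  have hq0 : q ≠ 0 := by
    rintro rfl
    simpa using (hpq 0 (by simp)).1
  let _ : GCDMonoid (Polynomial ℂ) := EuclideanDomain.gcdMonoid _
  set g := GCDMonoid.gcd p q
  have hp' : g * (p / g) = p :=
    EuclideanDomain.mul_div_cancel' (gcd_ne_zero_of_right hq0) (gcd_dvd_left _ _)
  have hq' : g * (q / g) = q :=
    EuclideanDomain.mul_div_cancel' (gcd_ne_zero_of_right hq0) (gcd_dvd_right _ _)
  obtain ⟨u, v, huv⟩ : IsCoprime (p / g) (q / g) := isCoprime_div_gcd_div_gcd hq0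
  have hball : ∀ z ∈ ball (0 : ℂ) 1, b z * (q / g).eval z = (p / g).eval z := by
    intro z hz
    obtain ⟨h1, h2⟩ := hpq z hz
    rw [eq_div_iff h1] at h2
    rw [← hq', Polynomial.eval_mul] at h1
    have hg := left_ne_zero_of_mul h1
    refine mul_left_cancel₀ hg ?_
    rw [← hp', ← hq', Polynomial.eval_mul, Polynomial.eval_mul] at h2
    linear_combination h2
  refine ⟨p / g, q / g, hball, fun ζ hζ h => ?_⟩
  -- In lowest terms, `|p| ≤ |q|` persists on the closed disc, so a zero of `q` on the circle would
  -- be a common zero.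
  have hle : ∀ z ∈ closure (ball (0 : ℂ) 1), ‖(p / g).eval z‖ ≤ ‖(q / g).eval z‖ := by
    refine closure_minimal (fun z hz => ?_)
      (isClosed_le (p / g).continuous.norm (q / g).continuous.norm)
    change ‖(p / g).eval z‖ ≤ ‖(q / g).eval z‖
    rw [← hball z hz, norm_mul]
    exact mul_le_of_le_one_left (norm_nonneg _) (hb z hz)
  have h1 := hle ζ (by rw [closure_ball _ one_ne_zero]; simp [hζ])
  rw [h, norm_zero, norm_le_zero_iff] at h1
  have h2 := congrArg (Polynomial.eval ζ) huv
  simp [h, h1] at h2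

/-- The defect form of the adjoint of the multiplication by `b`. -/
def defect {b : ℂ → ℂ} (hb : MemHInfty b) (x : HardySeq) : ℝ :=
  ‖x‖ ^ 2 - ‖ContinuousLinearMap.adjoint (hardyMul hb) x‖ ^ 2

lemma norm_hardyMul_le {f : ℂ → ℂ} (hf : MemHInfty f) :
    ∃ C, 0 ≤ C ∧ ∀ x, ‖hardyMul hf x‖ ^ 2 ≤ C * ‖x‖ ^ 2 :=
  ⟨‖hardyMul hf‖ ^ 2, by positivity, fun x => by
    rw [← mul_pow]
    exact pow_le_pow_left₀ (norm_nonneg _) ((hardyMul hf).le_opNorm x) 2⟩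

/-- The parallelogram law for the nonnegative quadratic form. -/
lemma defect_add_le {b : ℂ → ℂ} (hb : MemHInfty b) (h0 : ∀ x, 0 ≤ defect hb x) (x y : HardySeq) :
    defect hb (x + y) ≤ 2 * defect hb x + 2 * defect hb y := by
  have h1 := h0 (x - y)
  have h2 := parallelogram_law_with_norm ℂ x y
  have h3 := parallelogram_law_with_norm ℂ (ContinuousLinearMap.adjoint (hardyMul hb) x)
    (ContinuousLinearMap.adjoint (hardyMul hb) y)
  simp only [defect, map_add, map_sub] at h1 ⊢
  linarith

/-- The lower bound is hyponormality: the form is at least `‖x‖² - ‖b x‖² = ‖a x‖²`, and `a / a₁` is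
invertible in `H^∞`. For the upper bound, equality holds on multiples of the reflected denominator,
which is coprime to `a₁`; a Bézout identity splits `x` accordingly. -/
lemma IsRemainder.exists_defect_bounds {a₁ : Polynomial ℂ} {κ : ℂ}
    {p : HardySeq →ₗ[ℂ] Polynomial ℂ} (hp : IsRemainder a₁ κ p) {a b : ℂ → ℂ}
    (hr : IsRationalOnDisc b) (hb1 : ∀ z ∈ ball (0 : ℂ) 1, ‖b z‖ ≤ 1) (hb : MemHInfty b)
    (hmate : IsPythagoreanMate a b) (hz : HasZeroPolynomial a a₁) :
    ∃ C, 0 ≤ C ∧ ∀ x, ‖polyMul a₁ x‖ ^ 2 ≤ C * defect hb x ∧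
      defect hb x ≤ C * ‖polyMul a₁ x‖ ^ 2 := by
  obtain ⟨⟨ha, -⟩, hae⟩ := hmate
  obtain ⟨P, Q, hPQ, haz⟩ := hz
  obtain ⟨pb, qb, hpq, hqb⟩ := hr.exists_denominator_ne_zero hb1
  have hpyth := norm_sq_add_norm_sq_hardyMul ha hb hae
  have hPQ1 : MemHInfty fun z => P.eval z / Q.eval z := memHInfty_div fun z hz => (hPQ z hz).2
  have hQP1 : MemHInfty fun z => Q.eval z / P.eval z := memHInfty_div fun z hz => (hPQ z hz).1
  have ha1 : ∀ x, hardyMul ha x = hardyMul hPQ1 (polyMul a₁ x) := fun x =>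
    hardyEval_injective fun z hz => by
      have hz' : ‖z‖ < 1 := by simpa using hz
      rw [hardyEval_hardyMul _ _ hz', hardyEval_hardyMul _ _ hz', hardyEval_polyMul _ _ hz',
        haz z hz]
      ring
  have ha2 : ∀ x, polyMul a₁ x = hardyMul hQP1 (hardyMul ha x) := fun x =>
    hardyEval_injective fun z hz => by
      have hz' : ‖z‖ < 1 := by simpa using hz
      obtain ⟨h1, h2⟩ := hPQ z (ball_subset_closedBall hz)
      rw [hardyEval_hardyMul _ _ hz', hardyEval_hardyMul _ _ hz', hardyEval_polyMul _ _ hz',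
        haz z hz]
      field_simp
  have hlow : ∀ x, ‖hardyMul ha x‖ ^ 2 ≤ defect hb x := fun x => by
    have h1 := pow_le_pow_left₀ (norm_nonneg _) (norm_adjoint_hardyMul_le hb x) 2
    have h2 := hpyth x
    rw [defect]
    linarith
  have h0 : ∀ x, 0 ≤ defect hb x := fun x => (sq_nonneg _).trans (hlow x)
  set M := max pb.natDegree qb.natDegree
  obtain ⟨u, v, huv⟩ : IsCoprime a₁ (conjReflect M qb) := by
    rw [Polynomial.isCoprime_iff_aeval_ne_zero_of_isAlgClosed ℂ ℂ]
    intro ζ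
    rw [or_iff_not_imp_left, not_not]
    intro hζ
    have hζ1 := hp.norm_root ζ (by simpa using hζ)
    rw [Polynomial.coe_aeval_eq_eval, ← norm_ne_zero_iff,
      norm_conjReflect_eval (le_max_right _ _) hζ1, norm_ne_zero_iff]
    exact hqb ζ hζ1
  obtain ⟨C₁, hC₁, h1⟩ := norm_hardyMul_le hQP1
  obtain ⟨C₂, hC₂, h2⟩ := norm_hardyMul_le hPQ1
  obtain ⟨C₃, hC₃, h3⟩ := norm_hardyMul_le (memHInfty_eval u)
  obtain ⟨C₄, hC₄, h4⟩ := norm_hardyMul_le (memHInfty_eval (conjReflect M qb * v))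
  refine ⟨C₁ + (2 * C₃ + 2 * (C₂ * C₄)), by positivity, fun x => ⟨?_, ?_⟩⟩
  · refine (?_ : _ ≤ C₁ * defect hb x).trans
      (mul_le_mul_of_nonneg_right (le_add_of_nonneg_right (by positivity)) (h0 x))
    rw [ha2 x]
    exact (h1 _).trans (mul_le_mul_of_nonneg_left (hlow x) hC₁)
  · refine (?_ : _ ≤ (2 * C₃ + 2 * (C₂ * C₄)) * ‖polyMul a₁ x‖ ^ 2).trans
      (mul_le_mul_of_nonneg_right (le_add_of_nonneg_left hC₁) (by positivity))
    -- The part `s` is already a multiple of `a₁ x`, so the trivial bound by `‖s‖²` suffices. On `k`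
    -- the form equals `‖a k‖²`.
    set s := polyMul u (polyMul a₁ x) with hs
    set k := polyMul (conjReflect M qb) (polyMul v x) with hk
    have hx : x = s + k := hardyEval_injective fun z hz => by
      have hz' : ‖z‖ < 1 := by simpa using hz
      have e := congrArg (Polynomial.eval z) huv
      rw [hardyEval_add _ _ hz', hs, hk, hardyEval_polyMul _ _ hz', hardyEval_polyMul _ _ hz',
        hardyEval_polyMul _ _ hz', hardyEval_polyMul _ _ hz']
      simp only [Polynomial.eval_add, Polynomial.eval_mul, Polynomial.eval_one] at e
      linear_combination (-hardyEval x z) * e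
    have hs1 : defect hb s ≤ C₃ * ‖polyMul a₁ x‖ ^ 2 := by
      refine le_trans ?_ (h3 (polyMul a₁ x))
      exact sub_le_self _ (sq_nonneg _)
    have hk1 : defect hb k ≤ C₂ * C₄ * ‖polyMul a₁ x‖ ^ 2 := by
      have e1 : defect hb k = ‖hardyMul ha k‖ ^ 2 := by
        rw [defect, hk, norm_adjoint_hardyMul_conjReflect hb hpq (le_max_left _ _)
          (le_max_right _ _), ← hpyth (polyMul (conjReflect M qb) (polyMul v x))]
        ring
      have e2 : polyMul a₁ k = polyMul (conjReflect M qb * v) (polyMul a₁ x) := by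
        rw [hk, polyMul_mul]
        simp only [polyMul, ContinuousLinearMap.comp_apply]
        rw [hardyMul_comm (memHInfty_eval a₁), hardyMul_comm (memHInfty_eval a₁)]
      rw [e1, ha1, e2, mul_assoc]
      exact (h2 _).trans (mul_le_mul_of_nonneg_left (h4 _) hC₂)
    have := defect_add_le hb h0 s k
    rw [← hx] at this
    linarith

/-! ### The de Branges--Rovnyak space -/

/-- The Szegő kernel function at a point of the disc. -/
def szego (w : ball (0 : ℂ) 1) : HardySeq :=
  ⟨fun n => conj (w : ℂ) ^ n, HardySeq.memℓp (by
    have hw : ‖(w : ℂ)‖ < 1 := mem_ball_zero_iff.1 w.2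
    simp only [norm_pow, RCLike.norm_conj, ← pow_mul, mul_comm _ 2]
    simp only [pow_mul]
    exact summable_geometric_of_lt_one (sq_nonneg _) (pow_lt_one₀ (norm_nonneg _) hw two_ne_zero))⟩

lemma inner_szego_left (w : ball (0 : ℂ) 1) (x : HardySeq) :
    inner ℂ (szego w) x = hardyEval x w := by
  rw [lp.inner_eq_tsum, hardyEval]
  congr 1
  ext n
  simp [szego]

lemma hardyEval_szego (w z : ball (0 : ℂ) 1) :
    hardyEval (szego w) z = 1 / (1 - conj (w : ℂ) * z) := by
  have hw : ‖(w : ℂ)‖ < 1 := mem_ball_zero_iff.1 w.2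
  have hz : ‖(z : ℂ)‖ < 1 := mem_ball_zero_iff.1 z.2
  have h1 : hardyEval (szego w) z = ∑' n : ℕ, (conj (w : ℂ) * z) ^ n := by
    rw [hardyEval]
    congr 1
    ext n
    simp [szego, mul_pow]
  rw [h1, tsum_geometric_of_norm_lt_one, one_div]
  rw [norm_mul, RCLike.norm_conj]
  exact mul_lt_one_of_nonneg_of_lt_one_left (norm_nonneg _) hw hz.le

lemma adjoint_hardyMul_szego {b : ℂ → ℂ} (hb : MemHInfty b) (w : ball (0 : ℂ) 1) :
    ContinuousLinearMap.adjoint (hardyMul hb) (szego w) = conj (b w) • szego w := by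
  refine ext_inner_right ℂ fun y => ?_
  rw [ContinuousLinearMap.adjoint_inner_left, inner_smul_left, inner_szego_left, inner_szego_left,
    hardyEval_hardyMul _ _ (mem_ball_zero_iff.1 w.2), RCLike.conj_conj]

lemma denseRange_linearCombination {ι E : Type*} [NormedAddCommGroup E] [InnerProductSpace ℂ E]
    [CompleteSpace E] {v : ι → E} (h : ∀ x, (∀ i, inner ℂ (v i) x = 0) → x = 0) :
    DenseRange (Finsupp.linearCombination ℂ v) := by
  have : (LinearMap.range (Finsupp.linearCombination ℂ v)).topologicalClosure = ⊤ := by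
    rw [Submodule.topologicalClosure_eq_top_iff, Submodule.eq_bot_iff]
    intro x hx
    refine h x fun i => Submodule.inner_right_of_mem_orthogonal
      (K := LinearMap.range (Finsupp.linearCombination ℂ v)) ⟨Finsupp.single i 1, by simp⟩ hx
  rwa [← Submodule.dense_iff_topologicalClosure_eq_top] at this

section

variable {H : Type*} [NormedAddCommGroup H] [InnerProductSpace ℂ H] [CompleteSpace H]
  [RKHS ℂ H (ball (0 : ℂ) 1) ℂ]

/-- Szegő kernels are eigenvectors of the adjoint of multiplication by `b`, with eigenvalue `conj (b
w)`, so the defect form has the kernel of `H` as its Gram matrix. -/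
lemma IsDeBrangesRovnyak.inner_linearCombination {b : ℂ → ℂ} (hH : IsDeBrangesRovnyak H b)
    (hb : MemHInfty b) (c d : ball (0 : ℂ) 1 →₀ ℂ) :
    inner ℂ (Finsupp.linearCombination ℂ (fun w => RKHS.kerFun H w 1) c)
      (Finsupp.linearCombination ℂ (fun w => RKHS.kerFun H w 1) d) =
    inner ℂ (Finsupp.linearCombination ℂ szego c) (Finsupp.linearCombination ℂ szego d) -
      inner ℂ (ContinuousLinearMap.adjoint (hardyMul hb) (Finsupp.linearCombination ℂ szego c))
        (ContinuousLinearMap.adjoint (hardyMul hb) (Finsupp.linearCombination ℂ szego d)) := by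
  induction c using Finsupp.induction_linear with
  | zero => simp
  | add c c' h h' =>
    simp only [map_add, inner_add_left, h, h']
    ring
  | single w α =>
    induction d using Finsupp.induction_linear with
    | zero => simp
    | add d d' h h' =>
      simp only [map_add, inner_add_right, h, h']
      ring
    | single v β =>
      simp only [Finsupp.linearCombination_single, map_smul, inner_smul_left, inner_smul_right,
        adjoint_hardyMul_szego, inner_szego_left, hardyEval_szego, RKHS.kerFun_inner,
        RKHS.kerFun_apply, hH w v]
      simp
      ring

lemma IsDeBrangesRovnyak.norm_sq_linearCombination {b : ℂ → ℂ} (hH : IsDeBrangesRovnyak H b)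
    (hb : MemHInfty b) (c : ball (0 : ℂ) 1 →₀ ℂ) :
    ‖Finsupp.linearCombination ℂ (fun w => RKHS.kerFun H w 1) c‖ ^ 2 =
      defect hb (Finsupp.linearCombination ℂ szego c) := by
  have h := congrArg Complex.re (hH.inner_linearCombination hb c c)
  rw [Complex.sub_re] at h
  have h1 : ∀ x : HardySeq, (inner ℂ x x).re = ‖x‖ ^ 2 := fun x => inner_self_eq_norm_sq (𝕜 := ℂ) x
  have h2 : ∀ x : H, (inner ℂ x x).re = ‖x‖ ^ 2 := fun x => inner_self_eq_norm_sq (𝕜 := ℂ) x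
  rw [h1, h1, h2] at h
  exact h

/-- The de Branges--Rovnyak space of a rational function is the range of the co-analytic Toeplitz
operator whose symbol is the zero polynomial of the Pythagorean mate. -/
theorem IsRemainder.exists_equiv {a₁ : Polynomial ℂ} {κ : ℂ}
    {p : HardySeq →ₗ[ℂ] Polynomial ℂ} (hp : IsRemainder a₁ κ p) {a b : ℂ → ℂ}
    (hr : IsRationalOnDisc b) (hb1 : ∀ z ∈ ball (0 : ℂ) 1, ‖b z‖ ≤ 1) (hb : MemHInfty b)
    (hmate : IsPythagoreanMate a b) (hz : HasZeroPolynomial a a₁) (hH : IsDeBrangesRovnyak H b) :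
    ∃ T : H ≃L[ℂ] HardySeq, ∀ (h : H) (w : ball (0 : ℂ) 1), h w = hardyEval (conjMul a₁ (T h)) w := by
  obtain ⟨C, hC0, hC⟩ := hp.exists_defect_bounds hr hb1 hb hmate hz
  have he₁ : DenseRange (Finsupp.linearCombination ℂ fun w => RKHS.kerFun H w (1 : ℂ)) := by
    refine denseRange_linearCombination fun h hh => RKHS.ext fun w => ?_
    simpa using hh w
  set e₂ := Finsupp.linearCombination ℂ fun w => polyMul a₁ (szego w) with he₂d
  -- A vector orthogonal to every `a₁ * szego w` has `conjMul a₁ x = 0` on the disc, and that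
  -- operator is injective.
  have he₂ : DenseRange e₂ := by
    refine denseRange_linearCombination fun x hx => hp.injective (hardyEval_injective fun w hw => ?_)
    rw [map_zero, hardyEval_zero_left, ← hx ⟨w, hw⟩, ← ContinuousLinearMap.adjoint_inner_right,
      inner_szego_left, conjMul]
  have he₂x : ∀ c, e₂ c = polyMul a₁ (Finsupp.linearCombination ℂ szego c) := fun c => by
    rw [← ContinuousLinearMap.coe_coe, Finsupp.apply_linearCombination]
    rfl
  have hs : ∀ {s t : ℝ}, 0 ≤ t → s ^ 2 ≤ C * t ^ 2 → s ≤ √C * t := fun ht h =>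
    Real.le_sqrt_of_sq_le h |>.trans_eq (by rw [Real.sqrt_mul hC0, Real.sqrt_sq ht])
  have hn₁ : ∃ K, ∀ c, ‖e₂ (LinearEquiv.refl ℂ _ c)‖ ≤
      K * ‖Finsupp.linearCombination ℂ (fun w => RKHS.kerFun H w (1 : ℂ)) c‖ := by
    refine ⟨√C, fun c => hs (norm_nonneg _) ?_⟩
    rw [hH.norm_sq_linearCombination hb, LinearEquiv.refl_apply, he₂x]
    exact (hC _).1
  have hn₂ : ∃ K, ∀ c, ‖Finsupp.linearCombination ℂ (fun w => RKHS.kerFun H w (1 : ℂ))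
      ((LinearEquiv.refl ℂ _).symm c)‖ ≤ K * ‖e₂ c‖ := by
    refine ⟨√C, fun c => hs (norm_nonneg _) ?_⟩
    rw [LinearEquiv.refl_symm, LinearEquiv.refl_apply, hH.norm_sq_linearCombination hb, he₂x]
    exact (hC _).2
  -- The comparison of norms extends `k_w ↦ a₁ * szego w` from the dense spans to an isomorphism.
  let L : H ≃L[ℂ] HardySeq := (LinearEquiv.refl ℂ _).extend _ e₂ he₁ hn₁ he₂ hn₂
  have hL : ∀ w, L.symm (polyMul a₁ (szego w)) = RKHS.kerFun H w 1 := fun w => by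
    have := LinearEquiv.extend_symm_eq (LinearEquiv.refl ℂ _)
      (Finsupp.linearCombination ℂ fun w => RKHS.kerFun H w (1 : ℂ)) e₂ he₁ hn₁ he₂ hn₂
      (Finsupp.single w 1)
    simpa [he₂d] using this
  have hA : (L : H →L[ℂ] HardySeq).adjoint ∘L (L.symm : HardySeq →L[ℂ] H).adjoint = .id ℂ H := by
    rw [← ContinuousLinearMap.adjoint_comp, L.coe_symm_comp_coe, ContinuousLinearMap.adjoint_id]
  have hB : (L.symm : HardySeq →L[ℂ] H).adjoint ∘L (L : H →L[ℂ] HardySeq).adjoint =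
      .id ℂ HardySeq := by
    rw [← ContinuousLinearMap.adjoint_comp, L.coe_comp_coe_symm, ContinuousLinearMap.adjoint_id]
  -- The isomorphism sought is the adjoint of the inverse of `L`: moving it across `h w = ⟨k_w, h⟩`
  -- gives `⟨a₁ * szego w, T h⟩`, the value of `conjMul a₁ (T h)` at `w`.
  refine ⟨ContinuousLinearEquiv.equivOfInverse (L.symm : HardySeq →L[ℂ] H).adjoint
    (L : H →L[ℂ] HardySeq).adjoint (DFunLike.congr_fun hA) (DFunLike.congr_fun hB), fun h w => ?_⟩
  have h1 : h w = inner ℂ (RKHS.kerFun H w 1) h := by simp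
  rw [h1, ← hL w, ← inner_szego_left, conjMul, ContinuousLinearMap.adjoint_inner_right]
  exact (ContinuousLinearMap.adjoint_inner_right (L.symm : HardySeq →L[ℂ] H) _ _).symm

end

/-! ### Transfer of density and cyclicity along the isomorphism. -/

section

variable {H : Type*} [NormedAddCommGroup H] [InnerProductSpace ℂ H]
  [RKHS ℂ H (ball (0 : ℂ) 1) ℂ]

lemma ContinuousLinearEquiv.dense_preimage_iff {E F : Type*} [NormedAddCommGroup E]
    [NormedSpace ℂ E] [NormedAddCommGroup F] [NormedSpace ℂ F] (T : E ≃L[ℂ] F) {S : Set F} :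
    Dense (T ⁻¹' S) ↔ Dense S := by
  refine ⟨fun h => ?_, fun h => h.preimage T.toHomeomorph.isOpenMap⟩
  have := h.preimage T.symm.toHomeomorph.isOpenMap
  simpa [← Set.preimage_comp] using this

lemma IsRemainder.deBrangesRovnyak {a r : Polynomial ℂ} {κ : ℂ}
    {p : HardySeq →ₗ[ℂ] Polynomial ℂ} {ψ : ℂ → ℂ} {t : HardySeq} (hp : IsRemainder a κ p)
    (hψ : MemHInfty ψ)
    (ht : ∀ z ∈ ball (0 : ℂ) 1, ψ z = a.eval z * hardyEval t z + r.eval z) {T : H ≃L[ℂ] HardySeq}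
    (hT : ∀ (h : H) (w : ball (0 : ℂ) 1), h w = hardyEval (conjMul a (T h)) w) :
    IsMultiplierOf H ψ ∧ (Dense (mulSet H ψ) ↔ IsOuter ψ ∧ IsCoprime a r) ∧
      (IsCyclicIn H ψ ↔ IsOuter ψ ∧ IsCoprime a r) := by
  refine ⟨⟨hψ.1, fun f => ?_⟩, ?_, ?_⟩
  · obtain ⟨y, hy, -⟩ := hp.exists_mul hψ ht (T f)
    exact ⟨T.symm y, fun z => by rw [hT, hT, T.apply_symm_apply, hy z z.2]⟩
  · rw [← hp.dense_mulDomain_iff hψ ht, ← T.dense_preimage_iff]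
    refine iff_of_eq (congrArg Dense (Set.ext fun g => ⟨?_, ?_⟩))
    · rintro ⟨f, hf⟩
      exact ⟨T f, fun z hz => by simpa only [hT] using hf ⟨z, hz⟩⟩
    · rintro ⟨x, hx⟩
      exact ⟨T.symm x, fun z => by rw [hT, hT, T.apply_symm_apply, hx z z.2]⟩
  · have hspan : ∀ u : ℕ → H, (Submodule.span ℂ (Set.range u) : Set H) =
        T ⁻¹' (Submodule.span ℂ (Set.range (T ∘ u)) : Set HardySeq) := fun u => by
      have : (Submodule.span ℂ (Set.range (T ∘ u)) : Set HardySeq) =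
          T '' (Submodule.span ℂ (Set.range u) : Set H) := by
        rw [Set.range_comp]
        exact congrArg SetLike.coe
          (Submodule.map_span (T.toLinearEquiv : H →ₗ[ℂ] HardySeq) (Set.range u)).symm
      rw [this, Set.preimage_image_eq _ T.injective]
    constructor
    · rintro ⟨u, hu, hd⟩
      rw [hspan, T.dense_preimage_iff, hp.dense_span_orbit_iff hψ ht fun n z hz => ?_] at hd
      · exact hd
      · rw [Function.comp_apply, ← hT (u n) ⟨z, hz⟩, hu]
    · intro h
      obtain ⟨u, hu⟩ := hp.exists_orbit hψ ht
      have hTu : T ∘ (T.symm ∘ u) = u := by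
        ext1 n
        simp
      refine ⟨T.symm ∘ u, fun n z => ?_, ?_⟩
      · rw [hT, Function.comp_apply, T.apply_symm_apply, hu n z z.2]
      · rw [hspan, T.dense_preimage_iff, hTu, hp.dense_span_orbit_iff hψ ht hu]
        exact h

end

lemma IsRationalOnDisc.differentiableOn {b : ℂ → ℂ} (hr : IsRationalOnDisc b) :
    DifferentiableOn ℂ b (ball 0 1) := by
  obtain ⟨p, q, hpq⟩ := hr
  exact (p.differentiable.differentiableOn.div q.differentiable.differentiableOn
    fun z hz => (hpq z hz).1).congr fun z hz => (hpq z hz).2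

lemma MemHInfty.add {f g : ℂ → ℂ} (hf : MemHInfty f) (hg : MemHInfty g) :
    MemHInfty fun z => f z + g z := by
  obtain ⟨hfd, C, hC⟩ := hf
  obtain ⟨hgd, D, hD⟩ := hg
  exact ⟨hfd.add hgd, C + D, fun z hz => norm_add_le_of_le (hC z hz) (hD z hz)⟩

end

theorem mainTheorem4
    (a₁ : Polynomial ℂ) (ha₁ : ∀ z : ℂ, a₁.IsRoot z → ‖z‖ = 1)
    (ψt : ℂ → ℂ) (hψt : MemH2 ψt) (hbdd : MemHInfty (fun z => a₁.eval z * ψt z))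
    (r : Polynomial ℂ) (hr : r.degree < a₁.degree)
    (ψ : ℂ → ℂ) (hψ : ∀ z ∈ ball (0 : ℂ) 1, ψ z = a₁.eval z * ψt z + r.eval z) :
    (IsMultiplier (MBar fun z => a₁.eval z) ψ ∧
      (IsDenseInMBar (fun z => a₁.eval z) {G | ∃ F ∈ MBar fun z => a₁.eval z, G = ψ * F} ↔
        IsOuter ψ ∧ IsCoprime a₁ r) ∧
      (IsCyclicInMBar (fun z => a₁.eval z) ψ ↔ IsOuter ψ ∧ IsCoprime a₁ r)) ∧
    ∀ (b a : ℂ → ℂ), IsRationalOnDisc b → (∀ z ∈ ball (0 : ℂ) 1, ‖b z‖ ≤ 1) →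
      IsPythagoreanMate a b → HasZeroPolynomial a a₁ →
      ∀ (H : Type*) [NormedAddCommGroup H] [InnerProductSpace ℂ H] [CompleteSpace H]
        [RKHS ℂ H (ball (0 : ℂ) 1) ℂ], IsDeBrangesRovnyak H b →
        IsMultiplierOf H ψ ∧
        (Dense (mulSet H ψ) ↔ IsOuter ψ ∧ IsCoprime a₁ r) ∧
        (IsCyclicIn H ψ ↔ IsOuter ψ ∧ IsCoprime a₁ r) := by
  -- The zero polynomial has degree `⊥`, so the strict bound on the degree of `r` excludes `a₁ = 0`,
  -- and it forces `r = 0` when `a₁` is constant.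
  have h0 : a₁ ≠ 0 := by
    rintro rfl
    simp at hr
  obtain ⟨κ, p, hp⟩ := exists_isRemainder h0 ha₁
  obtain ⟨t, ht⟩ := hψt.exists_hardyEval
  have hψH : MemHInfty ψ := (hbdd.add (memHInfty_eval r)).congr hψ
  have hψe : ∀ z ∈ ball (0 : ℂ) 1, ψ z = a₁.eval z * hardyEval t z + r.eval z := fun z hz => by
    rw [hψ z hz, ht hz]
  refine ⟨⟨hp.isMultiplier_MBar hψH hψe, hp.isDenseInMBar_mul_iff hψH hψe,
    hp.isCyclicInMBar_iff hψH hψe⟩, ?_⟩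
  intro b a hrat hb1 hmate hzero H _ _ _ _ hH
  obtain ⟨T, hT⟩ := hp.exists_equiv hrat hb1 ⟨hrat.differentiableOn, 1, hb1⟩ hmate hzero hH
  exact hp.deBrangesRovnyak hψH hψe hT
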